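/- Let $d\in\mathbb N$ and $2<p,r\le\infty$ be such that $\frac d2-\frac2p-\frac dr>0$ (with $\frac1\infty=0$), and let $p',r'$ be the conjugate exponents. Write $\mathbb T=\mathbb R/\mathbb Z$. Fix a smooth even function $\phi:\mathbb R\to\mathbb R$ with $\phi(x)=1$ for $|x|\le1$ and $\phi(x)=0$ for $|x|\ge2$. For $\theta=(\theta_1,\dots,\theta_d)\in(0,1]^d$ and $N\in\{1,2,4,8,\dots\}$ put $$K_N(t,x)=\sum_{k\in\mathbb Z^d}\ \prod_{j=1}^d\phi\bigl(\tfrac{k_j}N\bigr)\,e^{2\pi i[k_jx_j-t\theta_jk_j^2]},\qquad t\in\mathbb R,\ x\in\mathbb T^d .$$ For $\sigma>0$ and $J=[0,1]$ or $J=[-1,1]$, let $\mathcal T$ be the set of those $t\in J$ for which there are $j\in\{1,\dots,d\}$ and integers $a$ and $q\ge1$ with $\gcd(a,q)=1$, $q\le N^{2\sigma}$ and $qN^2\bigl|\theta_jt-\frac aq\bigr|\le N^{2\sigma}$, and put $\tilde K_N(t,x)=\chi_{\mathcal T}(t)\,K_N(t,x)$. For $F\in L^{p'}_tL^{r'}_x([0,1]\times\mathbb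 T^d)$ let $$(\tilde K_N*F)(t,x)=\int_0^1\!\int_{\mathbb T^d}\tilde K_N(t-s,x-y)\,F(s,y)\,dy\,ds .$$ There is $\sigma_0>0$, depending only on $(d,p,r)$, such that for every $0<\sigma\le\sigma_0$, for both choices of $J$, for all $\theta$, $N$ and $F$ as above, the integral defining $\tilde K_N*F$ converges absolutely for every $t$ and $x$, $\tilde K_N*F$ is measurable, and $$\|\tilde K_N*F\|_{L^p_tL^r_x([0,1]\times\mathbb T^d)}\le C\,N^{2\left(\frac d2-\frac2p-\frac dr\right)}\,\|F\|_{L^{p'}_tL^{r'}_x([0,1]\times\mathbb T^d)},$$ where $C>0$ depends only on $d$, $p$, $r$, $\phi$ and a positive lower bound for $\theta_1,\dots,\theta_d$. -/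

import Mathlib

open MeasureTheory
open scoped ENNReal ContDiff

namespace TorusStrichartz

noncomputable section

/-- A smooth, even (that is, radial on `ℝ`) cutoff function which equals `1` on `[-1, 1]` and
vanishes outside `(-2, 2)`. -/
structure IsCutoff (φ : ℝ → ℝ) : Prop where
  smooth : ContDiff ℝ ∞ φ
  even : ∀ x, φ (-x) = φ x
  eq_one : ∀ x, |x| ≤ 1 → φ x = 1
  eq_zero : ∀ x, 2 ≤ |x| → φ x = 0

/-- The kernel `K_N(t, x) = ∑_{k ∈ ℤ^d} ∏_j φ(k_j / N) · exp(2πi [k · x - t ∑_j θ_j k_j²])` of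
`e^{itΔ} P_{≤ N}` on `(ℝ/ℤ)^d`, where `Δ = ∑_j θ_j ∂_j²`. Here `UnitAddTorus.mFourier k x` is
`exp(2πi k · x)`. For a cutoff `φ` and `N > 0` only finitely many terms are nonzero. -/
def kernel {d : ℕ} (φ : ℝ → ℝ) (θ : Fin d → ℝ) (N : ℝ) (t : ℝ) (x : UnitAddTorus (Fin d)) : ℂ :=
  ∑' k : Fin d → ℤ,
    ((∏ j, φ ((k j : ℝ) / N) : ℝ) : ℂ) * UnitAddTorus.mFourier k x *
      Complex.exp (-(2 * Real.pi * (t * ∑ j, θ j * (k j : ℝ) ^ 2) : ℝ) * Complex.I)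

/-- The times `t` in the window `J` for which, for some coordinate `j`, the number `θ_j t` is close
to a reduced fraction `a / q` with small denominator:
`q N² |θ_j t - a / q| ≤ N^{2σ}` and `q ≤ N^{2σ}`. -/
def majorTimes {d : ℕ} (J : Set ℝ) (θ : Fin d → ℝ) (σ N : ℝ) : Set ℝ :=
  {t | t ∈ J ∧ ∃ (j : Fin d) (a : ℤ) (q : ℕ), 1 ≤ q ∧ Int.gcd a q = 1 ∧
    (q : ℝ) ≤ N ^ (2 * σ) ∧ (q : ℝ) * N ^ 2 * |θ j * t - (a : ℝ) / q| ≤ N ^ (2 * σ)}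

/-- The truncated kernel: `kernel` times the indicator function of `majorTimes`. -/
def truncatedKernel {d : ℕ} (J : Set ℝ) (φ : ℝ → ℝ) (θ : Fin d → ℝ) (σ N : ℝ) (t : ℝ)
    (x : UnitAddTorus (Fin d)) : ℂ :=
  (majorTimes J θ σ N).indicator (fun s => kernel φ θ N s x) t

/-- The measure on spacetime `[0, 1] × (ℝ/ℤ)^d` (realised on `ℝ × (ℝ/ℤ)^d`). -/
def spacetimeMeasure (d : ℕ) : Measure (ℝ × UnitAddTorus (Fin d)) :=
  ((volume : Measure ℝ).restrict (Set.Icc 0 1)).prod volume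

/-- The spacetime convolution
`(K * F)(t, x) = ∫_{[0,1]} ∫_{(ℝ/ℤ)^d} K(t - s, x - y) F(s, y) dy ds`. -/
def spacetimeConv {d : ℕ} (K F : ℝ → UnitAddTorus (Fin d) → ℂ) (t : ℝ)
    (x : UnitAddTorus (Fin d)) : ℂ :=
  ∫ z, K (t - z.1) (x - z.2) * F z.1 z.2 ∂(spacetimeMeasure d)

/-- The mixed norm `‖F‖_{L^p_t L^r_x([0,1] × (ℝ/ℤ)^d)}`, with values in `[0, ∞]`. -/
def mixedNorm {d : ℕ} (p r : ℝ≥0∞) (F : ℝ → UnitAddTorus (Fin d) → ℂ) : ℝ≥0∞ :=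
  eLpNorm (fun t => eLpNorm (F t) r volume) p ((volume : Measure ℝ).restrict (Set.Icc 0 1))

end

end TorusStrichartz

/-!
The truncated kernel is estimated one time at a time, and the resulting convolution operators in
space are then put together by a convolution in time with a scalar majorant.

*Space.* Weyl differencing turns the square of the one-dimensional quadratic sum into a sum of
correlation sums of the cutoff. As the cutoff is smooth, two summations by parts make these decay
quadratically, so that the usual logarithm does not appear: near a fraction `a / q` the sum is
`O(N v^{-1/2})` with `v = q + N² |q θ_j t - a|` (`IsCutoff.exists_weyl_bound`). At a major time one
coordinate has `v ≤ 2 N^{2σ}` by definition, and Dirichlet's theorem supplies a fraction for each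
of the others. Taking the smallest `v` among all coordinates gives
`sup_x |K_N(t, x)| ≤ (C N v^{-1/2})^d` (`IsCutoff.exists_kernel_bound`), and interpolation with
Bessel's inequality bounds the convolution with `K_N(t, ·)` from `L^{r'}` to `L^r` by
`N^γ v^{-γ/2}`, where `γ = d (1 - 2/r)`
(`IsCutoff.exists_enorm_bilinForm_truncatedKernel_le`). With `v` rounded up to a power of two, this
is dominated by `arcMajorant`, a weighted sum of indicator functions of the sets `arcSet θ_j N V`,
which collect the arcs with `q ≤ V` and `N² |q θ_j t - a| ≤ V`.

*Time.* Such an indicator function is dominated by Fejér kernels centred at the fractions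
(`indicator_arcSet_le`). The sum over the numerators keeps only the frequencies divisible by `q`,
so the Fourier coefficient at `n ≠ 0` is `O(V / N²)` times the number of divisors of `n` which are
at most `V`. All its moments over `n ≤ N²` are `O(N² V^ε)`
(`sum_divisorCountUpTo_pow_le`); by Hölder's inequality and Parseval's identity it can be treated
as if it were bounded (`exists_norm_bilinForm_arcSet_le`). Real interpolation with the trivial
`L¹`-`L^∞` bound yields, from `L^{p'}` to `L^p`, the norm `(V / N²)^{2/p} V^δ + V² / N²`, where the
second term is due to the zero frequency (`exists_enorm_bilinForm_arcSet_le`). Weighted with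
`N^γ V^{-γ/2}` and summed over the levels `V = 2^i`, the first terms form a convergent geometric
series, because the hypothesis on the exponents says `γ > 4/p`. Their sum is `N^{γ - 4/p}`, the
power of `N` that is claimed. The second terms are smaller, since `V = O(N^{2σ})`, `p > 2` and `σ`
is small (`exists_eLpNorm_arcMajorant_le`).

The interpolation lemma `exists_bilinForm_le` decomposes both functions into their dyadic level
sets; it is used in space as well as in time. Duality and Fubini's theorem combine the two halves
(`eLpNorm_spacetimeConv_le`).
-/

namespace TorusStrichartz

/-! ### Quadratic exponential sums with smooth weights -/

/-- The additive character `x ↦ exp(2πix)` of `ℝ`. -/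
noncomputable def echar (x : ℝ) : ℂ := Complex.exp (2 * Real.pi * x * Complex.I)

lemma echar_add (x y : ℝ) : echar (x + y) = echar x * echar y := by
  simp only [echar, ← Complex.exp_add]; congr 1; push_cast; ring

@[simp] lemma echar_zero : echar 0 = 1 := by simp [echar]

@[simp] lemma norm_echar (x : ℝ) : ‖echar x‖ = 1 := by
  have : (2 * Real.pi * x * Complex.I : ℂ) = ((2 * Real.pi * x : ℝ) : ℂ) * Complex.I := by
    push_cast; ring
  rw [echar, this, Complex.norm_exp_ofReal_mul_I]

lemma echar_neg (x : ℝ) : echar (-x) = (starRingEnd ℂ) (echar x) := by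
  simp only [echar, ← Complex.exp_conj]; congr 1
  simp [Complex.conj_ofNat]

@[simp] lemma echar_int (n : ℤ) : echar n = 1 := by
  rw [echar, ← Complex.exp_int_mul_two_pi_mul_I n]; congr 1; push_cast; ring

lemma echar_re (x : ℝ) : (echar x).re = Real.cos (2 * Real.pi * x) := by
  have : (2 * Real.pi * x * Complex.I : ℂ) = ((2 * Real.pi * x : ℝ) : ℂ) * Complex.I := by
    push_cast; ring
  rw [echar, this, Complex.exp_ofReal_mul_I_re]

lemma continuous_echar : Continuous echar := by unfold echar; fun_prop

/-- The one-dimensional quadratic exponential sum `∑ₖ φ(k/N) e(kx - τk²)`. -/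
noncomputable def weylSum (φ : ℝ → ℝ) (N : ℕ) (τ x : ℝ) : ℂ :=
  ∑ k ∈ Finset.Icc (-(2 * N : ℤ)) (2 * N), (φ ((k : ℝ) / N) : ℂ) * echar (k * x - τ * k ^ 2)

lemma IsCutoff.eq_zero_of_notMem {φ : ℝ → ℝ} (hφ : IsCutoff φ) {N : ℕ} (hN : 1 ≤ N) {l : ℤ}
    (hl : l ∉ Finset.Icc (-(2 * N : ℤ)) (2 * N)) : φ ((l : ℝ) / N) = 0 := by
  have hN0 : (0 : ℝ) < N := by exact_mod_cast hN
  refine hφ.eq_zero _ ?_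
  rw [abs_div, abs_of_pos hN0, le_div_iff₀ hN0]
  by_contra hlt
  rw [not_le, abs_lt] at hlt
  apply hl
  rw [Finset.mem_Icc]
  constructor
  · have : (-(2 * N : ℤ) : ℝ) < l := by push_cast; linarith [hlt.1]
    exact_mod_cast this.le
  · have : (l : ℝ) < (2 * N : ℤ) := by push_cast; linarith [hlt.2]
    exact_mod_cast this.le

/-- Bounds for the size and the first two differences of a cutoff. -/
lemma IsCutoff.exists_bound {φ : ℝ → ℝ} (hφ : IsCutoff φ) :
    ∃ c : ℝ, 1 ≤ c ∧ (∀ y, |φ y| ≤ c) ∧ (∀ y δ, |φ (y + δ) - φ y| ≤ c * |δ|) ∧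
      ∀ y δ, |φ (y + δ) + φ (y - δ) - 2 * φ y| ≤ c * δ ^ 2 := by
  have hcs : HasCompactSupport φ := by
    refine HasCompactSupport.intro (isCompact_Icc (a := (-2 : ℝ)) (b := 2)) fun x hx => ?_
    refine hφ.eq_zero x ?_
    by_contra h
    rw [not_le, abs_lt] at h
    exact hx ⟨h.1.le, h.2.le⟩
  have hd0 : Differentiable ℝ φ := hφ.smooth.differentiable (by simp)
  have hs1 : ContDiff ℝ ∞ (deriv φ) := by
    have := (contDiff_infty_iff_deriv (f := φ) (𝕜 := ℝ)).1 hφ.smooth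
    exact this.2
  have hd1 : Differentiable ℝ (deriv φ) := hs1.differentiable (by simp)
  have hs2 : ContDiff ℝ ∞ (deriv (deriv φ)) := (contDiff_infty_iff_deriv.1 hs1).2
  obtain ⟨c0, h0⟩ := hcs.exists_bound_of_continuous hφ.smooth.continuous
  obtain ⟨c1, h1⟩ := hcs.deriv.exists_bound_of_continuous hs1.continuous
  obtain ⟨c2, h2⟩ := hcs.deriv.deriv.exists_bound_of_continuous hs2.continuous
  have lip0 : ∀ y z, |φ z - φ y| ≤ c1 * |z - y| := fun y z => by
    simpa using Convex.norm_image_sub_le_of_norm_deriv_le (f := φ) (s := Set.univ)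
      (fun x _ => hd0 x) (fun x _ => h1 x) convex_univ (Set.mem_univ y) (Set.mem_univ z)
  have lip1 : ∀ y z, |deriv φ z - deriv φ y| ≤ c2 * |z - y| := fun y z => by
    simpa using Convex.norm_image_sub_le_of_norm_deriv_le (f := deriv φ) (s := Set.univ)
      (fun x _ => hd1 x) (fun x _ => h2 x) convex_univ (Set.mem_univ y) (Set.mem_univ z)
  have hc2 : 0 ≤ c2 := (norm_nonneg _).trans (h2 0)
  refine ⟨1 + |c0| + |c1| + 2 * c2, by
    have := abs_nonneg c0
    have := abs_nonneg c1
    linarith, fun y => ?_, fun y δ => ?_, fun y δ => ?_⟩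
  · have := h0 y
    rw [Real.norm_eq_abs] at this
    have := le_abs_self c0
    have := abs_nonneg c1
    linarith
  · refine (lip0 y (y + δ)).trans ?_
    rw [add_sub_cancel_left]
    have := le_abs_self c1
    have := abs_nonneg c0
    gcongr
    linarith
  · have key : ‖(φ (y + δ) + φ (y - δ)) - (φ (y + 0) + φ (y - 0))‖ ≤
        (2 * c2 * |δ|) * ‖δ - 0‖ := by
      refine Convex.norm_image_sub_le_of_norm_hasDerivWithin_le
        (f := fun s => φ (y + s) + φ (y - s)) (f' := fun s => deriv φ (y + s) - deriv φ (y - s))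
        (s := Set.uIcc 0 δ) (fun s _ => ?_) (fun s hs => ?_) (convex_uIcc 0 δ)
        Set.left_mem_uIcc Set.right_mem_uIcc
      · have e1 := (hd0 (y + s)).hasDerivAt.comp_const_add y s
        have e2 := (hd0 (y - s)).hasDerivAt.comp_const_sub y s
        convert! (e1.add e2).hasDerivWithinAt using 1
      · have h3 := lip1 (y - s) (y + s)
        have h4 : |s| ≤ |δ| := by
          have := Set.abs_sub_left_of_mem_uIcc hs
          simpa using this
        rw [Real.norm_eq_abs]
        refine h3.trans ?_
        have : y + s - (y - s) = 2 * s := by ring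
        rw [this, abs_mul, abs_two]
        nlinarith
    have h5 : φ (y + δ) + φ (y - δ) - 2 * φ y
        = (φ (y + δ) + φ (y - δ)) - (φ (y + 0) + φ (y - 0)) := by simp; ring
    rw [h5, ← Real.norm_eq_abs]
    refine key.trans ?_
    rw [sub_zero, Real.norm_eq_abs, mul_assoc, abs_mul_abs_self, ← sq]
    have := abs_nonneg c0
    have := abs_nonneg c1
    gcongr
    linarith

lemma two_sub_echar (α : ℝ) :
    (2 - echar α - echar (-α) : ℂ) = ((4 * Real.sin (Real.pi * α) ^ 2 : ℝ) : ℂ) := by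
  have h : echar α + echar (-α) = ((2 * Real.cos (2 * Real.pi * α) : ℝ) : ℂ) := by
    rw [echar_neg, Complex.add_conj, echar_re]
  have h2 : Real.cos (2 * Real.pi * α) = 1 - 2 * Real.sin (Real.pi * α) ^ 2 := by
    rw [show 2 * Real.pi * α = 2 * (Real.pi * α) by ring, Real.cos_two_mul]
    nlinarith [Real.sin_sq_add_cos_sq (Real.pi * α)]
  rw [sub_sub, h, h2]; push_cast; ring

/-- Two summations by parts, that is, multiplication by `2 - e(α) - e(-α) = 4 sin² (πα)`. -/
lemma sin_sq_mul_norm_tsum_le {u : ℤ → ℝ} (hu : u.support.Finite) (α : ℝ) :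
    4 * Real.sin (Real.pi * α) ^ 2 * ‖∑' l : ℤ, (u l : ℂ) * echar (l * α)‖ ≤
      ∑' l : ℤ, |u (l + 1) + u (l - 1) - 2 * u l| := by
  have hs : ∀ j : ℤ, Summable fun l : ℤ => (u (l + j) : ℂ) * echar (l * α) := fun j => by
    refine summable_of_hasFiniteSupport ?_
    refine (hu.preimage (f := fun l : ℤ => l + j) (add_left_injective j).injOn).subset ?_
    intro l hl
    simp only [Function.mem_support, Set.mem_preimage] at hl ⊢
    intro h
    apply hl; simp [h]
  have hshift : ∀ j : ℤ, ∑' l : ℤ, (u (l + j) : ℂ) * echar (l * α) =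
      echar (-(j * α)) * ∑' l : ℤ, (u l : ℂ) * echar (l * α) := fun j => by
    rw [← tsum_mul_left]
    conv_rhs => rw [← (Equiv.addRight j).tsum_eq]
    refine tsum_congr fun l => ?_
    have : (l : ℝ) * α = -(j * α) + ((l + j : ℤ) : ℝ) * α := by push_cast; ring
    rw [this, echar_add, Equiv.coe_addRight]
    ring
  set T := ∑' l : ℤ, (u l : ℂ) * echar (l * α)
  have key : ((4 * Real.sin (Real.pi * α) ^ 2 : ℝ) : ℂ) * T =
      ∑' l : ℤ, ((2 * u l - u (l + 1) - u (l - 1) : ℝ) : ℂ) * echar (l * α) := by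
    have e1 : ∑' l : ℤ, ((2 * u l - u (l + 1) - u (l - 1) : ℝ) : ℂ) * echar (l * α) =
        2 * T - (∑' l : ℤ, (u (l + 1) : ℂ) * echar (l * α)) -
          ∑' l : ℤ, (u (l + (-1)) : ℂ) * echar (l * α) := by
      have hs0 : Summable fun l : ℤ => (u l : ℂ) * echar (l * α) := by simpa using hs 0
      rw [← tsum_mul_left, ← (hs0.mul_left 2).tsum_sub (hs 1),
        ← ((hs0.mul_left 2).sub (hs 1)).tsum_sub (hs (-1))]
      refine tsum_congr fun l => ?_
      rw [← sub_eq_add_neg]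
      push_cast; ring
    rw [e1, hshift 1, hshift (-1), ← two_sub_echar]
    push_cast
    simp only [one_mul, neg_mul, neg_neg]
    ring
  have hn : 4 * Real.sin (Real.pi * α) ^ 2 * ‖T‖ =
      ‖∑' l : ℤ, ((2 * u l - u (l + 1) - u (l - 1) : ℝ) : ℂ) * echar (l * α)‖ := by
    rw [← key, norm_mul, Complex.norm_real, Real.norm_of_nonneg (by positivity)]
  rw [hn]
  have heq : ∀ l : ℤ, ‖((2 * u l - u (l + 1) - u (l - 1) : ℝ) : ℂ) * echar (l * α)‖ =
      |u (l + 1) + u (l - 1) - 2 * u l| := fun l => by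
    rw [norm_mul, norm_echar, mul_one, Complex.norm_real, Real.norm_eq_abs, ← abs_neg]
    congr 1; ring
  have hsum : Summable fun l : ℤ =>
      ‖((2 * u l - u (l + 1) - u (l - 1) : ℝ) : ℂ) * echar (l * α)‖ := by
    refine summable_of_hasFiniteSupport ?_
    refine ((hu.union (hu.preimage (f := fun l : ℤ => l + 1) (add_left_injective 1).injOn)).union
      (hu.preimage (f := fun l : ℤ => l - 1) (sub_left_injective).injOn)).subset ?_
    intro l hl
    by_contra hc
    simp only [Set.mem_union, Set.mem_preimage, Function.mem_support, not_or, not_not] at hc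
    apply hl
    simp [hc.1.1, hc.1.2, hc.2]
  refine (norm_tsum_le_tsum_norm hsum).trans_eq ?_
  exact tsum_congr heq

/-- The bounds for the correlation sums of a sampled cutoff which Weyl differencing produces: the
trivial one and the one from two summations by parts. -/
lemma IsCutoff.exists_correlation_bound {φ : ℝ → ℝ} (hφ : IsCutoff φ) :
    ∃ C : ℝ, 1 ≤ C ∧ ∀ N : ℕ, 1 ≤ N → ∀ (h : ℤ) (α : ℝ),
      ‖∑ l ∈ Finset.Icc (-(2 * N : ℤ)) (2 * N),
        ((φ ((l : ℝ) / N) * φ (((l + h : ℤ) : ℝ) / N) : ℝ) : ℂ) * echar (l * α)‖ ≤ C * N ∧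
      Real.sin (Real.pi * α) ^ 2 * ‖∑ l ∈ Finset.Icc (-(2 * N : ℤ)) (2 * N),
        ((φ ((l : ℝ) / N) * φ (((l + h : ℤ) : ℝ) / N) : ℝ) : ℂ) * echar (l * α)‖ ≤ C / N := by
  obtain ⟨c, hc1, hb0, hb1, hb2⟩ := hφ.exists_bound
  refine ⟨7 * (4 * c ^ 2), by nlinarith, fun N hN h α => ?_⟩
  have hN0 : (0 : ℝ) < N := by exact_mod_cast hN
  have hN1 : (1 : ℝ) ≤ N := by exact_mod_cast hN
  set u : ℤ → ℝ := fun l => φ ((l : ℝ) / N) * φ (((l + h : ℤ) : ℝ) / N) with hu_def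
  have hzero : ∀ l : ℤ, l ∉ Finset.Icc (-(2 * N : ℤ)) (2 * N) → φ ((l : ℝ) / N) = 0 :=
    fun _ hl => hφ.eq_zero_of_notMem hN hl
  have hu : ∀ l : ℤ, l ∉ Finset.Icc (-(2 * N : ℤ)) (2 * N) → u l = 0 := fun l hl => by
    simp [hu_def, hzero l hl]
  have hT : ∑ l ∈ Finset.Icc (-(2 * N : ℤ)) (2 * N), (u l : ℂ) * echar (l * α) =
      ∑' l : ℤ, (u l : ℂ) * echar (l * α) := by
    refine (tsum_eq_sum fun l hl => ?_).symm
    simp [hu l hl]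
  have hcard : ((Finset.Icc (-(2 * N : ℤ)) (2 * N)).card : ℝ) ≤ 5 * N := by
    rw [Int.card_Icc]
    have : (((2 * N : ℤ) + 1 - -(2 * N)).toNat : ℝ) = 4 * N + 1 := by
      have : ((2 * N : ℤ) + 1 - -(2 * N)).toNat = 4 * N + 1 := by omega
      rw [this]; push_cast; ring
    rw [this]; linarith
  have hcard' : ((Finset.Icc (-(2 * N + 1 : ℤ)) (2 * N + 1)).card : ℝ) ≤ 7 * N := by
    rw [Int.card_Icc]
    have : (((2 * N + 1 : ℤ) + 1 - -(2 * N + 1)).toNat : ℝ) = 4 * N + 3 := by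
      have : ((2 * N + 1 : ℤ) + 1 - -(2 * N + 1)).toNat = 4 * N + 3 := by omega
      rw [this]; push_cast; ring
    rw [this]; linarith
  constructor
  · calc ‖∑ l ∈ Finset.Icc (-(2 * N : ℤ)) (2 * N), (u l : ℂ) * echar (l * α)‖
        ≤ ∑ l ∈ Finset.Icc (-(2 * N : ℤ)) (2 * N), c ^ 2 := by
          refine norm_sum_le_of_le _ fun l _ => ?_
          rw [norm_mul, norm_echar, mul_one, Complex.norm_real, Real.norm_eq_abs, abs_mul, sq]
          gcongr
          · exact hb0 _
          · exact hb0 _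
      _ ≤ (5 * N) * c ^ 2 := by
          rw [Finset.sum_const, nsmul_eq_mul]; gcongr
      _ ≤ 7 * (4 * c ^ 2) * N := by nlinarith [mul_pos hN0 (pow_pos (zero_lt_one.trans_le hc1) 2)]
  · change Real.sin (Real.pi * α) ^ 2 * ‖∑ l ∈ Finset.Icc (-(2 * N : ℤ)) (2 * N),
        (u l : ℂ) * echar (l * α)‖ ≤ _
    rw [hT]
    have hfin : u.support.Finite := (Finset.finite_toSet (Finset.Icc (-(2 * N : ℤ)) (2 * N))).subset
      fun l hl => by
        by_contra hc
        exact hl (hu l hc)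
    have h1 := sin_sq_mul_norm_tsum_le hfin α
    have h2 : ∑' l : ℤ, |u (l + 1) + u (l - 1) - 2 * u l| ≤ (7 * N) * (4 * c ^ 2 / N ^ 2) := by
      rw [tsum_eq_sum (s := Finset.Icc (-(2 * N + 1 : ℤ)) (2 * N + 1))]
      · calc _ ≤ ∑ l ∈ Finset.Icc (-(2 * N + 1 : ℤ)) (2 * N + 1), 4 * c ^ 2 / N ^ 2 := by
              refine Finset.sum_le_sum fun l _ => ?_
              have hδ : ∀ m : ℤ, ((m + 1 : ℤ) : ℝ) / N = m / N + 1 / N := fun m => by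
                push_cast; ring
              have hδ' : ∀ m : ℤ, ((m - 1 : ℤ) : ℝ) / N = m / N - 1 / N := fun m => by
                push_cast; ring
              have hδ'' : ∀ m : ℤ, ((m - 1 : ℤ) : ℝ) / N = m / N + (-(1 / N)) := fun m => by
                push_cast; ring
              have a1 : ∀ m : ℤ, |φ (((m + 1 : ℤ) : ℝ) / N) - φ (m / N)| ≤ c / N := fun m => by
                have := hb1 (m / N) (1 / N)
                rw [← hδ, abs_of_pos (by positivity : (0 : ℝ) < 1 / N), mul_one_div] at this
                exact this
              have a2 : ∀ m : ℤ, |φ (((m - 1 : ℤ) : ℝ) / N) - φ (m / N)| ≤ c / N := fun m => by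
                have := hb1 (m / N) (-(1 / N))
                rw [← hδ'', abs_neg, abs_of_pos (by positivity : (0 : ℝ) < 1 / N),
                  mul_one_div] at this
                exact this
              have a3 : ∀ m : ℤ, |φ (((m + 1 : ℤ) : ℝ) / N) + φ (((m - 1 : ℤ) : ℝ) / N)
                  - 2 * φ (m / N)| ≤ c / N ^ 2 := fun m => by
                have := hb2 (m / N) (1 / N)
                rw [← hδ, ← hδ', one_div, inv_pow, ← div_eq_mul_inv] at this
                exact this
              have e : u (l + 1) + u (l - 1) - 2 * u l =
                  φ (((l + h : ℤ) : ℝ) / N) * (φ (((l + 1 : ℤ) : ℝ) / N) +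
                    φ (((l - 1 : ℤ) : ℝ) / N) - 2 * φ (l / N)) +
                  φ (l / N) * (φ (((l + h + 1 : ℤ) : ℝ) / N) +
                    φ (((l + h - 1 : ℤ) : ℝ) / N) - 2 * φ ((l + h : ℤ) / N)) +
                  (φ (((l + 1 : ℤ) : ℝ) / N) - φ (l / N)) *
                    (φ (((l + h + 1 : ℤ) : ℝ) / N) - φ ((l + h : ℤ) / N)) +
                  (φ (((l - 1 : ℤ) : ℝ) / N) - φ (l / N)) *
                    (φ (((l + h - 1 : ℤ) : ℝ) / N) - φ ((l + h : ℤ) / N)) := by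
                simp only [hu_def]
                rw [show l + 1 + h = l + h + 1 by ring, show l - 1 + h = l + h - 1 by ring]
                ring
              rw [e]
              have hc0 : 0 ≤ c := by linarith
              have m1 : ∀ {x y X Y : ℝ}, |x| ≤ X → |y| ≤ Y → 0 ≤ X → |x * y| ≤ X * Y :=
                fun hx hy hX => by rw [abs_mul]; exact mul_le_mul hx hy (abs_nonneg _) hX
              have t1 := m1 (hb0 (((l + h : ℤ) : ℝ) / N)) (a3 l) hc0
              have t2 := m1 (hb0 ((l : ℝ) / N)) (a3 (l + h)) hc0
              have t3 := m1 (a1 l) (a1 (l + h)) (by positivity)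
              have t4 := m1 (a2 l) (a2 (l + h)) (by positivity)
              refine (abs_add_le _ _).trans ?_
              refine (add_le_add ((abs_add_le _ _).trans
                (add_le_add ((abs_add_le _ _).trans (add_le_add t1 t2)) t3)) t4).trans_eq ?_
              field_simp
              ring
          _ ≤ (7 * N) * (4 * c ^ 2 / N ^ 2) := by
              rw [Finset.sum_const, nsmul_eq_mul]; gcongr
      · intro l hl
        have hl' : l < -(2 * N + 1) ∨ (2 * N + 1 : ℤ) < l := by
          rw [Finset.mem_Icc, not_and_or, not_le, not_le] at hl
          simpa using hl
        have k : ∀ m : ℤ, |m - l| ≤ 1 → u m = 0 := fun m hm => hu m (by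
          rw [abs_le] at hm
          rw [Finset.mem_Icc]; omega)
        rw [k (l + 1) (by simp), k (l - 1) (by simp), k l (by simp)]
        simp
    have h3 : 7 * (N : ℝ) * (4 * c ^ 2 / N ^ 2) = 7 * (4 * c ^ 2) / N := by
      field_simp
    rw [h3] at h2
    have h4 := h1.trans h2
    have h5 : 0 ≤ Real.sin (Real.pi * α) ^ 2 * ‖∑' l : ℤ, (u l : ℂ) * echar (l * α)‖ := by
      positivity
    linarith

/-! ### Sums with quadratic decay near a rational number -/

/-- A residue class modulo `q ≤ 16N` has `O(N / q)` elements in `[-8N, 8N]`. -/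
lemma card_filter_modEq_le {N q : ℕ} (hq : 1 ≤ q) (hqN : q ≤ 16 * N) (v : ℤ) :
    (((Finset.Icc (-(8 * N : ℤ)) (8 * N)).filter (fun n => n ≡ v [ZMOD q])).card : ℝ) ≤
      48 * N / q := by
  have hq0 : (0 : ℝ) < q := by exact_mod_cast hq
  have h0 : Finset.Icc (-(8 * N : ℤ)) (8 * N) = Finset.Ico (-(8 * N : ℤ)) (8 * N + 1) := by
    ext; simp [Finset.mem_Icc, Finset.mem_Ico]
  have h1 := Int.Ico_filter_modEq_card (-(8 * N : ℤ)) (8 * N + 1) (r := q) (by exact_mod_cast hq) v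
  have hqN' : (q : ℚ) ≤ 16 * N := by exact_mod_cast hqN
  have hq0' : (0 : ℚ) < q := by exact_mod_cast hq
  have hq1' : (1 : ℚ) ≤ q := by exact_mod_cast hq
  have h2 : (((Finset.Icc (-(8 * N : ℤ)) (8 * N)).filter (fun n => n ≡ v [ZMOD q])).card : ℚ) ≤
      48 * N / q := by
    rw [h0]
    have h3 : (((Finset.Ico (-(8 * N : ℤ)) (8 * N + 1)).filter
        (fun n => n ≡ v [ZMOD q])).card : ℚ) = (((Finset.Ico (-(8 * N : ℤ)) (8 * N + 1)).filter
        (fun n => n ≡ v [ZMOD q])).card : ℤ) := by push_cast; rfl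
    rw [h3, h1]
    push_cast
    have c1 := Int.ceil_lt_add_one (((8 * N + 1 : ℚ) - v) / q)
    have c2 := Int.le_ceil ((-(8 * N : ℚ) - v) / q)
    have e : (8 * N + 1 - v : ℚ) / q - (-(8 * N : ℚ) - v) / q = (16 * N + 1) / q := by
      field_simp; ring
    have e2 : (16 * N + 1 : ℚ) / q + 1 ≤ 48 * N / q := by
      rw [div_add_one hq0'.ne']
      gcongr
      have : (1 : ℚ) ≤ 16 * N := hq1'.trans hqN'
      linarith
    refine max_le ?_ (by positivity)
    linarith
  have h4 := (Rat.cast_le (K := ℝ)).2 h2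
  push_cast at h4
  exact h4

/-- Jordan's inequality, with the distance to the nearest integer. -/
lemma two_mul_abs_sub_round_le_abs_sin (x : ℝ) :
    2 * |x - round x| ≤ |Real.sin (Real.pi * x)| := by
  have h1 : |Real.sin (Real.pi * x)| = |Real.sin (Real.pi * (x - round x))| := by
    have : Real.pi * (x - round x) = Real.pi * x - (round x : ℤ) * Real.pi := by ring
    rw [this, Real.sin_sub_int_mul_pi]
    rw [abs_mul, abs_zpow]; simp
  rw [h1]
  have h2 : |Real.pi * (x - round x)| ≤ Real.pi / 2 := by
    rw [abs_mul, abs_of_pos Real.pi_pos]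
    have := abs_sub_round x
    nlinarith [Real.pi_pos]
  have h3 := Real.mul_abs_le_abs_sin h2
  rw [abs_mul, abs_of_pos Real.pi_pos] at h3
  have : 2 / Real.pi * (Real.pi * |x - round x|) = 2 * |x - round x| := by
    field_simp
  rwa [this] at h3

lemma sum_range_inv_sq_add_inv_sq_le (q : ℕ) :
    ∑ c ∈ Finset.range q,
      (if c = 0 then (0 : ℝ) else 1 / (c : ℝ) ^ 2 + 1 / ((q : ℝ) - c) ^ 2) ≤ 4 := by
  rcases Nat.eq_zero_or_pos q with rfl | hq
  · simp
  have h := sum_Ioo_inv_sq_le (α := ℝ) 0 q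
  have h' : ∑ i ∈ Finset.Ioo 0 q, 1 / ((q : ℝ) - i) ^ 2 =
      ∑ i ∈ Finset.Ioo 0 q, ((i : ℝ) ^ 2)⁻¹ := by
    refine Finset.sum_bij' (fun i _ => q - i) (fun i _ => q - i) ?_ ?_ ?_ ?_ ?_
    · intro i hi; rw [Finset.mem_Ioo] at hi ⊢; omega
    · intro i hi; rw [Finset.mem_Ioo] at hi ⊢; omega
    · intro i hi; rw [Finset.mem_Ioo] at hi; omega
    · intro i hi; rw [Finset.mem_Ioo] at hi; omega
    · intro i hi
      rw [Finset.mem_Ioo] at hi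
      rw [Nat.cast_sub hi.2.le, one_div]
  have h2 : ∑ c ∈ Finset.range q,
      (if c = 0 then (0 : ℝ) else 1 / (c : ℝ) ^ 2 + 1 / ((q : ℝ) - c) ^ 2) =
      ∑ i ∈ Finset.Ioo 0 q, (1 / (i : ℝ) ^ 2 + 1 / ((q : ℝ) - i) ^ 2) := by
    symm
    refine Finset.sum_subset_zero_on_sdiff (fun i hi => ?_) (fun i hi => ?_) (fun i hi => ?_)
    · rw [Finset.mem_Ioo] at hi; rw [Finset.mem_range]; exact hi.2
    · rw [Finset.mem_sdiff, Finset.mem_range, Finset.mem_Ioo] at hi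
      rw [if_pos (by omega)]
    · rw [Finset.mem_Ioo] at hi
      rw [if_neg (by omega)]
  rw [h2, Finset.sum_add_distrib, h']
  simp only [one_div]
  norm_num at h
  linarith

/-- The terms with `q ∤ n` in the sum of `sum_mul_le_of_near_rational`: there `τ n` keeps a
distance to the integers comparable with that of `a n / q`, and `n ↦ a n` permutes the residue
classes. -/
lemma sum_not_dvd_le {N : ℕ} (hN : 1 ≤ N) {D : ℤ → ℝ} {τ : ℝ}
    (hD0 : ∀ n, 0 ≤ D n)
    (hD2 : ∀ n : ℤ, Real.sin (Real.pi * (τ * n)) ^ 2 * D n ≤ 1 / N)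
    {a : ℤ} {q : ℕ} (hq : 1 ≤ q) (haq : Int.gcd a q = 1) (hqN : q ≤ 16 * N)
    (hβ : |τ - a / q| ≤ 1 / (16 * q * N)) :
    ∑ n ∈ (Finset.Icc (-(8 * N : ℤ)) (8 * N)).filter (fun n => ¬ (q : ℤ) ∣ n), D n ≤ 192 * q := by
  have hN0 : (0 : ℝ) < N := by exact_mod_cast hN
  have hq0 : (0 : ℝ) < q := by exact_mod_cast hq
  have hqz : (q : ℤ) ≠ 0 := by exact_mod_cast (by omega : q ≠ 0)
  set f : ℕ → ℝ := fun c => if c = 0 then (0 : ℝ) else 1 / (c : ℝ) ^ 2 + 1 / ((q : ℝ) - c) ^ 2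
    with hf
  have hf0 : ∀ c, 0 ≤ f c := fun c => by simp only [hf]; split_ifs <;> positivity
  have hpt : ∀ n ∈ (Finset.Icc (-(8 * N : ℤ)) (8 * N)).filter (fun n => ¬ (q : ℤ) ∣ n),
      D n ≤ (q : ℝ) ^ 2 / N * f ((a * n) % q).toNat := by
    intro n hn
    rw [Finset.mem_filter, Finset.mem_Icc] at hn
    obtain ⟨⟨hn1, hn2⟩, hn3⟩ := hn
    set c := ((a * n) % q).toNat with hc
    have hc0 : (c : ℤ) = (a * n) % q := Int.toNat_of_nonneg (Int.emod_nonneg _ hqz)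
    have hcq : (c : ℤ) < q := by rw [hc0]; exact Int.emod_lt_of_pos _ (by exact_mod_cast hq)
    have hcpos : c ≠ 0 := by
      intro h
      rw [h, Nat.cast_zero, eq_comm] at hc0
      apply hn3
      have h1 : (q : ℤ) ∣ a * n := Int.dvd_of_emod_eq_zero hc0
      exact Int.dvd_of_dvd_mul_right_of_gcd_one h1 (by rw [Int.gcd_comm]; exact haq)
    have hcqR : (c : ℝ) < q := by exact_mod_cast hcq
    have hc1 : (1 : ℝ) ≤ c := by exact_mod_cast Nat.one_le_iff_ne_zero.2 hcpos
    -- the distance of `a n` to the multiple `q m` of `q`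
    set m := round (τ * n) with hm
    set k := a * n / q with hk
    have hdiv : a * n = q * k + c := by rw [hc0]; exact (Int.mul_ediv_add_emod _ _).symm
    have hdivR : (a : ℝ) * n = q * k + c := by exact_mod_cast hdiv
    have hdist : min (c : ℝ) (q - c) ≤ |(a : ℝ) * n - q * m| := by
      rw [hdivR]
      rcases le_or_gt m k with h | h
      · have hh : (m : ℝ) ≤ k := by exact_mod_cast h
        refine (min_le_left _ _).trans ?_
        refine le_trans ?_ (le_abs_self _)
        nlinarith
      · have hh : (k : ℝ) + 1 ≤ m := by exact_mod_cast h
        refine (min_le_right _ _).trans ?_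
        refine le_trans ?_ (neg_le_abs _)
        nlinarith
    have hdist1 : (1 : ℝ) ≤ |(a : ℝ) * n - q * m| := by
      refine le_trans (le_min hc1 ?_) hdist
      have : (c : ℝ) + 1 ≤ q := by exact_mod_cast hcq
      linarith
    have hnR : |(n : ℝ)| ≤ 8 * N := by
      rw [abs_le]; constructor
      · exact_mod_cast hn1
      · exact_mod_cast hn2
    have herr : q * |(τ - a / q) * n| ≤ 1 / 2 := by
      rw [abs_mul]
      calc q * (|τ - a / q| * |(n : ℝ)|) ≤ q * (1 / (16 * q * N) * (8 * N)) := by gcongr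
        _ = 1 / 2 := by field_simp; norm_num
    have hlow : min (c : ℝ) (q - c) ≤ q * |Real.sin (Real.pi * (τ * n))| := by
      have h1 := two_mul_abs_sub_round_le_abs_sin (τ * n)
      have h2 : (a : ℝ) * n - q * m = q * (τ * n - m) - q * ((τ - a / q) * n) := by
        field_simp; ring
      have h3 : |(a : ℝ) * n - q * m| ≤ q * |τ * n - m| + 1 / 2 := by
        rw [h2]
        refine (abs_sub _ _).trans ?_
        rw [abs_mul, abs_mul (q : ℝ) ((τ - a / q) * n), abs_of_pos hq0]
        linarith
      have h4 : q * (2 * |τ * n - m|) ≤ q * |Real.sin (Real.pi * (τ * n))| := by gcongr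
      linarith
    have hmin : 0 < min (c : ℝ) (q - c) := lt_min (by linarith) (by linarith)
    have hsq : min (c : ℝ) (q - c) ^ 2 ≤ q ^ 2 * Real.sin (Real.pi * (τ * n)) ^ 2 := by
      calc min (c : ℝ) (q - c) ^ 2 ≤ (q * |Real.sin (Real.pi * (τ * n))|) ^ 2 := by gcongr
        _ = _ := by rw [mul_pow, sq_abs]
    have h5 : min (c : ℝ) (q - c) ^ 2 * D n ≤ q ^ 2 / N := by
      calc min (c : ℝ) (q - c) ^ 2 * D n ≤ q ^ 2 * Real.sin (Real.pi * (τ * n)) ^ 2 * D n := by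
            gcongr; exact hD0 n
        _ = q ^ 2 * (Real.sin (Real.pi * (τ * n)) ^ 2 * D n) := by ring
        _ ≤ q ^ 2 * (1 / N) := by gcongr; exact hD2 n
        _ = _ := by ring
    have h6 : D n ≤ q ^ 2 / N * (1 / min (c : ℝ) (q - c) ^ 2) := by
      rw [mul_one_div, le_div_iff₀ (by positivity)]; linarith
    refine h6.trans ?_
    gcongr
    simp only [hf, if_neg hcpos]
    rcases min_choice (c : ℝ) (q - c) with h | h <;> rw [h]
    · have : 0 ≤ 1 / ((q : ℝ) - c) ^ 2 := by positivity
      linarith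
    · have : 0 ≤ 1 / (c : ℝ) ^ 2 := by positivity
      linarith
  have hmaps : ∀ n ∈ Finset.Icc (-(8 * N : ℤ)) (8 * N), ((a * n) % q).toNat ∈ Finset.range q := by
    intro n _
    rw [Finset.mem_range]
    have := Int.emod_lt_of_pos (a * n) (by exact_mod_cast hq : (0 : ℤ) < q)
    have := Int.emod_nonneg (a * n) hqz
    omega
  calc _ ≤ ∑ n ∈ (Finset.Icc (-(8 * N : ℤ)) (8 * N)).filter (fun n => ¬ (q : ℤ) ∣ n),
        (q : ℝ) ^ 2 / N * f ((a * n) % q).toNat := Finset.sum_le_sum hpt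
    _ ≤ ∑ n ∈ Finset.Icc (-(8 * N : ℤ)) (8 * N), (q : ℝ) ^ 2 / N * f ((a * n) % q).toNat :=
        Finset.sum_le_sum_of_subset_of_nonneg (Finset.filter_subset _ _)
          (fun n _ _ => mul_nonneg (by positivity) (hf0 _))
    _ = ∑ c ∈ Finset.range q, ∑ n ∈ (Finset.Icc (-(8 * N : ℤ)) (8 * N)).filter
          (fun n => ((a * n) % q).toNat = c), (q : ℝ) ^ 2 / N * f ((a * n) % q).toNat :=
        (Finset.sum_fiberwise_of_maps_to hmaps _).symm
    _ ≤ ∑ c ∈ Finset.range q, (48 * N / q) * ((q : ℝ) ^ 2 / N * f c) := by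
        refine Finset.sum_le_sum fun c _ => ?_
        rw [Finset.sum_congr rfl (g := fun _ => (q : ℝ) ^ 2 / N * f c)
          (fun n hn => by rw [(Finset.mem_filter.1 hn).2]), Finset.sum_const, nsmul_eq_mul]
        refine mul_le_mul_of_nonneg_right ?_ (mul_nonneg (by positivity) (hf0 _))
        rcases Finset.eq_empty_or_nonempty ((Finset.Icc (-(8 * N : ℤ)) (8 * N)).filter
          (fun n => ((a * n) % q).toNat = c)) with h | ⟨v, hv⟩
        · rw [h]; simp; positivity
        · refine le_trans ?_ (card_filter_modEq_le hq hqN v)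
          refine Nat.cast_le.2 (Finset.card_le_card fun n hn => ?_)
          rw [Finset.mem_filter] at hn hv ⊢
          refine ⟨hn.1, ?_⟩
          have h1 := Int.emod_nonneg (a * n) hqz
          have h2 := Int.emod_nonneg (a * v) hqz
          have h3 : a * n ≡ a * v [ZMOD q] := by
            unfold Int.ModEq; omega
          have := Int.ModEq.cancel_left_div_gcd (by exact_mod_cast hq) h3
          rwa [Int.gcd_comm, haq, Nat.cast_one, Int.ediv_one] at this
    _ = 48 * q * ∑ c ∈ Finset.range q, f c := by
        rw [Finset.mul_sum]
        refine Finset.sum_congr rfl fun c _ => ?_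
        field_simp
    _ ≤ 48 * q * 4 := by gcongr; exact sum_range_inv_sq_add_inv_sq_le q
    _ = 192 * q := by ring

/-- The terms with `q ∣ n` in the sum of `sum_mul_le_of_near_rational`, where `τ n` is at distance
`|n| |τ - a/q|` from the integers. -/
lemma sum_dvd_le {N : ℕ} (hN : 1 ≤ N) {D : ℤ → ℝ} {τ : ℝ}
    (hD0 : ∀ n, 0 ≤ D n) (hD1 : ∀ n, D n ≤ N)
    (hD2 : ∀ n : ℤ, Real.sin (Real.pi * (τ * n)) ^ 2 * D n ≤ 1 / N)
    (hD3 : ∀ n : ℤ, 8 * N < |n| → D n = 0)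
    {a : ℤ} {q : ℕ} (hq : 1 ≤ q) (hβ : |τ - a / q| ≤ 1 / (16 * q * N)) :
    (∑ n ∈ (Finset.Icc (-(8 * N : ℤ)) (8 * N)).filter (fun n => (q : ℤ) ∣ n), D n) *
      |q * τ - a| ≤ 4 := by
  have hN0 : (0 : ℝ) < N := by exact_mod_cast hN
  have hN1 : (1 : ℝ) ≤ N := by exact_mod_cast hN
  have hq0 : (0 : ℝ) < q := by exact_mod_cast hq
  have hqz : (q : ℤ) ≠ 0 := by exact_mod_cast (by omega : q ≠ 0)
  set w := |q * τ - a| with hw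
  have hwβ : w = q * |τ - a / q| := by
    rw [hw, ← abs_of_pos hq0, ← abs_mul, abs_of_pos hq0]; congr 1; field_simp
  have hw1 : w * N ≤ 1 / 16 := by
    rw [hwβ]
    calc q * |τ - a / q| * N ≤ q * (1 / (16 * q * N)) * N := by gcongr
      _ = 1 / 16 := by field_simp
  rcases (abs_nonneg (q * τ - a)).eq_or_lt' with hw0 | hw0
  · rw [← hw] at hw0; rw [hw0, mul_zero]; norm_num
  rw [← hw] at hw0
  set g : ℕ → ℝ := fun k => min (N : ℝ) (1 / (4 * N * w ^ 2) * ((k : ℝ) ^ 2)⁻¹) with hg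
  have hDg : ∀ m : ℤ, m ≠ 0 → D (q * m) ≤ g m.natAbs := by
    intro m hm0
    have hmR : |(m : ℝ)| = m.natAbs := by rw [Nat.cast_natAbs]; push_cast; rfl
    have hm1 : (0 : ℝ) < m.natAbs := by exact_mod_cast Int.natAbs_pos.2 hm0
    by_cases hbig : 8 * N < |q * m|
    · rw [hD3 _ hbig]; simp only [hg]; positivity
    refine le_min (hD1 _) ?_
    have hnR : |((q * m : ℤ) : ℝ)| ≤ 8 * N := by
      have : |q * m| ≤ 8 * (N : ℤ) := not_lt.1 hbig
      exact_mod_cast this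
    have hsmall : |(τ - a / q) * ((q * m : ℤ) : ℝ)| ≤ 1 / 2 := by
      rw [abs_mul]
      have hq1 : (1 : ℝ) ≤ q := by exact_mod_cast hq
      calc |τ - a / q| * |((q * m : ℤ) : ℝ)| ≤ 1 / (16 * q * N) * (8 * N) := by gcongr
        _ = 1 / (2 * q) := by field_simp; norm_num
        _ ≤ 1 / 2 := by
          refine one_div_le_one_div_of_le (by norm_num) (by linarith)
    have hsin : |Real.sin (Real.pi * (τ * ((q * m : ℤ) : ℝ)))| =
        |Real.sin (Real.pi * ((τ - a / q) * ((q * m : ℤ) : ℝ)))| := by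
      have : Real.pi * ((τ - a / q) * ((q * m : ℤ) : ℝ)) =
          Real.pi * (τ * ((q * m : ℤ) : ℝ)) - ((a * m : ℤ) : ℝ) * Real.pi := by
        push_cast; field_simp
      rw [this, Real.sin_sub_int_mul_pi, abs_mul, abs_zpow]; simp
    have h2 : |Real.pi * ((τ - a / q) * ((q * m : ℤ) : ℝ))| ≤ Real.pi / 2 := by
      rw [abs_mul, abs_of_pos Real.pi_pos]
      nlinarith [Real.pi_pos]
    have h3 := Real.mul_abs_le_abs_sin h2
    rw [← hsin, abs_mul, abs_of_pos Real.pi_pos, abs_mul] at h3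
    have h4 : 2 / Real.pi * (Real.pi * (|τ - a / q| * |((q * m : ℤ) : ℝ)|)) =
        2 * (w * m.natAbs) := by
      push_cast
      rw [abs_mul, hmR, hwβ, abs_of_pos hq0]; field_simp
    rw [h4] at h3
    have h5 : (2 * (w * m.natAbs)) ^ 2 * D (q * m) ≤ 1 / N := by
      refine le_trans ?_ (hD2 (q * m))
      rw [← sq_abs (Real.sin _)]
      gcongr
      exact hD0 _
    rw [← div_eq_mul_inv, div_div, le_div_iff₀ (by positivity)]
    have h6 := mul_le_mul_of_nonneg_right h5 hN0.le
    rw [one_div, inv_mul_cancel₀ hN0.ne'] at h6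
    nlinarith
  have hg0 : ∀ k, 0 ≤ g k := fun k => by simp only [hg]; positivity
  set M := 8 * N with hM
  have hsub : ∑ n ∈ (Finset.Icc (-(8 * N : ℤ)) (8 * N)).filter (fun n => (q : ℤ) ∣ n), D n ≤
      ∑ m ∈ Finset.Icc (-(8 * N : ℤ)) (8 * N), D (q * m) := by
    rw [← Finset.sum_image (f := D) (g := fun m : ℤ => (q : ℤ) * m)
      (fun x _ y _ h => mul_left_cancel₀ hqz h)]
    refine Finset.sum_le_sum_of_subset_of_nonneg (fun n hn => ?_) (fun n _ _ => hD0 n)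
    rw [Finset.mem_filter, Finset.mem_Icc] at hn
    obtain ⟨⟨h1, h2⟩, m, rfl⟩ := hn
    refine Finset.mem_image.2 ⟨m, ?_, rfl⟩
    rw [Finset.mem_Icc]
    have hq1 : (1 : ℤ) ≤ q := by exact_mod_cast hq
    constructor <;> by_contra! hlt <;> nlinarith
  have hcover : ∑ m ∈ Finset.Icc (-(8 * N : ℤ)) (8 * N), D (q * m) ≤
      N + 2 * ∑ k ∈ Finset.Ioo 0 (M + 1), g k := by
    have hsplit : Finset.Icc (-(8 * N : ℤ)) (8 * N) ⊆ {0} ∪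
        ((Finset.Ioo 0 (M + 1)).image (fun k : ℕ => (k : ℤ)) ∪
          (Finset.Ioo 0 (M + 1)).image (fun k : ℕ => -(k : ℤ))) := by
      intro m hm
      rw [Finset.mem_Icc] at hm
      simp only [Finset.mem_union, Finset.mem_singleton, Finset.mem_image, Finset.mem_Ioo]
      rcases lt_trichotomy m 0 with h | h | h
      · exact Or.inr (Or.inr ⟨m.natAbs, by omega, by omega⟩)
      · exact Or.inl h
      · exact Or.inr (Or.inl ⟨m.natAbs, by omega, by omega⟩)
    have hnn : ∀ m : ℤ, 0 ≤ D (q * m) := fun m => hD0 _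
    have hun : ∀ s t : Finset ℤ, ∑ m ∈ s ∪ t, D (q * m) ≤
        ∑ m ∈ s, D (q * m) + ∑ m ∈ t, D (q * m) := fun s t => by
      rw [← Finset.sum_union_inter]
      have := Finset.sum_nonneg (s := s ∩ t) (fun m _ => hnn m)
      linarith
    refine (Finset.sum_le_sum_of_subset_of_nonneg hsplit (fun m _ _ => hnn m)).trans ?_
    refine (hun _ _).trans ?_
    rw [two_mul]
    refine add_le_add (by simpa using hD1 0) ((hun _ _).trans (add_le_add ?_ ?_))
    · rw [Finset.sum_image (fun x _ y _ h => by exact_mod_cast h)]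
      refine Finset.sum_le_sum fun k hk => ?_
      rw [Finset.mem_Ioo] at hk
      simpa using hDg k (by omega)
    · rw [Finset.sum_image (fun x _ y _ h => by simpa using h)]
      refine Finset.sum_le_sum fun k hk => ?_
      rw [Finset.mem_Ioo] at hk
      simpa using hDg (-k) (by omega)
  -- the two bounds in `g` balance at `k ≈ 1 / (N w)`
  set K := ⌊1 / (N * w)⌋₊ with hK
  have hK1 : (K : ℝ) ≤ 1 / (N * w) := Nat.floor_le (by positivity)
  have hK2 : 1 / (N * w) < K + 1 := Nat.lt_floor_add_one _
  have hgsum : ∑ k ∈ Finset.Ioo 0 (M + 1), g k ≤ K * N + 1 / (4 * N * w ^ 2) * (2 / (K + 1)) := by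
    have hsplit : Finset.Ioo 0 (M + 1) ⊆ Finset.Ioc 0 K ∪ Finset.Ioo K (M + 1) := by
      intro k hk
      rw [Finset.mem_Ioo] at hk
      rw [Finset.mem_union, Finset.mem_Ioc, Finset.mem_Ioo]
      omega
    refine (Finset.sum_le_sum_of_subset_of_nonneg hsplit (fun k _ _ => hg0 k)).trans ?_
    have hun : ∑ k ∈ Finset.Ioc 0 K ∪ Finset.Ioo K (M + 1), g k ≤
        ∑ k ∈ Finset.Ioc 0 K, g k + ∑ k ∈ Finset.Ioo K (M + 1), g k := by
      rw [← Finset.sum_union_inter]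
      have := Finset.sum_nonneg (s := Finset.Ioc 0 K ∩ Finset.Ioo K (M + 1)) (fun m _ => hg0 m)
      linarith
    refine hun.trans (add_le_add ?_ ?_)
    · calc ∑ k ∈ Finset.Ioc 0 K, g k ≤ ∑ k ∈ Finset.Ioc 0 K, (N : ℝ) :=
            Finset.sum_le_sum fun k _ => min_le_left _ _
        _ = K * N := by simp
    · calc ∑ k ∈ Finset.Ioo K (M + 1), g k
          ≤ ∑ k ∈ Finset.Ioo K (M + 1), 1 / (4 * N * w ^ 2) * ((k : ℝ) ^ 2)⁻¹ :=
            Finset.sum_le_sum fun k _ => min_le_right _ _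
        _ = 1 / (4 * N * w ^ 2) * ∑ k ∈ Finset.Ioo K (M + 1), ((k : ℝ) ^ 2)⁻¹ := by
            rw [Finset.mul_sum]
        _ ≤ _ := by gcongr; exact sum_Ioo_inv_sq_le K (M + 1)
  have hfin : K * N + 1 / (4 * N * w ^ 2) * (2 / (K + 1)) ≤ 3 / (2 * w) := by
    have e1 : K * (N : ℝ) ≤ 1 / w := by
      calc K * (N : ℝ) ≤ 1 / (N * w) * N := by gcongr
        _ = 1 / w := by field_simp
    have e2 : 1 / (4 * N * w ^ 2) * (2 / (K + 1)) ≤ 1 / (2 * w) := by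
      have : (2 : ℝ) / (K + 1) ≤ 2 / (1 / (N * w)) := by
        gcongr
      calc 1 / (4 * N * w ^ 2) * (2 / ((K : ℝ) + 1))
          ≤ 1 / (4 * N * w ^ 2) * (2 / (1 / (N * w))) := by gcongr
        _ = 1 / (2 * w) := by field_simp; norm_num
    have e3 : 1 / w + 1 / (2 * w) = 3 / (2 * w) := by field_simp; norm_num
    linarith
  have hall := hsub.trans (hcover.trans (add_le_add_right
    (mul_le_mul_of_nonneg_left (hgsum.trans hfin) zero_le_two) (N : ℝ)))
  calc _ ≤ (N + 2 * (3 / (2 * w))) * w := by gcongr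
    _ = w * N + 3 := by field_simp
    _ ≤ 4 := by linarith

/-- The arithmetic part of the Weyl bound: the sum which remains after differencing, near a
rational number `a / q`. Because the weights decay quadratically, no logarithm is lost. -/
lemma sum_mul_le_of_near_rational {N : ℕ} (hN : 1 ≤ N) {D : ℤ → ℝ} {τ : ℝ}
    (hD0 : ∀ n, 0 ≤ D n) (hD1 : ∀ n, D n ≤ N)
    (hD2 : ∀ n : ℤ, Real.sin (Real.pi * (τ * n)) ^ 2 * D n ≤ 1 / N)
    (hD3 : ∀ n : ℤ, 8 * N < |n| → D n = 0)
    {a : ℤ} {q : ℕ} (hq : 1 ≤ q) (haq : Int.gcd a q = 1) (hqN : q ≤ 16 * N)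
    (hβ : |τ - a / q| ≤ 1 / (16 * q * N)) :
    (∑ n ∈ Finset.Icc (-(8 * N : ℤ)) (8 * N), D n) * (q + N ^ 2 * |q * τ - a|) ≤
      50000 * N ^ 2 := by
  have hN0 : (0 : ℝ) < N := by exact_mod_cast hN
  have hq0 : (0 : ℝ) < q := by exact_mod_cast hq
  have hqN' : (q : ℝ) ≤ 16 * N := by exact_mod_cast hqN
  have h1 := sum_not_dvd_le hN hD0 hD2 hq haq hqN hβ
  have h2 := sum_dvd_le hN hD0 hD1 hD2 hD3 hq hβ
  have h3 : ∑ n ∈ (Finset.Icc (-(8 * N : ℤ)) (8 * N)).filter (fun n => (q : ℤ) ∣ n), D n ≤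
      48 * N / q * N := by
    refine (Finset.sum_le_card_nsmul _ _ (N : ℝ) fun n _ => hD1 n).trans ?_
    rw [nsmul_eq_mul]
    gcongr
    refine le_trans (Nat.cast_le.2 (Finset.card_le_card fun n hn => ?_))
      (card_filter_modEq_le hq hqN 0)
    rw [Finset.mem_filter] at hn ⊢
    exact ⟨hn.1, Int.modEq_zero_iff_dvd.2 hn.2⟩
  have hw1 : |q * τ - a| * N ≤ 1 / 16 := by
    have hwβ : |q * τ - a| = q * |τ - a / q| := by
      rw [← abs_of_pos hq0, ← abs_mul, abs_of_pos hq0]; congr 1; field_simp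
    rw [hwβ]
    calc q * |τ - a / q| * N ≤ q * (1 / (16 * q * N)) * N := by gcongr
      _ = 1 / 16 := by field_simp
  rw [← Finset.sum_filter_add_sum_filter_not _ (fun n => (q : ℤ) ∣ n)]
  set S1 := ∑ n ∈ (Finset.Icc (-(8 * N : ℤ)) (8 * N)).filter (fun n => (q : ℤ) ∣ n), D n
  set S2 := ∑ n ∈ (Finset.Icc (-(8 * N : ℤ)) (8 * N)).filter (fun n => ¬ (q : ℤ) ∣ n), D n
  set w := |q * τ - a|
  have hw0 : 0 ≤ w := abs_nonneg _
  have a1 : S1 * q ≤ 48 * N ^ 2 := by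
    calc S1 * q ≤ 48 * N / q * N * q := by gcongr
      _ = 48 * N ^ 2 := by field_simp
  have a2 : S2 * q ≤ 192 * (16 * N) ^ 2 := by
    calc S2 * q ≤ 192 * q * q := by gcongr
      _ = 192 * (q : ℝ) ^ 2 := by ring
      _ ≤ _ := by gcongr
  have a3 : S1 * (N ^ 2 * w) ≤ 4 * N ^ 2 := by nlinarith [sq_nonneg (N : ℝ)]
  have a4 : S2 * (N ^ 2 * w) ≤ 192 * N ^ 2 := by
    calc S2 * (N ^ 2 * w) ≤ 192 * (16 * N) * (N ^ 2 * w) := by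
          gcongr; linarith
      _ = 192 * 16 * N ^ 2 * (w * N) := by ring
      _ ≤ 192 * 16 * N ^ 2 * (1 / 16) := by gcongr
      _ = _ := by ring
  nlinarith

/-! ### Weyl's inequality without logarithmic loss -/

/-- Weyl differencing: the square is expanded and summed along the differences `h` of the two
variables, which makes the phase linear. The linear coefficient `x` disappears. -/
lemma IsCutoff.norm_weylSum_sq_le {φ : ℝ → ℝ} (hφ : IsCutoff φ) {N : ℕ} (hN : 1 ≤ N) (τ x : ℝ) :
    ‖weylSum φ N τ x‖ ^ 2 ≤ ∑ h ∈ Finset.Icc (-(4 * N : ℤ)) (4 * N),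
      ‖∑ l ∈ Finset.Icc (-(2 * N : ℤ)) (2 * N),
        ((φ ((l : ℝ) / N) * φ (((l + h : ℤ) : ℝ) / N) : ℝ) : ℂ) *
          echar (l * (-(τ * (2 * h : ℤ))))‖ := by
  have hN0 : (0 : ℝ) < N := by exact_mod_cast hN
  have hzero : ∀ l : ℤ, l ∉ Finset.Icc (-(2 * N : ℤ)) (2 * N) → φ ((l : ℝ) / N) = 0 :=
    fun _ hl => hφ.eq_zero_of_notMem hN hl
  set I := Finset.Icc (-(2 * N : ℤ)) (2 * N) with hI
  set G : ℤ → ℤ → ℂ := fun k l => (φ ((k : ℝ) / N) : ℂ) * echar (k * x - τ * k ^ 2) *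
    ((φ ((l : ℝ) / N) : ℂ) * echar (-(l * x - τ * l ^ 2))) with hG
  have h1 : ((‖weylSum φ N τ x‖ ^ 2 : ℝ) : ℂ) = ∑ l ∈ I, ∑ k ∈ I, G k l := by
    have : ((‖weylSum φ N τ x‖ ^ 2 : ℝ) : ℂ) =
        weylSum φ N τ x * (starRingEnd ℂ) (weylSum φ N τ x) := by
      rw [Complex.mul_conj, Complex.normSq_eq_norm_sq]
    rw [this, weylSum, map_sum, Finset.sum_mul_sum, Finset.sum_comm]
    refine Finset.sum_congr rfl fun l _ => Finset.sum_congr rfl fun k _ => ?_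
    rw [map_mul, Complex.conj_ofReal, ← echar_neg]
  have h2 : ∀ l ∈ I, ∑ k ∈ I, G k l = ∑ h ∈ Finset.Icc (-(4 * N : ℤ)) (4 * N), G (l + h) l := by
    intro l hl
    rw [hI, Finset.mem_Icc] at hl
    have e : ∑ h ∈ Finset.Icc (-(4 * N : ℤ)) (4 * N), G (l + h) l =
        ∑ k ∈ (Finset.Icc (-(4 * N : ℤ)) (4 * N)).image (fun h => l + h), G k l := by
      rw [Finset.sum_image (fun a _ b _ h => add_left_cancel h)]
    rw [e]
    refine Finset.sum_subset (fun k hk => ?_) (fun k _ hk => ?_)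
    · rw [hI, Finset.mem_Icc] at hk
      refine Finset.mem_image.2 ⟨k - l, ?_, by ring⟩
      rw [Finset.mem_Icc]; omega
    · simp [hG, hzero k hk]
  have h3 : ((‖weylSum φ N τ x‖ ^ 2 : ℝ) : ℂ) =
      ∑ h ∈ Finset.Icc (-(4 * N : ℤ)) (4 * N), echar (h * x - τ * h ^ 2) * ∑ l ∈ I,
        ((φ ((l : ℝ) / N) * φ (((l + h : ℤ) : ℝ) / N) : ℝ) : ℂ) *
          echar (l * (-(τ * (2 * h : ℤ)))) := by
    rw [h1, Finset.sum_congr rfl h2, Finset.sum_comm]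
    refine Finset.sum_congr rfl fun h _ => ?_
    rw [Finset.mul_sum]
    refine Finset.sum_congr rfl fun l _ => ?_
    have e : ((l + h : ℤ) : ℝ) * x - τ * ((l + h : ℤ) : ℝ) ^ 2 =
      (h * x - τ * h ^ 2) + (l * (-(τ * (2 * h : ℤ)))) + (l * x - τ * l ^ 2) := by push_cast; ring
    have e2 : echar (l * x - τ * l ^ 2) * echar (-(l * x - τ * l ^ 2)) = 1 := by
      rw [← echar_add]; simp
    simp only [hG]
    rw [e, echar_add, echar_add]
    push_cast
    linear_combination (φ ((l + h : ℝ) / N) * echar (h * x - τ * h ^ 2) *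
      echar (l * (-(τ * (2 * h)))) * φ (l / N) : ℂ) * e2
  have h4 : ‖weylSum φ N τ x‖ ^ 2 = ‖((‖weylSum φ N τ x‖ ^ 2 : ℝ) : ℂ)‖ := by
    rw [Complex.norm_real, Real.norm_of_nonneg (by positivity)]
  rw [h4, h3]
  refine (norm_sum_le _ _).trans (Finset.sum_le_sum fun h _ => ?_)
  rw [norm_mul, norm_echar, one_mul]

/-- The sharp Weyl bound near a rational number `a / q`, without any logarithmic loss. -/
lemma IsCutoff.exists_weyl_bound {φ : ℝ → ℝ} (hφ : IsCutoff φ) :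
    ∃ C : ℝ, 1 ≤ C ∧ ∀ N : ℕ, 1 ≤ N → ∀ (a : ℤ) (q : ℕ) (τ x : ℝ), 1 ≤ q → Int.gcd a q = 1 →
      q ≤ 16 * N → |τ - a / q| ≤ 1 / (16 * q * N) →
      ‖weylSum φ N τ x‖ ^ 2 * (q + N ^ 2 * |q * τ - a|) ≤ C * N ^ 2 := by
  obtain ⟨C, hC1, hC⟩ := hφ.exists_correlation_bound
  refine ⟨C * 50000, by linarith, fun N hN a q τ x hq haq hqN hβ => ?_⟩
  have hN0 : (0 : ℝ) < N := by exact_mod_cast hN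
  have hC0 : 0 < C := by linarith
  set T : ℤ → ℝ := fun h => ‖∑ l ∈ Finset.Icc (-(2 * N : ℤ)) (2 * N),
        ((φ ((l : ℝ) / N) * φ (((l + h : ℤ) : ℝ) / N) : ℝ) : ℂ) *
          echar (l * (-(τ * (2 * h : ℤ))))‖ with hT
  -- the differences `2h`, as a subset of all integers
  set D : ℤ → ℝ := fun n => if |n| ≤ 8 * N ∧ Even n then T (n / 2) / C else 0 with hD
  have hT0 : ∀ h, 0 ≤ T h := fun h => norm_nonneg _
  have hD0 : ∀ n, 0 ≤ D n := fun n => by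
    simp only [hD]; split_ifs
    · exact div_nonneg (hT0 _) hC0.le
    · exact le_rfl
  have hD1 : ∀ n, D n ≤ N := fun n => by
    simp only [hD]; split_ifs
    · rw [div_le_iff₀ hC0, mul_comm]; exact (hC N hN _ _).1
    · exact hN0.le
  have hD2 : ∀ n : ℤ, Real.sin (Real.pi * (τ * n)) ^ 2 * D n ≤ 1 / N := fun n => by
    simp only [hD]; split_ifs with h
    · obtain ⟨_, h2⟩ := h
      have h3 := (hC N hN (n / 2) (-(τ * (2 * (n / 2) : ℤ)))).2
      rw [mul_neg, Real.sin_neg, neg_sq] at h3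
      have h3' : Real.sin (Real.pi * (τ * (2 * (n / 2) : ℤ))) ^ 2 * T (n / 2) ≤ C / N := h3
      rw [Int.two_mul_ediv_two_of_even h2] at h3'
      rw [← mul_div_assoc, div_le_iff₀ hC0]
      calc _ ≤ C / N := h3'
        _ = _ := by ring
    · rw [mul_zero]; positivity
  have hD3 : ∀ n : ℤ, 8 * N < |n| → D n = 0 := fun n hn => by
    simp only [hD]; rw [if_neg]; omega
  have key := sum_mul_le_of_near_rational hN hD0 hD1 hD2 hD3 hq haq hqN hβ
  have h1 : ‖weylSum φ N τ x‖ ^ 2 ≤ C * ∑ n ∈ Finset.Icc (-(8 * N : ℤ)) (8 * N), D n := by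
    refine (hφ.norm_weylSum_sq_le hN τ x).trans ?_
    calc ∑ h ∈ Finset.Icc (-(4 * N : ℤ)) (4 * N), T h
        = ∑ h ∈ Finset.Icc (-(4 * N : ℤ)) (4 * N), C * D (2 * h) := by
          refine Finset.sum_congr rfl fun h hh => ?_
          rw [Finset.mem_Icc] at hh
          have : |2 * h| ≤ 8 * (N : ℤ) := by rw [abs_le]; omega
          simp only [hD]
          rw [if_pos ⟨this, even_two_mul h⟩, Int.mul_ediv_cancel_left _ two_ne_zero]
          field_simp
      _ = C * ∑ n ∈ (Finset.Icc (-(4 * N : ℤ)) (4 * N)).image (fun h => 2 * h), D n := by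
          rw [Finset.mul_sum, Finset.sum_image (fun a _ b _ h => by simpa using h)]
      _ ≤ _ := by
          refine mul_le_mul_of_nonneg_left ?_ hC0.le
          refine Finset.sum_le_sum_of_subset_of_nonneg (fun n hn => ?_) (fun n _ _ => hD0 n)
          obtain ⟨h, hh, rfl⟩ := Finset.mem_image.1 hn
          rw [Finset.mem_Icc] at hh ⊢
          omega
  calc _ ≤ (C * ∑ n ∈ Finset.Icc (-(8 * N : ℤ)) (8 * N), D n) * (q + N ^ 2 * |q * τ - a|) := by
        gcongr
    _ = C * ((∑ n ∈ Finset.Icc (-(8 * N : ℤ)) (8 * N), D n) * (q + N ^ 2 * |q * τ - a|)) := by ring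
    _ ≤ C * (50000 * N ^ 2) := by gcongr
    _ = _ := by ring

lemma IsCutoff.exists_weylSum_trivial_bound {φ : ℝ → ℝ} (hφ : IsCutoff φ) :
    ∃ C : ℝ, 1 ≤ C ∧ ∀ N : ℕ, 1 ≤ N → ∀ τ x : ℝ, ‖weylSum φ N τ x‖ ≤ C * N := by
  obtain ⟨c, hc1, hb0, -, -⟩ := hφ.exists_bound
  refine ⟨5 * c, by linarith, fun N hN τ x => ?_⟩
  have hN1 : (1 : ℝ) ≤ N := by exact_mod_cast hN
  have hcard : ((Finset.Icc (-(2 * N : ℤ)) (2 * N)).card : ℝ) ≤ 5 * N := by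
    rw [Int.card_Icc]
    have : (((2 * N : ℤ) + 1 - -(2 * N)).toNat : ℝ) = 4 * N + 1 := by
      have : ((2 * N : ℤ) + 1 - -(2 * N)).toNat = 4 * N + 1 := by omega
      rw [this]; push_cast; ring
    rw [this]; linarith
  calc ‖weylSum φ N τ x‖ ≤ ∑ k ∈ Finset.Icc (-(2 * N : ℤ)) (2 * N), c := by
        refine norm_sum_le_of_le _ fun l _ => ?_
        rw [norm_mul, norm_echar, mul_one, Complex.norm_real, Real.norm_eq_abs]
        exact hb0 _
    _ ≤ 5 * N * c := by rw [Finset.sum_const, nsmul_eq_mul]; gcongr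
    _ = _ := by ring

/-- On the major arcs the Weyl bound holds for every `N`: for small `N` it is trivial, as the
quantity `q + N²|qτ - a|` is then bounded. -/
lemma IsCutoff.exists_weyl_bound_major {φ : ℝ → ℝ} (hφ : IsCutoff φ) :
    ∃ C : ℝ, 1 ≤ C ∧ ∀ N : ℕ, 1 ≤ N → ∀ σ : ℝ, σ ≤ 1 / 4 →
      ∀ (a : ℤ) (q : ℕ) (τ x : ℝ), 1 ≤ q → Int.gcd a q = 1 →
      (q : ℝ) ≤ (N : ℝ) ^ (2 * σ) → (N : ℝ) ^ 2 * |q * τ - a| ≤ (N : ℝ) ^ (2 * σ) →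
      ‖weylSum φ N τ x‖ ^ 2 * (q + N ^ 2 * |q * τ - a|) ≤ C * N ^ 2 := by
  obtain ⟨C1, hC1, h1⟩ := hφ.exists_weyl_bound
  obtain ⟨C2, hC2, h2⟩ := hφ.exists_weylSum_trivial_bound
  refine ⟨max C1 (32 * C2 ^ 2), le_max_of_le_left hC1, fun N hN σ hσ a q τ x hq haq hqN hβ => ?_⟩
  have hN0 : (0 : ℝ) < N := by exact_mod_cast hN
  have hN1 : (1 : ℝ) ≤ N := by exact_mod_cast hN
  have hq0 : (0 : ℝ) < q := by exact_mod_cast hq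
  have hpow : (N : ℝ) ^ (2 * σ) ≤ Real.sqrt N := by
    rw [Real.sqrt_eq_rpow]
    exact Real.rpow_le_rpow_of_exponent_le hN1 (by linarith)
  have hsq : Real.sqrt N * Real.sqrt N = N := Real.mul_self_sqrt hN0.le
  have hs1 : 1 ≤ Real.sqrt N := Real.one_le_sqrt.2 hN1
  -- from `N = 256` on, `N^{2σ} ≤ √N` makes the approximation good enough for `exists_weyl_bound`
  rcases le_or_gt 256 (N : ℝ) with h256 | h256
  · have h16 : 16 ≤ Real.sqrt N := by
      rw [Real.le_sqrt' (by norm_num)]; linarith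
    refine (h1 N hN a q τ x hq haq ?_ ?_).trans ?_
    · have : (q : ℝ) ≤ 16 * N := by nlinarith
      exact_mod_cast this
    · have e : |τ - a / q| = |q * τ - a| / q := by
        rw [eq_div_iff hq0.ne', ← abs_of_pos hq0, ← abs_mul, abs_of_pos hq0]
        congr 1; field_simp
      rw [e, div_le_div_iff₀ hq0 (by positivity)]
      have h3 : N ^ 2 * |q * τ - a| ≤ Real.sqrt N := hβ.trans hpow
      have h4 : |q * τ - a| * (16 * N) ≤ 1 := by
        have : |q * τ - a| * (16 * N) * N ≤ N := by nlinarith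
        by_contra! hlt
        nlinarith
      nlinarith
    · gcongr; exact le_max_left _ _
  · have h16 : Real.sqrt N ≤ 16 := by
      rw [Real.sqrt_le_left (by norm_num)]; linarith
    calc ‖weylSum φ N τ x‖ ^ 2 * (q + N ^ 2 * |q * τ - a|) ≤ (C2 * N) ^ 2 * 32 := by
          gcongr
          · exact h2 N hN τ x
          · linarith
      _ = 32 * C2 ^ 2 * N ^ 2 := by ring
      _ ≤ _ := by gcongr; exact le_max_right _ _

/-- Dirichlet's theorem supplies a rational approximation at which the Weyl bound applies. -/
lemma IsCutoff.exists_weyl_bound_dirichlet {φ : ℝ → ℝ} (hφ : IsCutoff φ) :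
    ∃ C : ℝ, 1 ≤ C ∧ ∀ N : ℕ, 1 ≤ N → ∀ τ : ℝ, ∃ (a : ℤ) (q : ℕ), 1 ≤ q ∧
      ∀ x : ℝ, ‖weylSum φ N τ x‖ ^ 2 * (q + N ^ 2 * |q * τ - a|) ≤ C * N ^ 2 := by
  obtain ⟨C1, hC1, h1⟩ := hφ.exists_weyl_bound
  refine ⟨C1, hC1, fun N hN τ => ?_⟩
  obtain ⟨ρ, h2, h3⟩ := Real.exists_rat_abs_sub_le_and_den_le τ (n := 16 * N) (by omega)
  have hN0 : (0 : ℝ) < N := by exact_mod_cast hN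
  have hd : (0 : ℝ) < ρ.den := by exact_mod_cast ρ.pos
  refine ⟨ρ.num, ρ.den, ρ.pos, fun x => h1 N hN _ _ τ x ρ.pos ?_ h3 ?_⟩
  · have := ρ.reduced
    rwa [Int.gcd_def, Int.natAbs_natCast]
  · have e : (ρ : ℝ) = ρ.num / ρ.den := by exact_mod_cast (Rat.num_div_den ρ).symm
    rw [← e]
    refine h2.trans ?_
    apply one_div_le_one_div_of_le (by positivity)
    push_cast
    nlinarith

/-! ### The kernel at major times -/

/-- The frequencies at which the symbol of `kernel φ θ N` can be nonzero. -/
noncomputable def frequencyBox (d N : ℕ) : Finset (Fin d → ℤ) :=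
  Fintype.piFinset fun _ => Finset.Icc (-(2 * N : ℤ)) (2 * N)

/-- The Fourier coefficient of `kernel φ θ N t` at `k`. -/
noncomputable def kernelCoeff {d : ℕ} (φ : ℝ → ℝ) (θ : Fin d → ℝ) (N : ℕ) (t : ℝ)
    (k : Fin d → ℤ) : ℂ :=
  ((∏ j, φ ((k j : ℝ) / N) : ℝ) : ℂ) *
    Complex.exp (-(2 * Real.pi * (t * ∑ j, θ j * (k j : ℝ) ^ 2) : ℝ) * Complex.I)

lemma IsCutoff.kernel_eq_sum {d : ℕ} {φ : ℝ → ℝ} (hφ : IsCutoff φ) (θ : Fin d → ℝ) {N : ℕ}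
    (hN : 1 ≤ N) (t : ℝ) (x : UnitAddTorus (Fin d)) :
    kernel φ θ N t x =
      ∑ k ∈ frequencyBox d N, kernelCoeff φ θ N t k * UnitAddTorus.mFourier k x := by
  rw [kernel, tsum_eq_sum (s := frequencyBox d N)]
  · refine Finset.sum_congr rfl fun k _ => ?_
    simp only [kernelCoeff]; ring
  · intro k hk
    simp only [frequencyBox, Fintype.mem_piFinset, not_forall] at hk
    obtain ⟨j, hj⟩ := hk
    rw [Finset.prod_eq_zero (Finset.mem_univ j) (hφ.eq_zero_of_notMem hN hj)]
    simp

lemma IsCutoff.exists_norm_kernelCoeff_le {φ : ℝ → ℝ} (hφ : IsCutoff φ) :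
    ∃ c : ℝ, 1 ≤ c ∧ ∀ {d : ℕ} (θ : Fin d → ℝ) (N : ℕ) (t : ℝ) (k : Fin d → ℤ),
      ‖kernelCoeff φ θ N t k‖ ≤ c ^ d := by
  obtain ⟨c, hc1, hb0, -, -⟩ := hφ.exists_bound
  refine ⟨c, hc1, fun {d} θ N t k => ?_⟩
  rw [kernelCoeff, norm_mul]
  have : ‖Complex.exp (-(2 * Real.pi * (t * ∑ j, θ j * (k j : ℝ) ^ 2) : ℝ) * Complex.I)‖ = 1 := by
    rw [← Complex.ofReal_neg, Complex.norm_exp_ofReal_mul_I]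
  rw [this, mul_one, Complex.norm_real, Real.norm_eq_abs, Finset.abs_prod]
  calc ∏ j, |φ ((k j : ℝ) / N)| ≤ ∏ _j : Fin d, c :=
        Finset.prod_le_prod (fun _ _ => abs_nonneg _) (fun _ _ => hb0 _)
    _ = c ^ d := by simp

lemma IsCutoff.continuous_kernel {d : ℕ} {φ : ℝ → ℝ} (hφ : IsCutoff φ) (θ : Fin d → ℝ) {N : ℕ}
    (hN : 1 ≤ N) :
    Continuous fun z : ℝ × UnitAddTorus (Fin d) => kernel φ θ N z.1 z.2 := by
  simp only [hφ.kernel_eq_sum θ hN, kernelCoeff]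
  refine continuous_finsetSum _ fun k _ => ?_
  have h1 : Continuous fun z : ℝ × UnitAddTorus (Fin d) => UnitAddTorus.mFourier k z.2 :=
    (UnitAddTorus.mFourier k).continuous.comp continuous_snd
  refine Continuous.mul ?_ h1
  fun_prop

/-- The kernel is a product of one-dimensional exponential sums. -/
lemma IsCutoff.kernel_eq_prod {d : ℕ} {φ : ℝ → ℝ} (hφ : IsCutoff φ) (θ : Fin d → ℝ) {N : ℕ}
    (hN : 1 ≤ N) (t : ℝ) (y : Fin d → ℝ) :
    kernel φ θ N t (fun j => (y j : UnitAddCircle)) = ∏ j, weylSum φ N (θ j * t) (y j) := by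
  rw [hφ.kernel_eq_sum θ hN]
  simp only [weylSum]
  rw [Finset.prod_univ_sum, frequencyBox]
  refine Finset.sum_congr rfl fun k _ => ?_
  rw [Finset.prod_mul_distrib, kernelCoeff]
  have e1 : ∏ j, echar (k j * y j - θ j * t * k j ^ 2) =
      Complex.exp (-(2 * Real.pi * (t * ∑ j, θ j * (k j : ℝ) ^ 2) : ℝ) * Complex.I) *
        UnitAddTorus.mFourier k (fun j => (y j : UnitAddCircle)) := by
    have e2 : UnitAddTorus.mFourier k (fun j => (y j : UnitAddCircle)) =
        ∏ j, echar (k j * y j) := by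
      simp only [UnitAddTorus.mFourier, ContinuousMap.coe_mk]
      refine Finset.prod_congr rfl fun j _ => ?_
      rw [fourier_coe_apply, echar]
      congr 1; push_cast; ring
    have e3 : Complex.exp (-(2 * Real.pi * (t * ∑ j, θ j * (k j : ℝ) ^ 2) : ℝ) * Complex.I) =
        ∏ j, echar (-(θ j * t * k j ^ 2)) := by
      simp only [echar]
      rw [← Complex.exp_sum]
      congr 1
      push_cast
      rw [Finset.mul_sum, Finset.mul_sum, ← Finset.sum_neg_distrib, Finset.sum_mul]
      refine Finset.sum_congr rfl fun j _ => ?_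
      ring
    rw [e2, e3, ← Finset.prod_mul_distrib]
    refine Finset.prod_congr rfl fun j _ => ?_
    rw [← echar_add]; congr 1; ring
  rw [e1]
  push_cast
  ring

lemma exists_real_lift {d : ℕ} (x : UnitAddTorus (Fin d)) :
    ∃ y : Fin d → ℝ, x = fun j => (y j : UnitAddCircle) := by
  choose y hy using fun j => QuotientAddGroup.mk_surjective (x j)
  exact ⟨y, funext fun j => (hy j).symm⟩

/-- At a major time, the coordinate with the best rational approximation controls the kernel: the
bounds for the other factors are replaced by the one for the smallest `q + N²|qθ_jt - a|`. -/
lemma IsCutoff.exists_kernel_bound {φ : ℝ → ℝ} (hφ : IsCutoff φ) :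
    ∃ C : ℝ, 1 ≤ C ∧ ∀ {d : ℕ} (J : Set ℝ) (θ : Fin d → ℝ) (σ : ℝ) (N : ℕ) (t : ℝ), 1 ≤ N →
      σ ≤ 1 / 4 → t ∈ majorTimes J θ σ N → ∃ (j : Fin d) (a : ℤ) (q : ℕ), 1 ≤ q ∧
        q + (N : ℝ) ^ 2 * |q * (θ j * t) - a| ≤ 2 * (N : ℝ) ^ (2 * σ) ∧
        ∀ x, ‖kernel φ θ N t x‖ ≤
          (C * N * (q + (N : ℝ) ^ 2 * |q * (θ j * t) - a|) ^ (-(1 / 2) : ℝ)) ^ d := by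
  obtain ⟨C1, hC1, h1⟩ := hφ.exists_weyl_bound_major
  obtain ⟨C2, hC2, h2⟩ := hφ.exists_weyl_bound_dirichlet
  refine ⟨max C1 C2, le_max_of_le_left hC1, ?_⟩
  intro d J θ σ N t hN hσ ht
  obtain ⟨-, j₀, a₀, q₀, hq₀, hg₀, hqN₀, hβ₀⟩ := ht
  have hN0 : (0 : ℝ) < N := by exact_mod_cast hN
  have hq₀' : (0 : ℝ) < q₀ := by exact_mod_cast hq₀
  have hβ₀' : (N : ℝ) ^ 2 * |q₀ * (θ j₀ * t) - a₀| ≤ (N : ℝ) ^ (2 * σ) := by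
    refine le_trans (le_of_eq ?_) hβ₀
    have : |q₀ * (θ j₀ * t) - a₀| = q₀ * |θ j₀ * t - a₀ / q₀| := by
      rw [← abs_of_pos hq₀', ← abs_mul, abs_of_pos hq₀']; congr 1; field_simp
    rw [this]; ring
  have hall : ∀ j : Fin d, ∃ (a : ℤ) (q : ℕ), 1 ≤ q ∧
      (j = j₀ → q + (N : ℝ) ^ 2 * |q * (θ j * t) - a| ≤ 2 * (N : ℝ) ^ (2 * σ)) ∧
      ∀ x : ℝ, ‖weylSum φ N (θ j * t) x‖ ^ 2 * (q + N ^ 2 * |q * (θ j * t) - a|) ≤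
        max C1 C2 * N ^ 2 := by
    intro j
    by_cases hj : j = j₀
    · subst hj
      refine ⟨a₀, q₀, hq₀, fun _ => by linarith, fun x => ?_⟩
      refine (h1 N hN σ hσ a₀ q₀ _ x hq₀ hg₀ hqN₀ hβ₀').trans ?_
      gcongr; exact le_max_left _ _
    · obtain ⟨a, q, hq, h⟩ := h2 N hN (θ j * t)
      refine ⟨a, q, hq, fun h => absurd h hj, fun x => (h x).trans ?_⟩
      gcongr; exact le_max_right _ _
  -- the given fraction at `j₀`, one from Dirichlet's theorem in all other coordinates
  choose a q hq hmaj hw using hall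
  set v : Fin d → ℝ := fun j => q j + (N : ℝ) ^ 2 * |q j * (θ j * t) - a j| with hv
  have hv1 : ∀ j, 0 < v j := fun j => by
    have : (0 : ℝ) < q j := by exact_mod_cast hq j
    simp only [hv]; positivity
  obtain ⟨i, -, hi⟩ := Finset.exists_min_image Finset.univ v ⟨j₀, Finset.mem_univ _⟩
  refine ⟨i, a i, q i, hq i, (hi j₀ (Finset.mem_univ _)).trans (hmaj j₀ rfl), fun x => ?_⟩
  obtain ⟨y, rfl⟩ := exists_real_lift x
  rw [hφ.kernel_eq_prod θ hN, norm_prod]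
  have hM : 1 ≤ max C1 C2 := le_max_of_le_left hC1
  have hb : ∀ j ∈ Finset.univ, ‖weylSum φ N (θ j * t) (y j)‖ ≤
      max C1 C2 * N * (v i) ^ (-(1 / 2) : ℝ) := by
    intro j hj
    have h3 : ‖weylSum φ N (θ j * t) (y j)‖ ^ 2 * v i ≤ (max C1 C2 * N) ^ 2 := by
      calc _ ≤ ‖weylSum φ N (θ j * t) (y j)‖ ^ 2 * v j := by gcongr; exact hi j hj
        _ ≤ max C1 C2 * N ^ 2 := hw j _
        _ ≤ (max C1 C2) ^ 2 * N ^ 2 := by gcongr; nlinarith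
        _ = _ := by ring
    have h4 : ((v i) ^ (-(1 / 2) : ℝ)) ^ 2 = (v i)⁻¹ := by
      rw [← Real.rpow_natCast, ← Real.rpow_mul (hv1 i).le, ← Real.rpow_neg_one]; norm_num
    have hvi := hv1 i
    refine le_of_sq_le_sq ?_ (by positivity)
    rw [mul_pow _ _ 2, h4, ← div_eq_mul_inv, le_div_iff₀ hvi]
    exact h3
  calc _ ≤ ∏ _j : Fin d, (max C1 C2 * N * (v i) ^ (-(1 / 2) : ℝ)) :=
        Finset.prod_le_prod (fun _ _ => norm_nonneg _) hb
    _ = _ := by simp [hv]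

lemma IsCutoff.exists_norm_kernel_le {φ : ℝ → ℝ} (hφ : IsCutoff φ) {d : ℕ} (θ : Fin d → ℝ) {N : ℕ}
    (hN : 1 ≤ N) : ∃ C : ℝ, 0 ≤ C ∧ ∀ t x, ‖kernel φ θ N t x‖ ≤ C := by
  obtain ⟨C2, hC2, h2⟩ := hφ.exists_weylSum_trivial_bound
  refine ⟨∏ _j : Fin d, (C2 * N), by positivity, fun t x => ?_⟩
  obtain ⟨y, rfl⟩ := exists_real_lift x
  rw [hφ.kernel_eq_prod θ hN, norm_prod]
  exact Finset.prod_le_prod (fun _ _ => norm_nonneg _) (fun j _ => h2 N hN _ _)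

/-- The truncated kernel, as a function on spacetime, is Borel measurable. -/
lemma IsCutoff.measurable_truncatedKernel {d : ℕ} {φ : ℝ → ℝ} (hφ : IsCutoff φ) {J : Set ℝ}
    (hJ : MeasurableSet J) (θ : Fin d → ℝ) (σ : ℝ) {N : ℕ} (hN : 1 ≤ N) :
    Measurable fun z : ℝ × UnitAddTorus (Fin d) => truncatedKernel J φ θ σ N z.1 z.2 := by
  have hm : MeasurableSet (majorTimes J θ σ N) := by
    have : majorTimes J θ σ N = J ∩ ⋃ (j : Fin d) (a : ℤ) (q : ℕ),
        {t : ℝ | 1 ≤ q ∧ Int.gcd a q = 1 ∧ (q : ℝ) ≤ (N : ℝ) ^ (2 * σ) ∧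
          (q : ℝ) * (N : ℝ) ^ 2 * |θ j * t - (a : ℝ) / q| ≤ (N : ℝ) ^ (2 * σ)} := by
      ext t; simp [majorTimes]
    rw [this]
    refine hJ.inter (MeasurableSet.iUnion fun j => MeasurableSet.iUnion fun a =>
      MeasurableSet.iUnion fun q => ?_)
    refine (MeasurableSet.const _).inter ((MeasurableSet.const _).inter
      ((MeasurableSet.const _).inter ?_))
    have hc : Measurable fun t : ℝ => (q : ℝ) * (N : ℝ) ^ 2 * |θ j * t - (a : ℝ) / q| :=
      (by fun_prop : Continuous fun t : ℝ =>
        (q : ℝ) * (N : ℝ) ^ 2 * |θ j * t - (a : ℝ) / q|).measurable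
    exact measurableSet_le hc measurable_const
  have h : (fun z : ℝ × UnitAddTorus (Fin d) => truncatedKernel J φ θ σ N z.1 z.2) =
      (Prod.fst ⁻¹' majorTimes J θ σ N).indicator
        (fun z : ℝ × UnitAddTorus (Fin d) => kernel φ θ N z.1 z.2) := by
    ext z; rfl
  rw [h]
  exact (hφ.continuous_kernel θ hN).measurable.indicator (measurable_fst hm)

/-! ### Moments of the truncated divisor function -/

/-- The number of divisors of `n` which are at most `V`. -/
def divisorCountUpTo (V n : ℕ) : ℕ := ((Finset.Icc 1 V).filter (fun e => e ∣ n)).card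

/-- The truncated divisor function is submultiplicative: a divisor `g` of `e m` is determined by the
divisors `gcd(g, e)` of `e` and `g / gcd(g, e)` of `m`. -/
lemma divisorCountUpTo_mul_le (V e m : ℕ) :
    divisorCountUpTo V (e * m) ≤ divisorCountUpTo V e * divisorCountUpTo V m := by
  unfold divisorCountUpTo
  rw [← Finset.card_product]
  refine Finset.card_le_card_of_injOn (fun g => (Nat.gcd g e, g / Nat.gcd g e)) ?_ ?_
  · intro g hg
    simp only [Finset.coe_filter, Finset.mem_Icc, Set.mem_ofPred_eq] at hg
    simp only [Finset.coe_product, Finset.coe_filter, Finset.mem_Icc, Set.mem_prod,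
      Set.mem_ofPred_eq]
    obtain ⟨⟨h1, h2⟩, h3⟩ := hg
    have hpos : 0 < Nat.gcd g e := Nat.gcd_pos_of_pos_left _ h1
    refine ⟨⟨⟨hpos, (Nat.gcd_le_left _ h1).trans h2⟩, Nat.gcd_dvd_right _ _⟩,
      ⟨Nat.div_pos (Nat.gcd_le_left _ h1) hpos, (Nat.div_le_self _ _).trans h2⟩, ?_⟩
    have h4 : Nat.Coprime (g / Nat.gcd g e) (e / Nat.gcd g e) := Nat.coprime_div_gcd_div_gcd hpos
    refine h4.dvd_of_dvd_mul_left ?_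
    have h5 : g / Nat.gcd g e ∣ (e * m) / Nat.gcd g e :=
      Nat.div_dvd_div (Nat.gcd_dvd_left _ _) h3
    rwa [Nat.mul_div_right_comm (Nat.gcd_dvd_right g e)] at h5
  · intro g _ g' _ h
    simp only [Prod.mk.injEq] at h
    have h1 := Nat.mul_div_cancel' (Nat.gcd_dvd_left g e)
    have h2 := Nat.mul_div_cancel' (Nat.gcd_dvd_left g' e)
    rw [← h1, ← h2, h.1]
    congr 1
    rw [← h.1, h.2, h.1]

lemma sum_divisorCountUpTo_mul_le (V M : ℕ) {f : ℕ → ℝ} (hf : ∀ n, 0 ≤ f n) :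
    ∑ n ∈ Finset.Icc 1 M, (divisorCountUpTo V n : ℝ) * f n ≤
      ∑ e ∈ Finset.Icc 1 V, ∑ m ∈ Finset.Icc 1 (M / e), f (e * m) := by
  have h1 : ∀ n, (divisorCountUpTo V n : ℝ) * f n =
      ∑ e ∈ Finset.Icc 1 V, if e ∣ n then f n else 0 := fun n => by
    rw [← Finset.sum_filter, Finset.sum_const, nsmul_eq_mul, divisorCountUpTo]
  simp only [h1]
  rw [Finset.sum_comm]
  refine Finset.sum_le_sum fun e he => ?_
  rw [Finset.mem_Icc] at he
  rw [← Finset.sum_filter, ← Finset.sum_image (f := f) (g := fun m => e * m)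
    (fun x _ y _ h => Nat.eq_of_mul_eq_mul_left he.1 h)]
  refine Finset.sum_le_sum_of_subset_of_nonneg (fun n hn => ?_) (fun n _ _ => hf n)
  rw [Finset.mem_filter, Finset.mem_Icc] at hn
  obtain ⟨⟨h2, h3⟩, m, rfl⟩ := hn
  refine Finset.mem_image.2 ⟨m, ?_, rfl⟩
  rw [Finset.mem_Icc]
  exact ⟨Nat.pos_of_mul_pos_left h2, (Nat.le_div_iff_mul_le he.1).2 (by linarith)⟩

/-- Logarithmic moments of the truncated divisor function. -/
lemma sum_divisorCountUpTo_pow_div_le (V B : ℕ) :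
    ∑ n ∈ Finset.Icc 1 V, (divisorCountUpTo V n : ℝ) ^ B / n ≤ (1 + Real.log V) ^ 2 ^ B := by
  induction B with
  | zero =>
    have := harmonic_le_one_add_log V
    rw [harmonic_eq_sum_Icc] at this
    push_cast at this
    simpa using this
  | succ B ih =>
    have h1 : ∀ n, (divisorCountUpTo V n : ℝ) ^ (B + 1) / n =
        (divisorCountUpTo V n : ℝ) * ((divisorCountUpTo V n : ℝ) ^ B / n) := fun n => by ring
    simp only [h1]
    refine (sum_divisorCountUpTo_mul_le V V (fun n => by positivity)).trans ?_
    have hlog : 0 ≤ Real.log V := Real.log_natCast_nonneg V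
    calc ∑ e ∈ Finset.Icc 1 V, ∑ m ∈ Finset.Icc 1 (V / e),
          (divisorCountUpTo V (e * m) : ℝ) ^ B / ((e * m : ℕ) : ℝ)
        ≤ ∑ e ∈ Finset.Icc 1 V, ∑ m ∈ Finset.Icc 1 V,
          ((divisorCountUpTo V e : ℝ) ^ B / e) * ((divisorCountUpTo V m : ℝ) ^ B / m) := by
          refine Finset.sum_le_sum fun e he => ?_
          rw [Finset.mem_Icc] at he
          refine (Finset.sum_le_sum_of_subset_of_nonneg
            (Finset.Icc_subset_Icc_right (Nat.div_le_self V e)) (fun _ _ _ => by positivity)).trans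
            (Finset.sum_le_sum fun m hm => ?_)
          rw [div_mul_div_comm, ← mul_pow]
          push_cast
          gcongr
          exact_mod_cast divisorCountUpTo_mul_le V e m
      _ = (∑ e ∈ Finset.Icc 1 V, (divisorCountUpTo V e : ℝ) ^ B / e) *
          ∑ m ∈ Finset.Icc 1 V, (divisorCountUpTo V m : ℝ) ^ B / m := by
          rw [Finset.sum_mul_sum]
      _ ≤ (1 + Real.log V) ^ 2 ^ B * (1 + Real.log V) ^ 2 ^ B := by gcongr
      _ = (1 + Real.log V) ^ 2 ^ (B + 1) := by rw [← pow_add, ← two_mul, ← pow_succ']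

/-- The moments of the truncated divisor function lose only powers of `log V`. One factor is opened
as a sum over divisors `e`, and submultiplicativity separates `e` from the rest. -/
lemma sum_divisorCountUpTo_pow_le (V B M : ℕ) :
    ∑ n ∈ Finset.Icc 1 M, (divisorCountUpTo V n : ℝ) ^ B ≤ M * (1 + Real.log V) ^ 2 ^ B := by
  have hlog : 0 ≤ Real.log V := Real.log_natCast_nonneg V
  induction B generalizing M with
  | zero =>
    simp
    nlinarith [(Nat.cast_nonneg M : (0 : ℝ) ≤ M)]
  | succ B ih =>
    have h1 : ∀ n, (divisorCountUpTo V n : ℝ) ^ (B + 1) =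
        (divisorCountUpTo V n : ℝ) * (divisorCountUpTo V n : ℝ) ^ B := fun n => by ring
    simp only [h1]
    refine (sum_divisorCountUpTo_mul_le V M (fun n => by positivity)).trans ?_
    calc ∑ e ∈ Finset.Icc 1 V, ∑ m ∈ Finset.Icc 1 (M / e), (divisorCountUpTo V (e * m) : ℝ) ^ B
        ≤ ∑ e ∈ Finset.Icc 1 V, (divisorCountUpTo V e : ℝ) ^ B *
            (M / e * (1 + Real.log V) ^ 2 ^ B) := by
          refine Finset.sum_le_sum fun e he => ?_
          rw [Finset.mem_Icc] at he
          calc _ ≤ ∑ m ∈ Finset.Icc 1 (M / e),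
                (divisorCountUpTo V e : ℝ) ^ B * (divisorCountUpTo V m : ℝ) ^ B := by
                refine Finset.sum_le_sum fun m _ => ?_
                rw [← mul_pow]
                gcongr
                exact_mod_cast divisorCountUpTo_mul_le V e m
            _ = (divisorCountUpTo V e : ℝ) ^ B *
                ∑ m ∈ Finset.Icc 1 (M / e), (divisorCountUpTo V m : ℝ) ^ B := by
                rw [Finset.mul_sum]
            _ ≤ (divisorCountUpTo V e : ℝ) ^ B *
                (((M / e : ℕ) : ℝ) * (1 + Real.log V) ^ 2 ^ B) := by gcongr; exact ih _
            _ ≤ _ := by gcongr; exact Nat.cast_div_le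
      _ = M * (1 + Real.log V) ^ 2 ^ B *
          ∑ e ∈ Finset.Icc 1 V, (divisorCountUpTo V e : ℝ) ^ B / e := by
          rw [Finset.mul_sum]
          refine Finset.sum_congr rfl fun e _ => by ring
      _ ≤ M * (1 + Real.log V) ^ 2 ^ B * (1 + Real.log V) ^ 2 ^ B := by
          gcongr; exact sum_divisorCountUpTo_pow_div_le V B
      _ = _ := by rw [mul_assoc, ← pow_add, ← two_mul, ← pow_succ']

lemma exists_one_add_log_pow_le (m : ℕ) {ε : ℝ} (hε : 0 < ε) :
    ∃ C : ℝ, 1 ≤ C ∧ ∀ V : ℕ, 1 ≤ V → (1 + Real.log V) ^ m ≤ C * (V : ℝ) ^ ε := by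
  rcases Nat.eq_zero_or_pos m with rfl | hm
  · refine ⟨1, le_rfl, fun V hV => ?_⟩
    rw [pow_zero, one_mul]
    exact Real.one_le_rpow (by exact_mod_cast hV) hε.le
  have hm' : (0 : ℝ) < m := by exact_mod_cast hm
  set η := ε / m with hη
  have hη0 : 0 < η := by positivity
  refine ⟨(1 + 1 / η) ^ m, one_le_pow₀ (by linarith [one_div_pos.2 hη0]), fun V hV => ?_⟩
  have hV1 : (1 : ℝ) ≤ V := by exact_mod_cast hV
  have h1 : Real.log V ≤ (V : ℝ) ^ η / η := Real.log_le_rpow_div (by positivity) hη0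
  have h2 : 1 ≤ (V : ℝ) ^ η := Real.one_le_rpow hV1 hη0.le
  have h3 : 1 + Real.log V ≤ (1 + 1 / η) * (V : ℝ) ^ η := by
    have : (1 + 1 / η) * (V : ℝ) ^ η = (V : ℝ) ^ η + (V : ℝ) ^ η / η := by ring
    linarith
  have hlog : 0 ≤ Real.log V := Real.log_natCast_nonneg V
  calc (1 + Real.log V) ^ m ≤ ((1 + 1 / η) * (V : ℝ) ^ η) ^ m := by gcongr
    _ = (1 + 1 / η) ^ m * (V : ℝ) ^ ε := by
      rw [mul_pow, ← Real.rpow_natCast ((V : ℝ) ^ η), ← Real.rpow_mul (by positivity)]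
      congr 2
      rw [hη]; field_simp

/-! ### Real interpolation of bilinear forms -/

lemma tsum_two_rpow_neg_abs_ne_top {κ : ℝ} (hκ : 0 < κ) :
    ∑' j : ℤ, (2 : ℝ≥0∞) ^ (-(κ * |(j : ℝ)|)) ≠ ⊤ := by
  have hr : ∀ j : ℤ, (2 : ℝ≥0∞) ^ (-(κ * |(j : ℝ)|)) =
      ENNReal.ofReal (((2 : ℝ) ^ (-κ)) ^ j.natAbs) := fun j => by
    rw [← Real.rpow_natCast, ← Real.rpow_mul zero_le_two, ← ENNReal.ofReal_rpow_of_pos two_pos,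
      Nat.cast_natAbs, neg_mul]
    simp
  simp only [hr]
  refine Summable.tsum_ofReal_ne_top ?_
  have hlt : (2 : ℝ) ^ (-κ) < 1 := Real.rpow_lt_one_of_one_lt_of_neg one_lt_two (by linarith)
  have hg := summable_geometric_of_lt_one (by positivity) hlt
  refine Summable.of_nat_of_neg ?_ ?_ <;> simpa using hg

/-- The geometric sums of real interpolation: two competing exponentials. -/
lemma exists_tsum_min_le {κ₁ κ₂ : ℝ} (h₁ : 0 < κ₁) (h₂ : 0 < κ₂) :
    ∃ C : ℝ≥0∞, C ≠ ⊤ ∧ ∀ c : ℝ≥0∞, c ≠ 0 → c ≠ ⊤ →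
      ∑' m : ℤ, min ((2 : ℝ≥0∞) ^ (-(m * κ₁))) (c * 2 ^ (m * κ₂)) ≤ C * c ^ (κ₁ / (κ₁ + κ₂)) := by
  set κ := min κ₁ κ₂ with hκ
  have hκ0 : 0 < κ := lt_min h₁ h₂
  refine ⟨2 ^ κ₁ * ∑' j : ℤ, (2 : ℝ≥0∞) ^ (-(κ * |(j : ℝ)|)),
    ENNReal.mul_ne_top (by simp) (tsum_two_rpow_neg_abs_ne_top hκ0), fun c hc0 hct => ?_⟩
  -- the two exponentials cross at `m = L`
  set L : ℝ := -Real.logb 2 c.toReal / (κ₁ + κ₂) with hL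
  have hs : κ₁ + κ₂ ≠ 0 := by positivity
  have hc : c = 2 ^ (-(L * (κ₁ + κ₂))) := by
    have hpos : 0 < c.toReal := ENNReal.toReal_pos hc0 hct
    have h3 : -(L * (κ₁ + κ₂)) = Real.logb 2 c.toReal := by rw [hL]; field_simp
    have h4 : (2 : ℝ≥0∞) = ENNReal.ofReal 2 := by simp
    rw [h3, h4, ENNReal.ofReal_rpow_of_pos two_pos, Real.rpow_logb two_pos (by norm_num) hpos,
      ENNReal.ofReal_toReal hct]
  have hce : c ^ (κ₁ / (κ₁ + κ₂)) = 2 ^ (-(L * κ₁)) := by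
    rw [hc, ← ENNReal.rpow_mul]; congr 1; field_simp
  rw [hce, mul_right_comm, ← ENNReal.rpow_add _ _ two_ne_zero ENNReal.ofNat_ne_top,
    ← (Equiv.addLeft ⌊L⌋).tsum_eq, ← ENNReal.tsum_mul_left]
  refine ENNReal.tsum_le_tsum fun j => ?_
  rw [← ENNReal.rpow_add _ _ two_ne_zero ENNReal.ofNat_ne_top, Equiv.coe_addLeft]
  push_cast
  have f1 := Int.floor_le L
  have f2 := Int.lt_floor_add_one L
  rcases le_or_gt 0 j with hj | hj
  · have hj' : (0 : ℝ) ≤ j := by exact_mod_cast hj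
    refine (min_le_left _ _).trans (ENNReal.rpow_le_rpow_of_exponent_le one_le_two ?_)
    rw [abs_of_nonneg hj']
    have : κ * j ≤ κ₁ * j := by gcongr; exact min_le_left _ _
    nlinarith
  · have hj' : (j : ℝ) < 0 := by exact_mod_cast hj
    refine (min_le_right _ _).trans ?_
    rw [hc, ← ENNReal.rpow_add _ _ two_ne_zero ENNReal.ofNat_ne_top]
    refine ENNReal.rpow_le_rpow_of_exponent_le one_le_two ?_
    rw [abs_of_neg hj']
    have : κ * (-j) ≤ κ₂ * (-j) := by
      refine mul_le_mul_of_nonneg_right (min_le_right _ _) (by linarith)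
    nlinarith

section LevelSets

variable {α : Type*}

/-- The dyadic level set `{2^k ≤ |f| < 2^(k+1)}`. -/
def levelSet (f : α → ℂ) (k : ℤ) : Set α := {x | ‖f x‖ₑ ∈ Set.Ico ((2 : ℝ≥0∞) ^ k) (2 ^ (k + 1))}

lemma disjoint_levelSet (f : α → ℂ) {k l : ℤ} (h : k ≠ l) :
    Disjoint (levelSet f k) (levelSet f l) := by
  have key : ∀ {k l : ℤ} {x}, x ∈ levelSet f k → x ∈ levelSet f l → k ≤ l := by
    intro k l x hk hl
    have h1 : (2 : ℝ≥0∞) ^ k < 2 ^ (l + 1) := hk.1.trans_lt hl.2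
    by_contra! hlt
    have : (2 : ℝ≥0∞) ^ (l + 1) ≤ 2 ^ k := ENNReal.zpow_le_of_le one_le_two (by omega)
    exact absurd h1 (not_lt.2 this)
  rw [Set.disjoint_left]
  exact fun x hk hl => h (le_antisymm (key hk hl) (key hl hk))

lemma exists_mem_levelSet {f : α → ℂ} {x : α} (h : f x ≠ 0) : ∃ k, x ∈ levelSet f k :=
  ENNReal.exists_mem_Ico_zpow (by simpa using h) enorm_ne_top ENNReal.one_lt_two
    ENNReal.ofNat_ne_top

/-- The part of `f` on a dyadic level set. -/
noncomputable def levelPart (f : α → ℂ) (k : ℤ) : α → ℂ := (levelSet f k).indicator f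

lemma exists_norm_levelPart_le (f : α → ℂ) (k : ℤ) : ∃ M : ℝ, ∀ x, ‖levelPart f k x‖ ≤ M := by
  refine ⟨((2 : ℝ≥0∞) ^ (k + 1)).toReal, fun x => ?_⟩
  by_cases hx : x ∈ levelSet f k
  · rw [levelPart, Set.indicator_of_mem hx, ← toReal_enorm]
    refine ENNReal.toReal_mono ?_ hx.2.le
    exact ENNReal.zpow_ne_top two_ne_zero ENNReal.ofNat_ne_top _
  · rw [levelPart, Set.indicator_of_notMem hx, norm_zero]; exact ENNReal.toReal_nonneg

variable [MeasurableSpace α] {μ : Measure α}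

lemma measurableSet_levelSet {f : α → ℂ} (hf : Measurable f) (k : ℤ) :
    MeasurableSet (levelSet f k) :=
  hf.enorm measurableSet_Ico

lemma tsum_setLIntegral_levelSet_le {f : α → ℂ} (hf : Measurable f) (g : α → ℝ≥0∞) :
    ∑' k, ∫⁻ x in levelSet f k, g x ∂μ ≤ ∫⁻ x, g x ∂μ := by
  rw [← lintegral_iUnion (measurableSet_levelSet hf) (fun k l h => disjoint_levelSet f h)]
  exact setLIntegral_le_lintegral _ _

lemma ennreal_rpow_le_rpow_of_nonpos {x y : ℝ≥0∞} {z : ℝ} (hxy : x ≤ y) (hz : z ≤ 0) :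
    y ^ z ≤ x ^ z := by
  rw [← ENNReal.inv_le_inv, ← ENNReal.rpow_neg, ← ENNReal.rpow_neg]
  exact ENNReal.rpow_le_rpow hxy (by linarith)

lemma setLIntegral_levelSet_le {f : α → ℂ} (hf : Measurable f) {s : ℝ} (hs : 1 ≤ s) (k : ℤ) :
    ∫⁻ x in levelSet f k, ‖f x‖ₑ ∂μ ≤
      2 ^ (k * (1 - s)) * ∫⁻ x in levelSet f k, ‖f x‖ₑ ^ s ∂μ := by
  rw [← lintegral_const_mul _ (hf.enorm.pow_const s)]
  refine setLIntegral_mono' (measurableSet_levelSet hf k) fun x hx => ?_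
  have h0 : ‖f x‖ₑ ≠ 0 := fun h => by
    have := hx.1
    rw [h, nonpos_iff_eq_zero] at this
    exact (ENNReal.zpow_pos two_ne_zero ENNReal.ofNat_ne_top k).ne' this
  calc ‖f x‖ₑ = ‖f x‖ₑ ^ (1 - s) * ‖f x‖ₑ ^ s := by
        rw [← ENNReal.rpow_add _ _ h0 enorm_ne_top]; simp
    _ ≤ _ := by
        gcongr
        rw [ENNReal.rpow_mul, ENNReal.rpow_intCast]
        exact ennreal_rpow_le_rpow_of_nonpos hx.1 (by linarith)

lemma setLIntegral_levelSet_sq_le {f : α → ℂ} (hf : Measurable f) {s : ℝ} (hs1 : 1 ≤ s)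
    (hs : s ≤ 2) (k : ℤ) :
    ∫⁻ x in levelSet f k, ‖f x‖ₑ ^ (2 : ℝ) ∂μ ≤
      2 ^ (1 + k * (2 - s)) * ∫⁻ x in levelSet f k, ‖f x‖ₑ ^ s ∂μ := by
  rw [← lintegral_const_mul _ (hf.enorm.pow_const s)]
  refine setLIntegral_mono' (measurableSet_levelSet hf k) fun x hx => ?_
  have h0 : ‖f x‖ₑ ≠ 0 := fun h => by
    have := hx.1
    rw [h, nonpos_iff_eq_zero] at this
    exact (ENNReal.zpow_pos two_ne_zero ENNReal.ofNat_ne_top k).ne' this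
  calc ‖f x‖ₑ ^ (2 : ℝ) = ‖f x‖ₑ ^ (2 - s) * ‖f x‖ₑ ^ s := by
        rw [← ENNReal.rpow_add _ _ h0 enorm_ne_top]; simp
    _ ≤ _ := by
        gcongr
        refine (ENNReal.rpow_le_rpow hx.2.le (by linarith)).trans ?_
        rw [← ENNReal.rpow_intCast, ← ENNReal.rpow_mul]
        refine ENNReal.rpow_le_rpow_of_exponent_le one_le_two ?_
        push_cast
        nlinarith

lemma measurable_levelPart {f : α → ℂ} (hf : Measurable f) (k : ℤ) : Measurable (levelPart f k) :=
  hf.indicator (measurableSet_levelSet hf k)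

lemma lintegral_levelPart {f : α → ℂ} (hf : Measurable f) (k : ℤ) {s : ℝ} (hs : 0 < s) :
    ∫⁻ x, ‖levelPart f k x‖ₑ ^ s ∂μ = ∫⁻ x in levelSet f k, ‖f x‖ₑ ^ s ∂μ := by
  rw [← lintegral_indicator (measurableSet_levelSet hf k)]
  refine lintegral_congr fun x => ?_
  by_cases hx : x ∈ levelSet f k
  · rw [levelPart, Set.indicator_of_mem hx, Set.indicator_of_mem hx]
  · rw [levelPart, Set.indicator_of_notMem hx, Set.indicator_of_notMem hx, enorm_zero,
      ENNReal.zero_rpow_of_pos hs]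

lemma eLpNorm_one_levelPart_le {f : α → ℂ} (hf : Measurable f) {s : ℝ} (hs : 1 ≤ s) (k : ℤ) :
    eLpNorm (levelPart f k) 1 μ ≤
      2 ^ (k * (1 - s)) * ∫⁻ x in levelSet f k, ‖f x‖ₑ ^ s ∂μ := by
  rw [eLpNorm_one_eq_lintegral_enorm]
  have := lintegral_levelPart (μ := μ) hf k one_pos
  simp only [ENNReal.rpow_one] at this
  rw [this]
  exact setLIntegral_levelSet_le hf hs k

lemma eLpNorm_two_levelPart_le {f : α → ℂ} (hf : Measurable f) {s : ℝ} (hs1 : 1 ≤ s)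
    (hs : s ≤ 2) (k : ℤ) :
    eLpNorm (levelPart f k) 2 μ ≤
      2 * 2 ^ (k * (1 - s / 2)) * (∫⁻ x in levelSet f k, ‖f x‖ₑ ^ s ∂μ) ^ (1 / 2 : ℝ) := by
  rw [eLpNorm_eq_lintegral_rpow_enorm_toReal two_ne_zero ENNReal.ofNat_ne_top, ENNReal.toReal_ofNat,
    lintegral_levelPart hf k two_pos]
  refine (ENNReal.rpow_le_rpow (setLIntegral_levelSet_sq_le hf hs1 hs k) (by norm_num)).trans ?_
  rw [ENNReal.mul_rpow_of_nonneg _ _ (by norm_num), ← ENNReal.rpow_mul]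
  gcongr
  calc (2 : ℝ≥0∞) ^ ((1 + k * (2 - s)) * (1 / 2)) ≤ 2 ^ (1 + k * (1 - s / 2)) := by
        refine ENNReal.rpow_le_rpow_of_exponent_le one_le_two ?_
        linarith
    _ = 2 * 2 ^ (k * (1 - s / 2)) := by
        rw [ENNReal.rpow_add _ _ two_ne_zero ENNReal.ofNat_ne_top, ENNReal.rpow_one]

/-- The bilinear form `∬ K(x, y) f(x) h(y)`. -/
noncomputable def bilinForm (μ : Measure α) (K : α × α → ℂ) (f h : α → ℂ) : ℂ :=
  ∫ z, K z * (f z.1 * h z.2) ∂(μ.prod μ)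

/-- A bilinear form with bounded kernel is at most the sum of its values at the dyadic parts of its
arguments. -/
lemma enorm_bilinForm_le_tsum [SFinite μ] {K : α × α → ℂ} (hK : Measurable K) {M : ℝ}
    (hM : ∀ z, ‖K z‖ ≤ M) {f h : α → ℂ} (hf : Measurable f) (hh : Measurable h)
    (hfi : Integrable f μ) (hhi : Integrable h μ) :
    ‖bilinForm μ K f h‖ₑ ≤
      ∑' z : ℤ × ℤ, ‖bilinForm μ K (levelPart f z.1) (levelPart h z.2)‖ₑ := by
  set G : α × α → ℂ := fun z => K z * (f z.1 * h z.2) with hG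
  have hGi : Integrable G (μ.prod μ) :=
    (hfi.mul_prod hhi).bdd_mul (c := M) hK.aestronglyMeasurable (Filter.Eventually.of_forall hM)
  set S : ℤ × ℤ → Set (α × α) := fun z => levelSet f z.1 ×ˢ levelSet h z.2 with hS
  have hSm : ∀ z, MeasurableSet (S z) := fun z =>
    (measurableSet_levelSet hf _).prod (measurableSet_levelSet hh _)
  have hSd : Pairwise (Function.onFun Disjoint S) := by
    intro z w hzw
    simp only [Function.onFun, hS]
    rw [Set.disjoint_prod]
    by_cases h1 : z.1 = w.1
    · exact Or.inr (disjoint_levelSet h fun h2 => hzw (Prod.ext h1 h2))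
    · exact Or.inl (disjoint_levelSet f h1)
  have h1 := hasSum_integral_iUnion hSm hSd hGi.integrableOn
  have h2 : ∫ z in ⋃ i, S i, G z ∂(μ.prod μ) = bilinForm μ K f h := by
    rw [bilinForm]
    refine setIntegral_eq_integral_of_forall_compl_eq_zero fun z hz => ?_
    by_contra hne
    apply hz
    have hf0 : f z.1 ≠ 0 := fun h0 => hne (by rw [hG]; simp [h0])
    have hh0 : h z.2 ≠ 0 := fun h0 => hne (by rw [hG]; simp [h0])
    obtain ⟨k, hk⟩ := exists_mem_levelSet hf0
    obtain ⟨l, hl⟩ := exists_mem_levelSet hh0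
    exact Set.mem_iUnion.2 ⟨(k, l), hk, hl⟩
  have h3 : ∀ z, ∫ w in S z, G w ∂(μ.prod μ) =
      bilinForm μ K (levelPart f z.1) (levelPart h z.2) := fun z => by
    rw [bilinForm, ← integral_indicator (hSm z)]
    refine integral_congr_ae (Filter.Eventually.of_forall fun w => ?_)
    change (levelSet f z.1 ×ˢ levelSet h z.2).indicator G w =
      K w * ((levelSet f z.1).indicator f w.1 * (levelSet h z.2).indicator h w.2)
    rw [hG]
    by_cases ha : w.1 ∈ levelSet f z.1 <;> by_cases hb : w.2 ∈ levelSet h z.2 <;>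
      simp [ha, hb]
  rw [h2] at h1
  simp only [h3] at h1
  rw [← h1.tsum_eq]
  exact enorm_tsum_le_tsum_enorm

lemma eLpNorm_one_eq_tsum_le {f : α → ℂ} (hf : Measurable f) :
    ∑' k, eLpNorm (levelPart f k) 1 μ ≤ eLpNorm f 1 μ := by
  have : ∀ k, eLpNorm (levelPart f k) 1 μ = ∫⁻ x in levelSet f k, ‖f x‖ₑ ∂μ := fun k => by
    rw [eLpNorm_one_eq_lintegral_enorm]
    simpa using lintegral_levelPart (μ := μ) hf k one_pos
  simp only [this]
  rw [eLpNorm_one_eq_lintegral_enorm]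
  exact tsum_setLIntegral_levelSet_le hf _

lemma rpow_half_mul_le_add (a b : ℝ≥0∞) : (a * b) ^ (1 / 2 : ℝ) ≤ a + b := by
  have h1 : a * b ≤ (a + b) ^ (2 : ℝ) := by
    rw [ENNReal.rpow_two, sq]
    exact mul_le_mul' le_self_add le_add_self
  calc (a * b) ^ (1 / 2 : ℝ) ≤ ((a + b) ^ (2 : ℝ)) ^ (1 / 2 : ℝ) :=
        ENNReal.rpow_le_rpow h1 (by norm_num)
    _ = a + b := by rw [← ENNReal.rpow_mul]; norm_num

/-- The normalised case of `exists_bilinForm_le`. -/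
lemma exists_bilinForm_le_of_le_one {s lam : ℝ} (hs1 : 1 < s) (hs2 : s < 2) (hlam0 : 0 ≤ lam)
    (hlam1 : lam ≤ 1) (hlam : 2 * (s - 1) < lam * s) :
    ∃ C : ℝ≥0∞, C ≠ ⊤ ∧ ∀ {α : Type} [MeasurableSpace α] (μ : Measure α) [IsProbabilityMeasure μ]
      (K : α × α → ℂ) (M : ℝ) (κ A c : ℝ≥0∞), Measurable K → (∀ z, ‖K z‖ ≤ M) → c ≠ 0 → c ≠ ⊤ →
      (∀ f h : α → ℂ, Measurable f → Measurable h → (∃ m : ℝ, ∀ x, ‖f x‖ ≤ m) →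
        (∃ m : ℝ, ∀ x, ‖h x‖ ≤ m) → ‖bilinForm μ K f h‖ₑ ≤
          κ * (eLpNorm f 1 μ * eLpNorm h 1 μ) + A * min (eLpNorm f 1 μ * eLpNorm h 1 μ)
            (c * ((eLpNorm f 1 μ * eLpNorm h 1 μ) ^ (1 - lam) *
              (eLpNorm f 2 μ * eLpNorm h 2 μ) ^ lam))) →
      ∀ f h : α → ℂ, Measurable f → Measurable h → ∫⁻ x, ‖f x‖ₑ ^ s ∂μ ≤ 1 →
        ∫⁻ x, ‖h x‖ₑ ^ s ∂μ ≤ 1 → eLpNorm f 1 μ ≤ 1 → eLpNorm h 1 μ ≤ 1 →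
        ‖bilinForm μ K f h‖ₑ ≤ κ + C * A * c ^ (2 * (s - 1) / (lam * s)) := by
  set κ₁ := s - 1 with hκ₁
  set κ₂ := 1 - s + lam * s / 2 with hκ₂
  have h1 : 0 < κ₁ := by linarith
  have h2 : 0 < κ₂ := by linarith
  obtain ⟨C₀, hC₀, hsum⟩ := exists_tsum_min_le h1 h2
  have he : κ₁ / (κ₁ + κ₂) = 2 * (s - 1) / (lam * s) := by
    rw [show κ₁ + κ₂ = lam * s / 2 by rw [hκ₁, hκ₂]; ring, hκ₁]
    field_simp
  refine ⟨2 * (C₀ * 4 ^ (κ₁ / (κ₁ + κ₂))), by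
    refine ENNReal.mul_ne_top (by simp) (ENNReal.mul_ne_top hC₀ ?_)
    exact ENNReal.rpow_ne_top_of_nonneg (by positivity) (by simp), ?_⟩
  intro α _ μ _ K M κ A c hK hM hc0 hct hB f h hf hh hfs hhs hf1 hh1
  have hfi : Integrable f μ := memLp_one_iff_integrable.1 ⟨hf.aestronglyMeasurable,
    hf1.trans_lt ENNReal.one_lt_top⟩
  have hhi : Integrable h μ := memLp_one_iff_integrable.1 ⟨hh.aestronglyMeasurable,
    hh1.trans_lt ENNReal.one_lt_top⟩
  set a : ℤ → ℝ≥0∞ := fun k => ∫⁻ x in levelSet f k, ‖f x‖ₑ ^ s ∂μ with ha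
  set b : ℤ → ℝ≥0∞ := fun k => ∫⁻ x in levelSet h k, ‖h x‖ₑ ^ s ∂μ with hb
  have ha1 : ∑' k, a k ≤ 1 := (tsum_setLIntegral_levelSet_le hf _).trans hfs
  have hb1 : ∑' k, b k ≤ 1 := (tsum_setLIntegral_levelSet_le hh _).trans hhs
  set wt : ℤ → ℝ≥0∞ := fun m => min ((2 : ℝ≥0∞) ^ (-(m * κ₁))) ((4 * c) * 2 ^ (m * κ₂)) with hwt
  have hwtsum : ∑' m, wt m ≤ C₀ * (4 * c) ^ (κ₁ / (κ₁ + κ₂)) :=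
    hsum (4 * c) (by simp [hc0]) (ENNReal.mul_ne_top (by simp) hct)
  have htop : (2 : ℝ≥0∞) ≠ ⊤ := ENNReal.ofNat_ne_top
  have hpt : ∀ k l : ℤ, min (eLpNorm (levelPart f k) 1 μ * eLpNorm (levelPart h l) 1 μ)
      (c * ((eLpNorm (levelPart f k) 1 μ * eLpNorm (levelPart h l) 1 μ) ^ (1 - lam) *
        (eLpNorm (levelPart f k) 2 μ * eLpNorm (levelPart h l) 2 μ) ^ lam)) ≤
      wt (k + l) * (a k + b l) := by
    intro k l
    have hab : a k * b l ≤ 1 := by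
      calc a k * b l ≤ 1 * 1 := mul_le_mul' ((ENNReal.le_tsum k).trans ha1)
            ((ENNReal.le_tsum l).trans hb1)
        _ = 1 := one_mul 1
    have hhalf : (a k * b l) ^ (1 / 2 : ℝ) ≤ a k + b l := rpow_half_mul_le_add _ _
    have hX : eLpNorm (levelPart f k) 1 μ * eLpNorm (levelPart h l) 1 μ ≤
        2 ^ (-(((k + l : ℤ) : ℝ) * κ₁)) * (a k * b l) := by
      refine (mul_le_mul' (eLpNorm_one_levelPart_le hf hs1.le k)
        (eLpNorm_one_levelPart_le hh hs1.le l)).trans_eq ?_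
      rw [mul_mul_mul_comm, ← ENNReal.rpow_add _ _ two_ne_zero htop]
      congr 2
      push_cast; ring
    have hY : eLpNorm (levelPart f k) 2 μ * eLpNorm (levelPart h l) 2 μ ≤
        4 * 2 ^ (((k + l : ℤ) : ℝ) * (1 - s / 2)) * (a k * b l) ^ (1 / 2 : ℝ) := by
      refine (mul_le_mul' (eLpNorm_two_levelPart_le hf hs1.le hs2.le k)
        (eLpNorm_two_levelPart_le hh hs1.le hs2.le l)).trans_eq ?_
      have e1 : (2 : ℝ≥0∞) ^ (((k + l : ℤ) : ℝ) * (1 - s / 2)) =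
          2 ^ (k * (1 - s / 2)) * 2 ^ (l * (1 - s / 2)) := by
        rw [← ENNReal.rpow_add _ _ two_ne_zero htop]
        congr 1
        push_cast; ring
      rw [mul_mul_mul_comm, ← ENNReal.mul_rpow_of_nonneg _ _ (by norm_num : (0 : ℝ) ≤ 1 / 2), e1]
      congr 1
      ring
    refine le_trans ?_ (mul_le_mul_right hhalf _)
    rw [hwt]
    simp only
    rw [min_mul_of_nonneg _ _ zero_le]
    refine min_le_min ?_ ?_
    · refine hX.trans (mul_le_mul_right ?_ _)
      calc a k * b l = (a k * b l) ^ (1 : ℝ) := (ENNReal.rpow_one _).symm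
        _ ≤ _ := ENNReal.rpow_le_rpow_of_exponent_ge hab (by norm_num)
    · have hlam1' : 0 ≤ 1 - lam := by linarith
      calc _ ≤ c * ((2 ^ (-(((k + l : ℤ) : ℝ) * κ₁)) * (a k * b l)) ^ (1 - lam) *
            (4 * 2 ^ (((k + l : ℤ) : ℝ) * (1 - s / 2)) * (a k * b l) ^ (1 / 2 : ℝ)) ^ lam) := by
            gcongr
        _ = c * (4 ^ lam * 2 ^ (((k + l : ℤ) : ℝ) * κ₂) *
              ((a k * b l) ^ (1 - lam) * (a k * b l) ^ (lam / 2))) := by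
            rw [ENNReal.mul_rpow_of_nonneg _ _ hlam1', ENNReal.mul_rpow_of_nonneg _ _ hlam0,
              ENNReal.mul_rpow_of_nonneg _ _ hlam0, ← ENNReal.rpow_mul, ← ENNReal.rpow_mul,
              ← ENNReal.rpow_mul]
            have e1 : (2 : ℝ≥0∞) ^ (((k + l : ℤ) : ℝ) * κ₂) =
                2 ^ (-(((k + l : ℤ) : ℝ) * κ₁) * (1 - lam)) *
                  2 ^ (((k + l : ℤ) : ℝ) * (1 - s / 2) * lam) := by
              rw [← ENNReal.rpow_add _ _ two_ne_zero htop]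
              congr 1
              rw [hκ₁, hκ₂]; ring
            rw [e1, show (1 / 2 : ℝ) * lam = lam / 2 by ring]
            ring
        _ ≤ c * (4 * 2 ^ (((k + l : ℤ) : ℝ) * κ₂) * (a k * b l) ^ (1 / 2 : ℝ)) := by
            gcongr
            · calc (4 : ℝ≥0∞) ^ lam ≤ 4 ^ (1 : ℝ) :=
                    ENNReal.rpow_le_rpow_of_exponent_le (by norm_num) hlam1
                _ = 4 := ENNReal.rpow_one _
            · rw [← ENNReal.rpow_add_of_nonneg _ _ hlam1' (by linarith)]
              exact ENNReal.rpow_le_rpow_of_exponent_ge hab (by linarith)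
        _ = _ := by ring
  have hX : ∑' z : ℤ × ℤ, eLpNorm (levelPart f z.1) 1 μ * eLpNorm (levelPart h z.2) 1 μ ≤ 1 := by
    rw [ENNReal.tsum_prod (f := fun k l => eLpNorm (levelPart f k) 1 μ *
      eLpNorm (levelPart h l) 1 μ)]
    simp only [ENNReal.tsum_mul_left, ENNReal.tsum_mul_right]
    calc _ ≤ (1 : ℝ≥0∞) * 1 := mul_le_mul' ((eLpNorm_one_eq_tsum_le hf).trans hf1)
          ((eLpNorm_one_eq_tsum_le hh).trans hh1)
      _ = 1 := one_mul 1
  have hwt_sum : ∑' z : ℤ × ℤ, wt (z.1 + z.2) * (a z.1 + b z.2) ≤ 2 * ∑' m, wt m := by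
    simp only [mul_add]
    rw [ENNReal.tsum_add, two_mul]
    refine add_le_add ?_ ?_
    · rw [ENNReal.tsum_prod (f := fun k l => wt (k + l) * a k)]
      simp only [ENNReal.tsum_mul_right]
      have : ∀ k, ∑' l, wt (k + l) = ∑' m, wt m := fun k => (Equiv.addLeft k).tsum_eq wt
      simp only [this, ENNReal.tsum_mul_left]
      calc _ ≤ (∑' m, wt m) * 1 := by gcongr
        _ = _ := mul_one _
    · rw [ENNReal.tsum_prod (f := fun k l => wt (k + l) * b l), ENNReal.tsum_comm]
      simp only [ENNReal.tsum_mul_right]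
      have : ∀ l, ∑' k, wt (k + l) = ∑' m, wt m := fun l => (Equiv.addRight l).tsum_eq wt
      simp only [this, ENNReal.tsum_mul_left]
      calc _ ≤ (∑' m, wt m) * 1 := by gcongr
        _ = _ := mul_one _
  refine (enorm_bilinForm_le_tsum hK hM hf hh hfi hhi).trans ?_
  calc _ ≤ ∑' z : ℤ × ℤ, (κ * (eLpNorm (levelPart f z.1) 1 μ * eLpNorm (levelPart h z.2) 1 μ) +
          A * (wt (z.1 + z.2) * (a z.1 + b z.2))) := by
        refine ENNReal.tsum_le_tsum fun z => ?_
        refine (hB _ _ (measurable_levelPart hf _) (measurable_levelPart hh _)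
          (exists_norm_levelPart_le _ _) (exists_norm_levelPart_le _ _)).trans ?_
        gcongr
        exact hpt _ _
    _ ≤ κ * 1 + A * (2 * (C₀ * (4 * c) ^ (κ₁ / (κ₁ + κ₂)))) := by
        rw [ENNReal.tsum_add, ENNReal.tsum_mul_left, ENNReal.tsum_mul_left]
        gcongr
        exact hwt_sum.trans (by gcongr)
    _ = _ := by
        rw [ENNReal.mul_rpow_of_nonneg _ _ (by positivity), ← he]
        ring

/-- Real interpolation for a bilinear form. If on bounded functions the form is controlled by
`κ X + A min(X, c X^(1-λ) Y^λ)`, where `X` and `Y` are the products of the `L¹` and of the `L²`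
norms, then it is bounded on `L^s × L^s` for the `s` strictly between the endpoints. The constant
depends on `s` and `λ` only. -/
lemma exists_bilinForm_le {s : ℝ≥0∞} {lam : ℝ} (hs1 : 1 < s) (hs2 : s < 2) (hlam0 : 0 ≤ lam)
    (hlam1 : lam ≤ 1) (hlam : 2 * (s.toReal - 1) < lam * s.toReal) :
    ∃ C : ℝ≥0∞, C ≠ ⊤ ∧ ∀ {α : Type} [MeasurableSpace α] (μ : Measure α) [IsProbabilityMeasure μ]
      (K : α × α → ℂ) (M : ℝ) (κ A c : ℝ≥0∞), Measurable K → (∀ z, ‖K z‖ ≤ M) → c ≠ 0 → c ≠ ⊤ →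
      (∀ f h : α → ℂ, Measurable f → Measurable h → (∃ m : ℝ, ∀ x, ‖f x‖ ≤ m) →
        (∃ m : ℝ, ∀ x, ‖h x‖ ≤ m) → ‖bilinForm μ K f h‖ₑ ≤
          κ * (eLpNorm f 1 μ * eLpNorm h 1 μ) + A * min (eLpNorm f 1 μ * eLpNorm h 1 μ)
            (c * ((eLpNorm f 1 μ * eLpNorm h 1 μ) ^ (1 - lam) *
              (eLpNorm f 2 μ * eLpNorm h 2 μ) ^ lam))) →
      ∀ f h : α → ℂ, Measurable f → Measurable h → eLpNorm f s μ ≠ ⊤ → eLpNorm h s μ ≠ ⊤ →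
        ‖bilinForm μ K f h‖ₑ ≤ (κ + C * A * c ^ (2 * (s.toReal - 1) / (lam * s.toReal))) *
          (eLpNorm f s μ * eLpNorm h s μ) := by
  have hst : s ≠ ⊤ := (hs2.trans (by simp)).ne
  have hs0 : s ≠ 0 := (zero_lt_one.trans hs1).ne'
  have hsr1 : 1 < s.toReal := by
    rw [← ENNReal.toReal_one]; exact (ENNReal.toReal_lt_toReal (by simp) hst).2 hs1
  have hsr2 : s.toReal < 2 := by
    rw [← ENNReal.toReal_ofNat 2]; exact (ENNReal.toReal_lt_toReal hst (by simp)).2 hs2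
  obtain ⟨C, hC, key⟩ := exists_bilinForm_le_of_le_one hsr1 hsr2 hlam0 hlam1 hlam
  refine ⟨C, hC, ?_⟩
  intro α _ μ _ K M κ A c hK hM hc0 hct hB f h hf hh hfs hhs
  have hzero : ∀ g : α → ℂ, Measurable g → eLpNorm g s μ = 0 → g =ᵐ[μ] 0 := fun g hg h0 =>
    (eLpNorm_eq_zero_iff hg.aestronglyMeasurable hs0).1 h0
  by_cases hf0 : eLpNorm f s μ = 0
  · have h0 : bilinForm μ K f h = 0 := by
      rw [bilinForm]
      refine integral_eq_zero_of_ae ?_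
      filter_upwards [Measure.quasiMeasurePreserving_fst.ae (hzero f hf hf0)] with z hz
      simp only [Pi.zero_apply] at hz ⊢
      simp [hz]
    rw [h0]; simp
  by_cases hh0 : eLpNorm h s μ = 0
  · have h0 : bilinForm μ K f h = 0 := by
      rw [bilinForm]
      refine integral_eq_zero_of_ae ?_
      filter_upwards [Measure.quasiMeasurePreserving_snd.ae (hzero h hh hh0)] with z hz
      simp only [Pi.zero_apply] at hz ⊢
      simp [hz]
    rw [h0]; simp
  set a := (eLpNorm f s μ).toReal with ha
  set b := (eLpNorm h s μ).toReal with hb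
  have ha0 : 0 < a := ENNReal.toReal_pos hf0 hfs
  have hb0 : 0 < b := ENNReal.toReal_pos hh0 hhs
  have hnorm : ∀ (g : α → ℂ) (c : ℝ), 0 < c → ENNReal.ofReal c = eLpNorm g s μ →
      eLpNorm (fun x => ((c⁻¹ : ℝ) : ℂ) * g x) s μ = 1 := by
    intro g c hc hg
    have h1 : (fun x => ((c⁻¹ : ℝ) : ℂ) * g x) = ((c⁻¹ : ℝ) : ℂ) • g := by
      ext x; simp
    rw [h1, eLpNorm_const_smul, ← hg, ← ofReal_norm, Complex.norm_real,
      Real.norm_of_nonneg (by positivity), ← ENNReal.ofReal_mul (by positivity),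
      inv_mul_cancel₀ hc.ne', ENNReal.ofReal_one]
  have hfn := hnorm f a ha0 (ENNReal.ofReal_toReal hfs)
  have hhn := hnorm h b hb0 (ENNReal.ofReal_toReal hhs)
  have hpow : ∀ g : α → ℂ, eLpNorm g s μ = 1 → ∫⁻ x, ‖g x‖ₑ ^ s.toReal ∂μ ≤ 1 := by
    intro g hg
    rw [eLpNorm_eq_lintegral_rpow_enorm_toReal hs0 hst] at hg
    have := congrArg (· ^ s.toReal) hg
    simp only [ENNReal.one_rpow, ← ENNReal.rpow_mul] at this
    rw [one_div, inv_mul_cancel₀ (by linarith), ENNReal.rpow_one] at this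
    exact this.le
  have hone : ∀ g : α → ℂ, Measurable g → eLpNorm g s μ = 1 → eLpNorm g 1 μ ≤ 1 :=
    fun g hg h1 => (eLpNorm_le_eLpNorm_of_exponent_le hs1.le hg.aestronglyMeasurable).trans h1.le
  have hfm : Measurable fun x => ((a⁻¹ : ℝ) : ℂ) * f x := hf.const_mul _
  have hhm : Measurable fun x => ((b⁻¹ : ℝ) : ℂ) * h x := hh.const_mul _
  have hres := key μ K M κ A c hK hM hc0 hct hB _ _ hfm hhm (hpow _ hfn) (hpow _ hhn)
    (hone _ hfm hfn) (hone _ hhm hhn)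
  have hscale : bilinForm μ K f h = ((a * b : ℝ) : ℂ) *
      bilinForm μ K (fun x => ((a⁻¹ : ℝ) : ℂ) * f x) (fun x => ((b⁻¹ : ℝ) : ℂ) * h x) := by
    rw [bilinForm, bilinForm, ← integral_const_mul]
    refine integral_congr_ae (Filter.Eventually.of_forall fun z => ?_)
    have ha' : (a : ℂ) ≠ 0 := by exact_mod_cast ha0.ne'
    have hb' : (b : ℂ) ≠ 0 := by exact_mod_cast hb0.ne'
    push_cast
    field_simp
  rw [hscale, enorm_mul, mul_comm]
  have hab : ‖((a * b : ℝ) : ℂ)‖ₑ = eLpNorm f s μ * eLpNorm h s μ := by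
    rw [← ofReal_norm, Complex.norm_real, Real.norm_of_nonneg (by positivity),
      ENNReal.ofReal_mul ha0.le, ENNReal.ofReal_toReal hfs, ENNReal.ofReal_toReal hhs]
  rw [hab]
  gcongr

end LevelSets

/-! ### Arcs and Fejér kernels -/

/-- Lebesgue measure on `[0, 1]`, as a measure on `ℝ`. -/
noncomputable abbrev timeMeasure : Measure ℝ := (volume : Measure ℝ).restrict (Set.Icc 0 1)

instance : IsProbabilityMeasure timeMeasure := ⟨by simp⟩

/-- The Fourier coefficient of `f` on `[0, 1]` at the frequency `n θ`. -/
noncomputable def timeCoeff (θ : ℝ) (f : ℝ → ℂ) (n : ℤ) : ℂ :=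
  ∫ x, echar (-(n * (θ * x))) * f x ∂timeMeasure

/-- Parseval's identity for the frequencies `n θ`, `n ∈ ℤ`: the function is extended by zero to the
period `[0, 1/θ]`. -/
lemma hasSum_sq_norm_timeCoeff {θ : ℝ} (hθ0 : 0 < θ) (hθ1 : θ ≤ 1) {f : ℝ → ℂ}
    (hf : MemLp f 2 timeMeasure) :
    HasSum (fun n => ‖timeCoeff θ f n‖ ^ 2) (θ⁻¹ * ∫ x, ‖f x‖ ^ 2 ∂timeMeasure) := by
  have hT : (0 : ℝ) < 1 / θ := by positivity
  have hT1 : 1 ≤ 1 / θ := by rw [le_div_iff₀ hθ0]; linarith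
  set g : ℝ → ℂ := (Set.Ioc (0 : ℝ) 1).indicator f with hg
  have hinter : Set.Ioc (0 : ℝ) 1 ∩ Set.Ioc 0 (1 / θ) = Set.Ioc 0 1 :=
    Set.inter_eq_left.2 (Set.Ioc_subset_Ioc_right hT1)
  have hμ : timeMeasure = volume.restrict (Set.Ioc 0 1) :=
    (restrict_Ioc_eq_restrict_Icc (μ := (volume : Measure ℝ))).symm
  have hint : ∀ (E : Type) [NormedAddCommGroup E] [NormedSpace ℝ E] (u : ℝ → E),
      ∫ x in (0 : ℝ)..(1 / θ), (Set.Ioc (0 : ℝ) 1).indicator u x = ∫ x, u x ∂timeMeasure := by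
    intro E _ _ u
    rw [intervalIntegral.integral_of_le hT.le, integral_indicator measurableSet_Ioc,
      Measure.restrict_restrict measurableSet_Ioc, hinter, hμ]
  have hgm : MemLp g 2 (volume.restrict (Set.Ioc 0 (1 / θ))) := by
    rw [hg, memLp_indicator_iff_restrict measurableSet_Ioc,
      Measure.restrict_restrict measurableSet_Ioc, hinter, ← hμ]
    exact hf
  have h1 := hasSum_sq_fourierCoeffOn hT hgm
  have h2 : ∀ n, ‖fourierCoeffOn hT g n‖ ^ 2 = θ ^ 2 * ‖timeCoeff θ f n‖ ^ 2 := by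
    intro n
    rw [fourierCoeffOn_eq_integral, norm_smul, mul_pow]
    congr 1
    · rw [sub_zero, one_div_one_div, Real.norm_of_nonneg hθ0.le]
    · rw [timeCoeff, ← hint]
      congr 3
      ext x
      by_cases hx : x ∈ Set.Ioc (0 : ℝ) 1
      · rw [hg, Set.indicator_of_mem hx, Set.indicator_of_mem hx, smul_eq_mul,
          fourier_coe_apply, echar]
        congr 2
        push_cast
        have : (θ : ℂ) ≠ 0 := by exact_mod_cast hθ0.ne'
        field_simp
        ring
      · rw [hg, Set.indicator_of_notMem hx, Set.indicator_of_notMem hx, smul_zero]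
  have h3 : ∫ x in (0 : ℝ)..(1 / θ), ‖g x‖ ^ 2 = ∫ x, ‖f x‖ ^ 2 ∂timeMeasure := by
    rw [← hint]
    congr 1
    ext x
    by_cases hx : x ∈ Set.Ioc (0 : ℝ) 1 <;> simp [hg, hx]
  simp only [h2] at h1
  rw [h3, sub_zero, smul_eq_mul, one_div, inv_inv] at h1
  have h4 := h1.mul_left ((θ ^ 2)⁻¹)
  convert! h4 using 1
  · ext n; field_simp
  · field_simp

lemma norm_timeCoeff_le (θ : ℝ) {f : ℝ → ℂ} (n : ℤ) :
    ‖timeCoeff θ f n‖ ≤ ∫ x, ‖f x‖ ∂timeMeasure := by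
  refine (norm_integral_le_integral_norm _).trans_eq ?_
  refine integral_congr_ae (Filter.Eventually.of_forall fun x => ?_)
  simp

/-- The union of the arcs around the fractions with denominator at most `V`, in the variable `θ t`.
Fractions need not be reduced here. -/
def arcSet (θ : ℝ) (N V : ℕ) : Set ℝ :=
  {t | ∃ (a : ℤ) (q : ℕ), 1 ≤ q ∧ q ≤ V ∧ (N : ℝ) ^ 2 * |q * (θ * t) - a| ≤ V}

lemma measurableSet_arcSet (θ : ℝ) (N V : ℕ) : MeasurableSet (arcSet θ N V) := by
  have : arcSet θ N V = ⋃ (a : ℤ) (q : ℕ),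
      {t : ℝ | 1 ≤ q ∧ q ≤ V ∧ (N : ℝ) ^ 2 * |q * (θ * t) - a| ≤ V} := by
    ext t; simp [arcSet]
  rw [this]
  refine MeasurableSet.iUnion fun a => MeasurableSet.iUnion fun q => ?_
  refine (MeasurableSet.const _).inter ((MeasurableSet.const _).inter ?_)
  have hc : Measurable fun t : ℝ => (N : ℝ) ^ 2 * |q * (θ * t) - a| :=
    (by fun_prop : Continuous fun t : ℝ => (N : ℝ) ^ 2 * |q * (θ * t) - a|).measurable
  exact measurableSet_le hc measurable_const

/-- The sum over all fractions with denominator `q` of unnormalised Fejér kernels of degree `M`. -/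
noncomputable def fejerSum (q M : ℕ) (x : ℝ) : ℝ :=
  ∑ a ∈ Finset.range q, ‖∑ m ∈ Finset.range M, echar (m * (x - a / q))‖ ^ 2

lemma fejerSum_nonneg (q M : ℕ) (x : ℝ) : 0 ≤ fejerSum q M x :=
  Finset.sum_nonneg fun _ _ => by positivity

lemma continuous_fejerSum (q M : ℕ) : Continuous (fejerSum q M) := by
  unfold fejerSum
  have := continuous_echar
  fun_prop

lemma sum_range_echar_div {q : ℕ} (hq : 1 ≤ q) (n : ℤ) :
    ∑ a ∈ Finset.range q, echar (-(n * (a / q))) = if (q : ℤ) ∣ n then (q : ℂ) else 0 := by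
  have hq0 : (q : ℝ) ≠ 0 := by positivity
  have hpow : ∀ a : ℕ, echar (-(n * (a / q))) = echar (-(n / q)) ^ a := by
    intro a
    induction a with
    | zero => simp
    | succ a ih =>
      rw [pow_succ, ← ih, ← echar_add]; congr 1; push_cast; ring
  simp only [hpow]
  split_ifs with h
  · obtain ⟨k, rfl⟩ := h
    have : -(((q : ℤ) * k : ℤ) / (q : ℝ)) = ((-k : ℤ) : ℝ) := by push_cast; field_simp
    rw [this, echar_int]; simp
  · have hne : echar (-(n / q)) ≠ 1 := by
      intro h1
      rw [echar, Complex.exp_eq_one_iff] at h1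
      obtain ⟨k, hk⟩ := h1
      apply h
      refine ⟨-k, ?_⟩
      have h2 : (2 * Real.pi * Complex.I : ℂ) ≠ 0 := Complex.two_pi_I_ne_zero
      have h3 : ((-(n / q) : ℝ) : ℂ) = k := by
        apply mul_right_cancel₀ h2
        rw [← hk]; ring
      have h4 : (-(n / q) : ℝ) = k := by exact_mod_cast h3
      have h5 : (n : ℝ) = q * (-k) := by rw [← h4]; field_simp
      exact_mod_cast h5
    rw [geom_sum_eq hne, ← hpow q]
    have : -(n * ((q : ℝ) / q)) = ((-n : ℤ) : ℝ) := by push_cast; field_simp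
    rw [this, echar_int]; simp

/-- Only the frequencies divisible by `q` survive the sum over the numerators. -/
lemma fejerSum_eq {q : ℕ} (hq : 1 ≤ q) (M : ℕ) (x : ℝ) :
    (fejerSum q M x : ℂ) = q * ∑ m ∈ Finset.range M, ∑ l ∈ Finset.range M,
      if (q : ℤ) ∣ (m - l : ℤ) then echar (((m - l : ℤ) : ℝ) * x) else 0 := by
  rw [fejerSum]
  push_cast
  have h1 : ∀ a : ℕ, (‖∑ m ∈ Finset.range M, echar (m * (x - a / q))‖ : ℂ) ^ 2 =
      ∑ m ∈ Finset.range M, ∑ l ∈ Finset.range M,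
        echar (((m - l : ℤ) : ℝ) * x) * echar (-(((m - l : ℤ) : ℝ) * (a / q))) := by
    intro a
    rw [← Complex.mul_conj', map_sum, Finset.sum_mul_sum]
    refine Finset.sum_congr rfl fun m _ => Finset.sum_congr rfl fun l _ => ?_
    rw [← echar_neg, ← echar_add, ← echar_add]
    congr 1; push_cast; ring
  simp only [h1]
  rw [Finset.sum_comm, Finset.mul_sum]
  refine Finset.sum_congr rfl fun m _ => ?_
  rw [Finset.sum_comm, Finset.mul_sum]
  refine Finset.sum_congr rfl fun l _ => ?_
  rw [← Finset.mul_sum, sum_range_echar_div hq]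
  split_ifs
  · rw [mul_comm]; push_cast; rfl
  · simp

/-- The degree of the Fejér kernels which majorise the arcs with denominator `q` in `arcSet`. -/
noncomputable def fejerDegree (N V q : ℕ) : ℕ := max 1 ⌊(q : ℝ) * N ^ 2 / (6 * V)⌋₊

lemma one_le_fejerDegree (N V q : ℕ) : 1 ≤ fejerDegree N V q := le_max_left _ _

lemma fejerDegree_le {N V q : ℕ} (hN : 1 ≤ N) (hqV : q ≤ V) : fejerDegree N V q ≤ N ^ 2 := by
  refine max_le (Nat.one_le_pow _ _ hN) ?_
  refine Nat.floor_le_of_le ?_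
  rcases Nat.eq_zero_or_pos V with rfl | hV
  · simp
  have hV' : (0 : ℝ) < V := by exact_mod_cast hV
  have hq' : (q : ℝ) ≤ V := by exact_mod_cast hqV
  push_cast
  rw [div_le_iff₀ (by positivity)]
  nlinarith [sq_nonneg (N : ℝ)]

lemma div_fejerDegree_le {N V q : ℕ} (hN : 1 ≤ N) (hV : 1 ≤ V) :
    (q : ℝ) / fejerDegree N V q ≤ 12 * V / N ^ 2 := by
  have hN' : (0 : ℝ) < N := by exact_mod_cast hN
  have hV' : (0 : ℝ) < V := by exact_mod_cast hV
  have hM : (1 : ℝ) ≤ fejerDegree N V q := by exact_mod_cast one_le_fejerDegree N V q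
  rw [div_le_div_iff₀ (by linarith) (by positivity)]
  have h1 : (q : ℝ) * N ^ 2 / (6 * V) ≤ 2 * fejerDegree N V q := by
    have h2 := Nat.lt_floor_add_one ((q : ℝ) * N ^ 2 / (6 * V))
    have h3 : (⌊(q : ℝ) * N ^ 2 / (6 * V)⌋₊ : ℝ) ≤ fejerDegree N V q := by
      exact Nat.cast_le.2 (le_max_right _ _)
    linarith
  rw [div_le_iff₀ (by positivity)] at h1
  linarith

lemma half_le_norm_sum_echar {M : ℕ} {x : ℝ} (hx : M * |x| ≤ 1 / 6) :
    (M : ℝ) / 2 ≤ ‖∑ m ∈ Finset.range M, echar (m * x)‖ := by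
  refine le_trans ?_ (Complex.re_le_norm _)
  rw [Complex.re_sum]
  calc (M : ℝ) / 2 = ∑ m ∈ Finset.range M, (1 / 2 : ℝ) := by simp; ring
    _ ≤ _ := by
      refine Finset.sum_le_sum fun m hm => ?_
      rw [Finset.mem_range] at hm
      rw [echar_re, ← Real.cos_abs, ← Real.cos_pi_div_three]
      have hm' : (m : ℝ) ≤ M := by exact_mod_cast hm.le
      have h1 : |2 * Real.pi * (m * x)| ≤ Real.pi / 3 := by
        rw [abs_mul, abs_of_pos (by positivity : 0 < 2 * Real.pi), abs_mul, Nat.abs_cast]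
        have : m * |x| ≤ 1 / 6 := le_trans (by gcongr) hx
        nlinarith [Real.pi_pos]
      refine Real.cos_le_cos_of_nonneg_of_le_pi (abs_nonneg _) ?_ h1
      linarith [Real.pi_pos]

/-- Fejér kernels majorise the indicator function of the arcs. -/
lemma indicator_arcSet_le {θ : ℝ} {N V : ℕ} (hN : 1 ≤ N) (hV : 1 ≤ V) (t : ℝ) :
    (arcSet θ N V).indicator (fun _ => (1 : ℝ)) t ≤
      ∑ q ∈ Finset.Icc 1 V, 4 / (fejerDegree N V q : ℝ) ^ 2 *
        fejerSum q (fejerDegree N V q) (θ * t) := by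
  have hnn : ∀ q ∈ Finset.Icc 1 V, 0 ≤ 4 / (fejerDegree N V q : ℝ) ^ 2 *
      fejerSum q (fejerDegree N V q) (θ * t) := fun q _ =>
    mul_nonneg (by positivity) (fejerSum_nonneg _ _ _)
  by_cases ht : t ∈ arcSet θ N V
  swap
  · rw [Set.indicator_of_notMem ht]; exact Finset.sum_nonneg hnn
  rw [Set.indicator_of_mem ht]
  obtain ⟨a, q, hq, hqV, hle⟩ := ht
  refine le_trans ?_ (Finset.single_le_sum hnn (Finset.mem_Icc.2 ⟨hq, hqV⟩))
  set M := fejerDegree N V q with hM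
  have hN' : (0 : ℝ) < N := by exact_mod_cast hN
  have hV' : (0 : ℝ) < V := by exact_mod_cast hV
  have hq' : (0 : ℝ) < q := by exact_mod_cast hq
  have hM1 : (1 : ℝ) ≤ M := by exact_mod_cast one_le_fejerDegree N V q
  have hqz : (q : ℤ) ≠ 0 := by exact_mod_cast (by omega : q ≠ 0)
  -- the numerator is reduced modulo `q`
  have hb0 := Int.emod_nonneg a hqz
  have hb1 := Int.emod_lt_of_pos a (by exact_mod_cast hq : (0 : ℤ) < q)
  set b := (a % q).toNat with hb
  have hbz : (b : ℤ) = a % q := Int.toNat_of_nonneg hb0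
  have hab : (a : ℝ) = b + q * (a / q : ℤ) := by
    have : a = b + q * (a / q) := by rw [hbz]; exact (Int.emod_add_mul_ediv a q).symm
    exact_mod_cast this
  have hper : ∀ m : ℕ, echar (m * (θ * t - b / q)) = echar (m * (θ * t - a / q)) := by
    intro m
    have : m * (θ * t - b / q) = m * (θ * t - a / q) + ((m * (a / q) : ℤ) : ℝ) := by
      rw [hab]; push_cast; field_simp; ring
    rw [this, echar_add, echar_int, mul_one]
  have hsum : (M : ℝ) / 2 ≤ ‖∑ m ∈ Finset.range M, echar (m * (θ * t - b / q))‖ := by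
    simp only [hper]
    rcases le_or_gt ⌊(q : ℝ) * N ^ 2 / (6 * V)⌋₊ 1 with h1 | h1
    · have : M = 1 := by rw [hM, fejerDegree]; exact max_eq_left h1
      rw [this]; simp; norm_num
    · have hMle : (M : ℝ) ≤ q * N ^ 2 / (6 * V) := by
        have : M = ⌊(q : ℝ) * N ^ 2 / (6 * V)⌋₊ := by
          rw [hM, fejerDegree]; exact max_eq_right h1.le
        rw [this]; exact Nat.floor_le (by positivity)
      refine half_le_norm_sum_echar ?_
      have e : |θ * t - a / q| = |q * (θ * t) - a| / q := by
        rw [eq_div_iff hq'.ne', ← abs_of_pos hq', ← abs_mul, abs_of_pos hq']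
        congr 1; field_simp
      rw [e]
      calc M * (|q * (θ * t) - a| / q) ≤ (q * N ^ 2 / (6 * V)) * (|q * (θ * t) - a| / q) := by
            gcongr
        _ = (N ^ 2 * |q * (θ * t) - a|) / (6 * V) := by field_simp
        _ ≤ V / (6 * V) := by gcongr
        _ = 1 / 6 := by field_simp
  have hF : ((M : ℝ) / 2) ^ 2 ≤ fejerSum q M (θ * t) := by
    refine le_trans (pow_le_pow_left₀ (by positivity) hsum 2) ?_
    refine Finset.single_le_sum (f := fun c : ℕ =>
      ‖∑ m ∈ Finset.range M, echar (m * (θ * t - c / q))‖ ^ 2) (fun _ _ => by positivity) ?_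
    rw [Finset.mem_range]; omega
  calc (1 : ℝ) = 4 / (M : ℝ) ^ 2 * ((M : ℝ) / 2) ^ 2 := by field_simp; norm_num
    _ ≤ _ := by gcongr

/-! ### The bilinear form of the arcs: Fourier coefficients -/

lemma integrable_of_bounded {f : ℝ → ℂ} (hf : Measurable f) (hb : ∃ m : ℝ, ∀ x, ‖f x‖ ≤ m) :
    Integrable f timeMeasure := by
  obtain ⟨m, hm⟩ := hb
  exact Integrable.of_bound hf.aestronglyMeasurable m (Filter.Eventually.of_forall hm)

/-- The bilinear form of a character factorises into Fourier coefficients. -/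
lemma integral_echar_mul {θ : ℝ} {f h : ℝ → ℂ} (n : ℤ) :
    ∫ z : ℝ × ℝ, echar (n * (θ * (z.2 - z.1))) * (f z.1 * h z.2) ∂(timeMeasure.prod timeMeasure) =
      timeCoeff θ f n * timeCoeff θ h (-n) := by
  rw [timeCoeff, timeCoeff, ← integral_prod_mul]
  refine integral_congr_ae (Filter.Eventually.of_forall fun z => ?_)
  have : n * (θ * (z.2 - z.1)) = -(n * (θ * z.1)) + -(((-n : ℤ) : ℝ) * (θ * z.2)) := by
    push_cast; ring
  simp only [this, echar_add]
  ring

lemma sum_range_sub_le {c : ℤ → ℝ} (hc : ∀ n, 0 ≤ c n) (q : ℤ) {M L : ℕ} (hML : M ≤ L) :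
    ∑ m ∈ Finset.range M, ∑ l ∈ Finset.range M, (if q ∣ (m - l : ℤ) then c (m - l) else 0) ≤
      M * ∑ n ∈ Finset.Icc (-(L : ℤ)) L, if q ∣ n then c n else 0 := by
  have h0 : ∀ n, 0 ≤ if q ∣ n then c n else 0 := fun n => by split_ifs <;> simp [hc]
  have h1 : ∀ m ∈ Finset.range M,
      ∑ l ∈ Finset.range M, (if q ∣ (m - l : ℤ) then c (m - l) else 0) ≤
        ∑ n ∈ Finset.Icc (-(L : ℤ)) L, if q ∣ n then c n else 0 := by
    intro m hm
    rw [← Finset.sum_image (s := Finset.range M) (g := fun l : ℕ => (m - l : ℤ))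
      (f := fun n : ℤ => if q ∣ n then c n else 0) (fun x _ y _ h => by
        have : (m - x : ℤ) = m - y := h
        omega)]
    refine Finset.sum_le_sum_of_subset_of_nonneg (fun n hn => ?_) (fun n _ _ => h0 n)
    obtain ⟨l, hl, rfl⟩ := Finset.mem_image.1 hn
    rw [Finset.mem_range] at hl hm
    rw [Finset.mem_Icc]
    omega
  refine (Finset.sum_le_sum h1).trans ?_
  simp

/-- The bilinear form of the arcs, bounded by Fourier coefficients weighted with the number of
divisors of the frequency. -/
lemma norm_bilinForm_arcSet_le_sum {θ : ℝ} {N V : ℕ} (hN : 1 ≤ N) (hV : 1 ≤ V)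
    {f h : ℝ → ℂ} (hf : Measurable f) (hh : Measurable h) (hfb : ∃ m : ℝ, ∀ x, ‖f x‖ ≤ m)
    (hhb : ∃ m : ℝ, ∀ x, ‖h x‖ ≤ m) :
    ‖bilinForm timeMeasure
        (fun z => (arcSet θ N V).indicator (fun _ => (1 : ℂ)) (z.2 - z.1)) f h‖ ≤
      ∑ q ∈ Finset.Icc 1 V, 48 * V / N ^ 2 *
        ∑ n ∈ Finset.Icc (-((N ^ 2 : ℕ) : ℤ)) ((N ^ 2 : ℕ) : ℤ),
        if (q : ℤ) ∣ n then ‖timeCoeff θ (fun x => (‖f x‖ : ℂ)) n‖ *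
          ‖timeCoeff θ (fun x => (‖h x‖ : ℂ)) (-n)‖ else 0 := by
  set f' : ℝ → ℂ := fun x => (‖f x‖ : ℂ) with hf'
  set h' : ℝ → ℂ := fun x => (‖h x‖ : ℂ) with hh'
  have hf'i : Integrable f' timeMeasure := (integrable_of_bounded hf hfb).norm.ofReal
  have hh'i : Integrable h' timeMeasure := (integrable_of_bounded hh hhb).norm.ofReal
  have hfni : Integrable (fun x => ‖f x‖) timeMeasure := (integrable_of_bounded hf hfb).norm
  have hhni : Integrable (fun x => ‖h x‖) timeMeasure := (integrable_of_bounded hh hhb).norm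
  set c : ℤ → ℝ := fun n => ‖timeCoeff θ f' n‖ * ‖timeCoeff θ h' (-n)‖ with hc
  have hcn : ∀ n, 0 ≤ c n := fun n => by positivity
  set μ2 := timeMeasure.prod timeMeasure with hμ2
  have hFbound : ∀ q M x, fejerSum q M x ≤ q * (M : ℝ) ^ 2 := by
    intro q M x
    calc fejerSum q M x ≤ ∑ a ∈ Finset.range q, (M : ℝ) ^ 2 := by
          refine Finset.sum_le_sum fun a _ => ?_
          refine pow_le_pow_left₀ (norm_nonneg _) ?_ 2
          refine (norm_sum_le _ _).trans ?_
          simp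
      _ = _ := by simp
  have hFint : ∀ q M, Integrable (fun z : ℝ × ℝ =>
      fejerSum q M (θ * (z.2 - z.1)) * (‖f z.1‖ * ‖h z.2‖)) μ2 := by
    intro q M
    refine (hfni.mul_prod hhni).bdd_mul (c := q * (M : ℝ) ^ 2) ?_ ?_
    · have := continuous_fejerSum q M
      exact (by fun_prop : Continuous fun z : ℝ × ℝ =>
        fejerSum q M (θ * (z.2 - z.1))).aestronglyMeasurable
    · refine Filter.Eventually.of_forall fun z => ?_
      rw [Real.norm_of_nonneg (fejerSum_nonneg _ _ _)]
      exact hFbound _ _ _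
  have hF : ∀ q, 1 ≤ q → ∀ M, ∫ z : ℝ × ℝ, fejerSum q M (θ * (z.2 - z.1)) *
      (‖f z.1‖ * ‖h z.2‖) ∂μ2 ≤ q * ∑ m ∈ Finset.range M, ∑ l ∈ Finset.range M,
        if (q : ℤ) ∣ (m - l : ℤ) then c (m - l) else 0 := by
    intro q hq M
    have hI : ∀ n : ℤ, Integrable (fun z : ℝ × ℝ =>
        echar (n * (θ * (z.2 - z.1))) * (f' z.1 * h' z.2)) μ2 := by
      intro n
      refine (hf'i.mul_prod hh'i).bdd_mul (c := 1) ?_ ?_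
      · have := continuous_echar
        exact (by fun_prop : Continuous fun z : ℝ × ℝ =>
          echar (n * (θ * (z.2 - z.1)))).aestronglyMeasurable
      · exact Filter.Eventually.of_forall fun z => by simp
    have e1 : ((∫ z : ℝ × ℝ, fejerSum q M (θ * (z.2 - z.1)) * (‖f z.1‖ * ‖h z.2‖) ∂μ2 : ℝ) : ℂ) =
        q * ∑ m ∈ Finset.range M, ∑ l ∈ Finset.range M,
          if (q : ℤ) ∣ (m - l : ℤ) then
            timeCoeff θ f' (m - l) * timeCoeff θ h' (-(m - l)) else 0 := by
      rw [← integral_complex_ofReal]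
      have e2 : ∀ z : ℝ × ℝ, ((fejerSum q M (θ * (z.2 - z.1)) * (‖f z.1‖ * ‖h z.2‖) : ℝ) : ℂ) =
          q * ∑ m ∈ Finset.range M, ∑ l ∈ Finset.range M,
            if (q : ℤ) ∣ (m - l : ℤ) then
              echar (((m - l : ℤ) : ℝ) * (θ * (z.2 - z.1))) * (f' z.1 * h' z.2) else 0 := by
        intro z
        rw [Complex.ofReal_mul, fejerSum_eq hq, mul_assoc, Finset.sum_mul]
        congr 1
        refine Finset.sum_congr rfl fun m _ => ?_
        rw [Finset.sum_mul]
        refine Finset.sum_congr rfl fun l _ => ?_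
        rw [ite_mul, zero_mul]
        simp [hf', hh']
      simp only [e2]
      rw [integral_const_mul, integral_finsetSum]
      · congr 1
        refine Finset.sum_congr rfl fun m _ => ?_
        rw [integral_finsetSum]
        · refine Finset.sum_congr rfl fun l _ => ?_
          split_ifs
          · exact integral_echar_mul _
          · simp
        · intro l _
          split_ifs
          · exact hI _
          · exact integrable_zero _ _ _
      · intro m _
        refine integrable_finsetSum _ fun l _ => ?_
        split_ifs
        · exact hI _
        · exact integrable_zero _ _ _
    refine (le_abs_self _).trans ?_
    rw [← Real.norm_eq_abs, ← Complex.norm_real, e1, norm_mul, Complex.norm_natCast]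
    gcongr
    refine (norm_sum_le _ _).trans (Finset.sum_le_sum fun m _ => ?_)
    refine (norm_sum_le _ _).trans (Finset.sum_le_sum fun l _ => ?_)
    split_ifs
    · rw [norm_mul]
    · simp
  have hstep : ‖bilinForm timeMeasure
        (fun z => (arcSet θ N V).indicator (fun _ => (1 : ℂ)) (z.2 - z.1)) f h‖ ≤
      ∫ z : ℝ × ℝ, ∑ q ∈ Finset.Icc 1 V, 4 / (fejerDegree N V q : ℝ) ^ 2 *
        (fejerSum q (fejerDegree N V q) (θ * (z.2 - z.1)) * (‖f z.1‖ * ‖h z.2‖)) ∂μ2 := by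
    rw [bilinForm]
    refine norm_integral_le_of_norm_le ?_ (Filter.Eventually.of_forall fun z => ?_)
    · exact integrable_finsetSum _ fun q _ => (hFint q _).const_mul _
    · have h1 := indicator_arcSet_le (θ := θ) hN hV (z.2 - z.1)
      have h2 : ‖(arcSet θ N V).indicator (fun _ => (1 : ℂ)) (z.2 - z.1)‖ =
          (arcSet θ N V).indicator (fun _ => (1 : ℝ)) (z.2 - z.1) := by
        by_cases ht : z.2 - z.1 ∈ arcSet θ N V <;> simp [ht]
      rw [norm_mul, h2, norm_mul]
      refine (mul_le_mul_of_nonneg_right h1 (by positivity)).trans_eq ?_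
      rw [Finset.sum_mul]
      exact Finset.sum_congr rfl fun q _ => by ring
  refine hstep.trans ?_
  rw [integral_finsetSum _ fun q _ => (hFint q _).const_mul _]
  refine Finset.sum_le_sum fun q hq => ?_
  rw [Finset.mem_Icc] at hq
  rw [integral_const_mul]
  set M := fejerDegree N V q with hM
  have hM0 : (0 : ℝ) < M := by exact_mod_cast one_le_fejerDegree N V q
  have h3 := (hF q hq.1 M).trans (mul_le_mul_of_nonneg_left
    (sum_range_sub_le hcn q (fejerDegree_le hN hq.2)) (Nat.cast_nonneg q))
  set T := ∑ n ∈ Finset.Icc (-((N ^ 2 : ℕ) : ℤ)) ((N ^ 2 : ℕ) : ℤ), if (q : ℤ) ∣ n then c n else 0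
    with hT
  have hT0 : 0 ≤ T := Finset.sum_nonneg fun n _ => by split_ifs <;> simp [hcn]
  calc _ ≤ 4 / (M : ℝ) ^ 2 * (q * (M * T)) := by gcongr
    _ = 4 * (q / M) * T := by field_simp
    _ ≤ 4 * (12 * V / N ^ 2) * T :=
      mul_le_mul_of_nonneg_right (mul_le_mul_of_nonneg_left (div_fejerDegree_le hN hV)
        (by norm_num)) hT0
    _ = 48 * V / N ^ 2 * T := by ring

/-- Separation of the zero frequency, where the number of divisors is `V`. -/
lemma sum_dvd_eq_divisorCount (V L : ℕ) {c : ℤ → ℝ} :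
    ∑ q ∈ Finset.Icc 1 V, ∑ n ∈ Finset.Icc (-(L : ℤ)) L, (if (q : ℤ) ∣ n then c n else 0) =
      V * c 0 + ∑ n ∈ Finset.Icc 1 L, (divisorCountUpTo V n : ℝ) * (c n + c (-n)) := by
  have hset : Finset.Icc (-(L : ℤ)) L = insert 0 ((Finset.Icc 1 L).image (fun n : ℕ => (n : ℤ)) ∪
      (Finset.Icc 1 L).image (fun n : ℕ => -(n : ℤ))) := by
    ext m
    simp only [Finset.mem_Icc, Finset.mem_insert, Finset.mem_union, Finset.mem_image]
    constructor
    · intro hm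
      rcases lt_trichotomy m 0 with h | h | h
      · exact Or.inr (Or.inr ⟨m.natAbs, by omega, by omega⟩)
      · exact Or.inl h
      · exact Or.inr (Or.inl ⟨m.natAbs, by omega, by omega⟩)
    · rintro (h | ⟨n, hn, rfl⟩ | ⟨n, hn, rfl⟩) <;> omega
  have hdis : Disjoint ((Finset.Icc 1 L).image (fun n : ℕ => (n : ℤ)))
      ((Finset.Icc 1 L).image (fun n : ℕ => -(n : ℤ))) := by
    rw [Finset.disjoint_left]
    intro m h1 h2
    simp only [Finset.mem_image, Finset.mem_Icc] at h1 h2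
    obtain ⟨a, ha, rfl⟩ := h1
    obtain ⟨b, hb, hab⟩ := h2
    omega
  have hone : ∀ q : ℕ, ∑ n ∈ Finset.Icc (-(L : ℤ)) L, (if (q : ℤ) ∣ n then c n else 0) =
      c 0 + ∑ n ∈ Finset.Icc 1 L, if q ∣ n then c n + c (-n) else 0 := by
    intro q
    rw [hset, Finset.sum_insert, Finset.sum_union hdis,
      Finset.sum_image (fun x _ y _ h => by exact_mod_cast h),
      Finset.sum_image (fun x _ y _ h => by simpa using h), ← Finset.sum_add_distrib]
    · simp only [dvd_zero, if_true, dvd_neg, Int.natCast_dvd_natCast]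
      congr 1
      refine Finset.sum_congr rfl fun n _ => ?_
      split_ifs <;> simp
    · simp only [Finset.mem_union, Finset.mem_image, Finset.mem_Icc, not_or, not_exists, not_and]
      constructor <;> intro n hn <;> omega
  simp only [hone]
  rw [Finset.sum_add_distrib, Finset.sum_const, Nat.card_Icc, Nat.add_sub_cancel, nsmul_eq_mul,
    Finset.sum_comm]
  congr 1
  refine Finset.sum_congr rfl fun n _ => ?_
  rw [← Finset.sum_filter, Finset.sum_const, nsmul_eq_mul, divisorCountUpTo]

/-! ### The bilinear form of the arcs: `L¹` and `L²` norms -/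

lemma sum_sq_norm_timeCoeff_le {θ : ℝ} (hθ0 : 0 < θ) (hθ1 : θ ≤ 1) {f : ℝ → ℂ}
    (hf : MemLp f 2 timeMeasure) {g : ℕ → ℤ} (hg : Function.Injective g) (S : Finset ℕ) :
    ∑ n ∈ S, ‖timeCoeff θ f (g n)‖ ^ 2 ≤ θ⁻¹ * ∫ x, ‖f x‖ ^ 2 ∂timeMeasure := by
  rw [← Finset.sum_image (s := S) (g := g) (f := fun n => ‖timeCoeff θ f n‖ ^ 2)
    (fun x _ y _ h => hg h)]
  exact sum_le_hasSum _ (fun _ _ => by positivity) (hasSum_sq_norm_timeCoeff hθ0 hθ1 hf)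

/-- Bessel's inequality and Cauchy-Schwarz for the products of the coefficients of two functions, at
distinct frequencies. -/
lemma sum_norm_timeCoeff_mul_le {θ : ℝ} (hθ0 : 0 < θ) (hθ1 : θ ≤ 1) {f h : ℝ → ℂ}
    (hf : MemLp f 2 timeMeasure) (hh : MemLp h 2 timeMeasure) {g g' : ℕ → ℤ}
    (hg : Function.Injective g) (hg' : Function.Injective g') (S : Finset ℕ) :
    ∑ n ∈ S, ‖timeCoeff θ f (g n)‖ * ‖timeCoeff θ h (g' n)‖ ≤
      θ⁻¹ * (Real.sqrt (∫ x, ‖f x‖ ^ 2 ∂timeMeasure) *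
        Real.sqrt (∫ x, ‖h x‖ ^ 2 ∂timeMeasure)) := by
  refine (Real.sum_mul_le_sqrt_mul_sqrt _ _ _).trans ?_
  have hs : θ⁻¹ = Real.sqrt θ⁻¹ * Real.sqrt θ⁻¹ := (Real.mul_self_sqrt (by positivity)).symm
  calc _ ≤ Real.sqrt (θ⁻¹ * ∫ x, ‖f x‖ ^ 2 ∂timeMeasure) *
        Real.sqrt (θ⁻¹ * ∫ x, ‖h x‖ ^ 2 ∂timeMeasure) := by
        gcongr
        · exact sum_sq_norm_timeCoeff_le hθ0 hθ1 hf hg S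
        · exact sum_sq_norm_timeCoeff_le hθ0 hθ1 hh hg' S
    _ = _ := by
        rw [Real.sqrt_mul (by positivity), Real.sqrt_mul (by positivity)]
        nth_rewrite 3 [hs]
        ring

/-- The bilinear form of the arcs, in terms of `L¹` and `L²` norms. Apart from the contribution of
the zero frequency it has the size which the number `V` of denominators, rather than the number
`V²` of arcs, suggests. The loss `V^ε` comes from the moments of the divisor function, and the
exponent `λ = 1 - 1/B` from Hölder's inequality. -/
lemma exists_norm_bilinForm_arcSet_le {θmin : ℝ} (hθmin : 0 < θmin) {B : ℕ} (hB : 2 ≤ B)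
    {ε : ℝ} (hε : 0 < ε) :
    ∃ C : ℝ, 1 ≤ C ∧ ∀ (θ : ℝ) (N V : ℕ), θmin ≤ θ → θ ≤ 1 → 1 ≤ N → 1 ≤ V →
      ∀ f h : ℝ → ℂ, Measurable f → Measurable h → (∃ m : ℝ, ∀ x, ‖f x‖ ≤ m) →
      (∃ m : ℝ, ∀ x, ‖h x‖ ≤ m) →
      ‖bilinForm timeMeasure
          (fun z => (arcSet θ N V).indicator (fun _ => (1 : ℂ)) (z.2 - z.1)) f h‖ ≤
        48 * (V : ℝ) ^ 2 / (N : ℝ) ^ 2 * ((∫ x, ‖f x‖ ∂timeMeasure) * ∫ x, ‖h x‖ ∂timeMeasure) +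
        C * (V : ℝ) ^ (1 + ε) * (N : ℝ) ^ (-(2 * (1 - 1 / (B : ℝ)))) *
          (((∫ x, ‖f x‖ ∂timeMeasure) * ∫ x, ‖h x‖ ∂timeMeasure) ^ (1 - (1 - 1 / (B : ℝ))) *
            (Real.sqrt (∫ x, ‖f x‖ ^ 2 ∂timeMeasure) *
              Real.sqrt (∫ x, ‖h x‖ ^ 2 ∂timeMeasure)) ^ (1 - 1 / (B : ℝ))) := by
  obtain ⟨C₀, hC₀, hlog⟩ := exists_one_add_log_pow_le (2 ^ B) hε
  have hθm1 : 0 ≤ θmin⁻¹ := by positivity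
  refine ⟨48 * C₀ * (2 * (1 + θmin⁻¹)), by nlinarith, ?_⟩
  intro θ N V hθ hθ1 hN hV f h hf hh hfb hhb
  have hθ0 : 0 < θ := hθmin.trans_le hθ
  have hN0 : (0 : ℝ) < N := by exact_mod_cast hN
  have hV0 : (0 : ℝ) < V := by exact_mod_cast hV
  have hV1 : (1 : ℝ) ≤ V := by exact_mod_cast hV
  have hB0 : (0 : ℝ) < B := by positivity
  have hB2 : (2 : ℝ) ≤ B := by exact_mod_cast hB
  have hB1 : 1 / (B : ℝ) ≤ 1 / 2 := one_div_le_one_div_of_le two_pos hB2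
  set lam : ℝ := 1 - 1 / (B : ℝ) with hlam
  have hlam0 : 0 < lam := by linarith
  have hlam1 : lam ≤ 1 := by have : 0 < 1 / (B : ℝ) := by positivity
                             linarith
  refine (norm_bilinForm_arcSet_le_sum hN hV hf hh hfb hhb).trans ?_
  set f' : ℝ → ℂ := fun x => (‖f x‖ : ℂ) with hf'
  set h' : ℝ → ℂ := fun x => (‖h x‖ : ℂ) with hh'
  have hmem : ∀ g : ℝ → ℂ, Measurable g → (∃ m : ℝ, ∀ x, ‖g x‖ ≤ m) →
      MemLp (fun x => (‖g x‖ : ℂ)) 2 timeMeasure := by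
    rintro g hg ⟨m, hm⟩
    refine MemLp.of_bound (Complex.measurable_ofReal.comp hg.norm).aestronglyMeasurable m
      (Filter.Eventually.of_forall fun x => ?_)
    simpa using hm x
  have hf2 := hmem f hf hfb
  have hh2 := hmem h hh hhb
  have hnf : ∀ x, ‖f' x‖ = ‖f x‖ := fun x => by simp [hf']
  have hnh : ∀ x, ‖h' x‖ = ‖h x‖ := fun x => by simp [hh']
  set X := (∫ x, ‖f x‖ ∂timeMeasure) * ∫ x, ‖h x‖ ∂timeMeasure with hX
  set Y := Real.sqrt (∫ x, ‖f x‖ ^ 2 ∂timeMeasure) *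
              Real.sqrt (∫ x, ‖h x‖ ^ 2 ∂timeMeasure) with hY
  have hX0 : 0 ≤ X := mul_nonneg (integral_nonneg fun _ => norm_nonneg _)
    (integral_nonneg fun _ => norm_nonneg _)
  have hY0 : 0 ≤ Y := by positivity
  set c : ℤ → ℝ := fun n => ‖timeCoeff θ f' n‖ * ‖timeCoeff θ h' (-n)‖ with hc
  have hc0 : ∀ n, 0 ≤ c n := fun n => by positivity
  have hcX : ∀ n, c n ≤ X := by
    intro n
    have h1 := norm_timeCoeff_le θ (f := f') n
    have h2 := norm_timeCoeff_le θ (f := h') (-n)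
    simp only [hnf] at h1
    simp only [hnh] at h2
    exact mul_le_mul h1 h2 (norm_nonneg _) (integral_nonneg fun _ => norm_nonneg _)
  set L := N ^ 2 with hL
  have hcast : Function.Injective (fun n : ℕ => (n : ℤ)) := Nat.cast_injective
  have hcastn : Function.Injective (fun n : ℕ => -(n : ℤ)) := fun a b hab => by simpa using hab
  have hcY : ∑ n ∈ Finset.Icc 1 L, (c n + c (-n)) ≤ 2 * (θmin⁻¹ * Y) := by
    have hinv : θ⁻¹ ≤ θmin⁻¹ := inv_anti₀ hθmin hθ
    rw [Finset.sum_add_distrib, two_mul]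
    have h1 := sum_norm_timeCoeff_mul_le hθ0 hθ1 hf2 hh2 hcast hcastn (Finset.Icc 1 L)
    have h2 := sum_norm_timeCoeff_mul_le hθ0 hθ1 hf2 hh2 hcastn hcast (Finset.Icc 1 L)
    simp only [Complex.norm_real, norm_norm] at h1 h2
    have h3 : θ⁻¹ * Y ≤ θmin⁻¹ * Y := by gcongr
    refine add_le_add (h1.trans h3) ?_
    simp only [hc, neg_neg]
    exact h2.trans h3
  rw [← Finset.mul_sum, sum_dvd_eq_divisorCount]
  set d : ℕ → ℝ := fun n => (divisorCountUpTo V n : ℝ) with hd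
  set c₂ : ℕ → ℝ := fun n => c n + c (-n) with hc₂
  have hc₂0 : ∀ n, 0 ≤ c₂ n := fun n => add_nonneg (hc0 _) (hc0 _)
  have hc₂X : ∀ n, c₂ n ≤ 2 * X := fun n => by
    have := hcX n; have := hcX (-n); simp only [hc₂]; linarith
  have hHolder : Real.HolderConjugate (B : ℝ) (1 / lam) := by
    rw [Real.holderConjugate_iff]
    refine ⟨by linarith, ?_⟩
    rw [one_div, inv_inv, hlam, one_div]; ring
  have hmom : (∑ n ∈ Finset.Icc 1 L, |d n| ^ (B : ℝ)) ^ (1 / (B : ℝ)) ≤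
      (N : ℝ) ^ (2 * (1 / (B : ℝ))) * (C₀ * (V : ℝ) ^ ε) := by
    have h1 : ∑ n ∈ Finset.Icc 1 L, |d n| ^ (B : ℝ) ≤ (L : ℝ) * (C₀ * (V : ℝ) ^ ε) := by
      calc _ = ∑ n ∈ Finset.Icc 1 L, d n ^ B := by
            refine Finset.sum_congr rfl fun n _ => ?_
            rw [Real.rpow_natCast, abs_of_nonneg (Nat.cast_nonneg _)]
        _ ≤ L * (1 + Real.log V) ^ 2 ^ B := sum_divisorCountUpTo_pow_le V B L
        _ ≤ _ := by gcongr; exact hlog V hV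
    have h2 : 1 ≤ C₀ * (V : ℝ) ^ ε := by
      have := Real.one_le_rpow hV1 hε.le
      nlinarith
    calc _ ≤ ((L : ℝ) * (C₀ * (V : ℝ) ^ ε)) ^ (1 / (B : ℝ)) := by
          refine Real.rpow_le_rpow ?_ h1 (by positivity)
          exact Finset.sum_nonneg fun n _ => by positivity
      _ = (L : ℝ) ^ (1 / (B : ℝ)) * (C₀ * (V : ℝ) ^ ε) ^ (1 / (B : ℝ)) := by
          rw [Real.mul_rpow (by positivity) (by positivity)]
      _ ≤ (N : ℝ) ^ (2 * (1 / (B : ℝ))) * (C₀ * (V : ℝ) ^ ε) := by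
          gcongr
          · rw [hL, Nat.cast_pow, ← Real.rpow_natCast, ← Real.rpow_mul hN0.le]
            norm_num
          · calc _ ≤ (C₀ * (V : ℝ) ^ ε) ^ (1 : ℝ) :=
                  Real.rpow_le_rpow_of_exponent_le h2 (by linarith)
              _ = _ := Real.rpow_one _
  -- the `1 / λ` powers are bounded by the sup norm, estimated by `L¹`, and Parseval's identity
  have hcsum : (∑ n ∈ Finset.Icc 1 L, |c₂ n| ^ (1 / lam)) ^ (1 / (1 / lam)) ≤
      2 * (1 + θmin⁻¹) * (X ^ (1 - lam) * Y ^ lam) := by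
    have hexp : 0 ≤ 1 / lam - 1 := by
      rw [sub_nonneg, le_div_iff₀ hlam0]; linarith
    have h1 : ∑ n ∈ Finset.Icc 1 L, |c₂ n| ^ (1 / lam) ≤
        (2 * X) ^ (1 / lam - 1) * (2 * (θmin⁻¹ * Y)) := by
      calc _ ≤ ∑ n ∈ Finset.Icc 1 L, (2 * X) ^ (1 / lam - 1) * c₂ n := by
            refine Finset.sum_le_sum fun n _ => ?_
            rw [abs_of_nonneg (hc₂0 n)]
            have : c₂ n ^ (1 / lam) = c₂ n ^ (1 / lam - 1) * c₂ n := by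
              rcases (hc₂0 n).eq_or_lt with h0 | h0
              · rw [← h0, Real.zero_rpow (by positivity), mul_zero]
              · nth_rewrite 3 [← Real.rpow_one (c₂ n)]
                rw [← Real.rpow_add h0]; congr 1; ring
            rw [this]
            exact mul_le_mul_of_nonneg_right (Real.rpow_le_rpow (hc₂0 n) (hc₂X n) hexp) (hc₂0 n)
        _ = (2 * X) ^ (1 / lam - 1) * ∑ n ∈ Finset.Icc 1 L, c₂ n := by rw [Finset.mul_sum]
        _ ≤ _ := by gcongr
    rw [one_div_one_div]
    calc _ ≤ ((2 * X) ^ (1 / lam - 1) * (2 * (θmin⁻¹ * Y))) ^ lam := by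
          refine Real.rpow_le_rpow ?_ h1 hlam0.le
          exact Finset.sum_nonneg fun n _ => by positivity
      _ = (2 * X) ^ (1 - lam) * (2 * (θmin⁻¹ * Y)) ^ lam := by
          rw [Real.mul_rpow (by positivity) (by positivity), ← Real.rpow_mul (by positivity)]
          congr 2
          field_simp
      _ = (2 ^ (1 - lam) * 2 ^ lam) * (θmin⁻¹ ^ lam) * (X ^ (1 - lam) * Y ^ lam) := by
          rw [Real.mul_rpow two_pos.le hX0, Real.mul_rpow two_pos.le (mul_nonneg hθm1 hY0),
            Real.mul_rpow hθm1 hY0]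
          ring
      _ ≤ 2 * (1 + θmin⁻¹) * (X ^ (1 - lam) * Y ^ lam) := by
          gcongr
          · rw [← Real.rpow_add two_pos]; simp
          · calc θmin⁻¹ ^ lam ≤ (1 + θmin⁻¹) ^ lam := by gcongr; linarith
              _ ≤ (1 + θmin⁻¹) ^ (1 : ℝ) :=
                Real.rpow_le_rpow_of_exponent_le (by linarith) hlam1
              _ = _ := Real.rpow_one _
  -- Hölder with exponents `B` and `1 / λ`, for the divisor function and the Fourier coefficients
  have hH := (Real.inner_le_Lp_mul_Lq (Finset.Icc 1 L) d c₂ hHolder).trans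
    (mul_le_mul hmom hcsum (by positivity) (by positivity))
  have hXY0 : 0 ≤ X ^ (1 - lam) * Y ^ lam := by positivity
  calc 48 * V / (N : ℝ) ^ 2 * (V * c 0 + ∑ n ∈ Finset.Icc 1 L, d n * c₂ n)
      ≤ 48 * V / (N : ℝ) ^ 2 * (V * X + (N : ℝ) ^ (2 * (1 / (B : ℝ))) * (C₀ * (V : ℝ) ^ ε) *
          (2 * (1 + θmin⁻¹) * (X ^ (1 - lam) * Y ^ lam))) := by
        gcongr
        exact hcX 0
    _ = 48 * (V : ℝ) ^ 2 / (N : ℝ) ^ 2 * X + 48 * C₀ * (2 * (1 + θmin⁻¹)) * (V * (V : ℝ) ^ ε) *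
          ((N : ℝ) ^ (2 * (1 / (B : ℝ))) / (N : ℝ) ^ 2) * (X ^ (1 - lam) * Y ^ lam) := by ring
    _ = _ := by
        rw [Real.rpow_add hV0, Real.rpow_one]
        have : (N : ℝ) ^ (2 * (1 / (B : ℝ))) / (N : ℝ) ^ 2 = (N : ℝ) ^ (-(2 * lam)) := by
          rw [← Real.rpow_natCast (N : ℝ) 2, ← Real.rpow_sub hN0]
          congr 1
          rw [hlam]; push_cast; ring
        rw [this]

/-! ### The bilinear form of the arcs on `L^{p'}` -/

section Norms

variable {α : Type*} [MeasurableSpace α] {μ : Measure α}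

lemma eLpNorm_one_eq_ofReal {f : α → ℂ} (hf : Integrable f μ) :
    eLpNorm f 1 μ = ENNReal.ofReal (∫ x, ‖f x‖ ∂μ) := by
  rw [eLpNorm_one_eq_lintegral_enorm, ofReal_integral_norm_eq_lintegral_enorm hf]

lemma eLpNorm_two_eq_ofReal {f : α → ℂ} (hf : MemLp f 2 μ) :
    eLpNorm f 2 μ = ENNReal.ofReal (Real.sqrt (∫ x, ‖f x‖ ^ 2 ∂μ)) := by
  rw [hf.eLpNorm_eq_integral_rpow_norm two_ne_zero ENNReal.ofNat_ne_top, Real.sqrt_eq_rpow]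
  simp

lemma enorm_bilinForm_le [SFinite μ] {K : α × α → ℂ} {M : ℝ} (hM : ∀ z, ‖K z‖ ≤ M)
    {f h : α → ℂ} (hf : Measurable f) (hh : Measurable h) :
    ‖bilinForm μ K f h‖ₑ ≤ ENNReal.ofReal M * (eLpNorm f 1 μ * eLpNorm h 1 μ) := by
  rw [eLpNorm_one_eq_lintegral_enorm, eLpNorm_one_eq_lintegral_enorm,
    ← lintegral_prod_mul hf.enorm.aemeasurable hh.enorm.aemeasurable,
    ← lintegral_const_mul _ (by fun_prop)]
  refine (enorm_integral_le_lintegral_enorm _).trans (lintegral_mono fun z => ?_)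
  rw [enorm_mul, enorm_mul]
  gcongr
  rw [← ofReal_norm]
  exact ENNReal.ofReal_le_ofReal (hM z)

end Norms

/-- The Hölder exponent `B` in `exists_norm_bilinForm_arcSet_le` can be chosen such that
interpolation with `λ = 1 - 1/B` reaches `1/p = η` and the power `V^(1 + 1/B)` becomes at most
`V^(2η + δ)`. -/
lemma exists_exponents {η δ : ℝ} (hη : η < 1 / 2) (hδ : 0 < δ) :
    ∃ B : ℕ, 2 ≤ B ∧ 2 * η < 1 - 1 / (B : ℝ) ∧
      (1 + 1 / (B : ℝ)) * (2 * η / (1 - 1 / (B : ℝ))) ≤ 2 * η + δ := by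
  have hlim : Filter.Tendsto (fun B : ℕ => 1 / (B : ℝ)) Filter.atTop (nhds 0) :=
    tendsto_one_div_atTop_nhds_zero_nat
  have h1 : ∀ᶠ B : ℕ in Filter.atTop, 2 * η < 1 - 1 / (B : ℝ) := by
    have : Filter.Tendsto (fun B : ℕ => 1 - 1 / (B : ℝ)) Filter.atTop (nhds (1 - 0)) :=
      tendsto_const_nhds.sub hlim
    exact this.eventually_const_lt (by linarith)
  have h2 : ∀ᶠ B : ℕ in Filter.atTop,
      (1 + 1 / (B : ℝ)) * (2 * η / (1 - 1 / (B : ℝ))) < 2 * η + δ := by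
    have : Filter.Tendsto (fun B : ℕ => (1 + 1 / (B : ℝ)) * (2 * η / (1 - 1 / (B : ℝ))))
        Filter.atTop (nhds ((1 + 0) * (2 * η / (1 - 0)))) :=
      (tendsto_const_nhds.add hlim).mul
        (tendsto_const_nhds.div (tendsto_const_nhds.sub hlim) (by norm_num))
    refine this.eventually_lt_const ?_
    simp
    linarith
  obtain ⟨B, hB1, hB2, hB3⟩ := (h1.and (h2.and (Filter.eventually_ge_atTop 2))).exists
  exact ⟨B, hB3, hB1, hB2.le⟩

/-- Convolution with the indicator function of the arcs, as a bilinear form on `L^{p'}`: up to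
`V^δ` and to the harmless contribution `V² / N²` of the mean, its norm is the measure `V / N²` of
the arcs of a single denominator, to the power `2/p`. -/
lemma exists_enorm_bilinForm_arcSet_le {p p' : ℝ≥0∞} (hp2 : 2 < p) (hpt : p ≠ ⊤)
    (hpp : p.HolderConjugate p') {θmin : ℝ} (hθmin : 0 < θmin) {δ : ℝ} (hδ : 0 < δ) :
    ∃ C : ℝ, 1 ≤ C ∧ ∀ (θ : ℝ) (N V : ℕ), θmin ≤ θ → θ ≤ 1 → 1 ≤ N → 1 ≤ V →
      ∀ f h : ℝ → ℂ, Measurable f → Measurable h → eLpNorm f p' timeMeasure ≠ ⊤ →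
      eLpNorm h p' timeMeasure ≠ ⊤ →
      ‖bilinForm timeMeasure
          (fun z => (arcSet θ N V).indicator (fun _ => (1 : ℂ)) (z.2 - z.1)) f h‖ₑ ≤
        ENNReal.ofReal (C * ((V : ℝ) ^ 2 / (N : ℝ) ^ 2 +
          (V : ℝ) ^ (2 * p⁻¹.toReal + δ) * (N : ℝ) ^ (-(4 * p⁻¹.toReal)))) *
        (eLpNorm f p' timeMeasure * eLpNorm h p' timeMeasure) := by
  set η := p⁻¹.toReal with hη
  have hp0 : p ≠ 0 := (zero_lt_two.trans hp2).ne'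
  have hpr : 2 < p.toReal := by
    rw [← ENNReal.toReal_ofNat 2]; exact (ENNReal.toReal_lt_toReal (by simp) hpt).2 hp2
  have hη' : η = p.toReal⁻¹ := ENNReal.toReal_inv p
  have hη0 : 0 < η := by rw [hη']; positivity
  have hη2 : η < 1 / 2 := by
    rw [hη', one_div]; exact inv_strictAnti₀ two_pos hpr
  -- the conjugate exponent lies in `(1, 2)`
  have hconj : p⁻¹ + p'⁻¹ = 1 := hpp.inv_add_inv_eq_one
  have hp'0 : p' ≠ 0 := by
    rintro rfl; simp at hconj
  have hsum : η + p'⁻¹.toReal = 1 := by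
    rw [hη, ← ENNReal.toReal_add (by simp [hp0]) (by simp [hp'0]), hconj, ENNReal.toReal_one]
  have hp't : p' ≠ ⊤ := by
    rintro rfl
    simp at hsum
    linarith
  set s := p'.toReal with hs
  have hs0 : 0 < s := ENNReal.toReal_pos hp'0 hp't
  have hsη : s⁻¹ = 1 - η := by rw [hs, ← ENNReal.toReal_inv]; linarith
  have hs1 : 1 < s := by
    have : s⁻¹ < 1 := by rw [hsη]; linarith
    exact (inv_lt_one₀ hs0).1 this
  have hs2 : s < 2 := by
    have : 2⁻¹ < s⁻¹ := by rw [hsη]; linarith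
    exact (inv_lt_inv₀ two_pos hs0).1 this
  have hp'1 : 1 < p' := by
    rw [← ENNReal.toReal_lt_toReal (by simp) hp't, ENNReal.toReal_one]; exact hs1
  have hp'2 : p' < 2 := by
    rw [← ENNReal.toReal_lt_toReal hp't (by simp), ENNReal.toReal_ofNat]; exact hs2
  have hsη' : (s - 1) / s = η := by
    rw [sub_div, div_self hs0.ne', one_div, hsη]; ring
  obtain ⟨B, hB, hB1, hB2⟩ := exists_exponents hη2 hδ
  have hB0 : (0 : ℝ) < B := by positivity
  set lam : ℝ := 1 - 1 / (B : ℝ) with hlam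
  have hlam0 : 0 < lam := by linarith
  have hlam1 : lam ≤ 1 := by
    have : 0 < 1 / (B : ℝ) := by positivity
    linarith
  have hcond : 2 * (s - 1) < lam * s := by
    have : s - 1 = η * s := by rw [← hsη']; field_simp
    rw [this]; nlinarith
  obtain ⟨C₁, hC₁, hform⟩ := exists_norm_bilinForm_arcSet_le hθmin hB (ε := 1 / B) (by positivity)
  obtain ⟨C₂, hC₂, hint⟩ := exists_bilinForm_le hp'1 hp'2 hlam0.le hlam1 hcond
  obtain ⟨c₂, hc₂, rfl⟩ : ∃ c₂ : ℝ, 0 ≤ c₂ ∧ C₂ = ENNReal.ofReal c₂ :=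
    ⟨C₂.toReal, ENNReal.toReal_nonneg, (ENNReal.ofReal_toReal hC₂).symm⟩
  have hexp : 2 * (s - 1) / (lam * s) = 2 * η / lam := by
    rw [← hsη']; field_simp
  have he0 : 0 ≤ 2 * η / lam := by positivity
  refine ⟨48 + c₂ * C₁ ^ (2 * η / lam), by
    have : 0 ≤ c₂ * C₁ ^ (2 * η / lam) := by positivity
    linarith, ?_⟩
  intro θ N V hθ hθ1 hN hV f h hf hh hfp hhp
  have hN0 : (0 : ℝ) < N := by exact_mod_cast hN
  have hV0 : (0 : ℝ) < V := by exact_mod_cast hV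
  have hV1 : (1 : ℝ) ≤ V := by exact_mod_cast hV
  set K : ℝ × ℝ → ℂ := fun z => (arcSet θ N V).indicator (fun _ => (1 : ℂ)) (z.2 - z.1) with hK
  have hKm : Measurable K := by
    have h1 : Measurable ((arcSet θ N V).indicator (fun _ => (1 : ℂ))) :=
      measurable_const.indicator (measurableSet_arcSet θ N V)
    exact h1.comp (measurable_snd.sub measurable_fst)
  have hK1 : ∀ z, ‖K z‖ ≤ 1 := fun z => by
    simp only [hK]
    by_cases hz : z.2 - z.1 ∈ arcSet θ N V <;> simp [hz]
  set cr : ℝ := C₁ * (V : ℝ) ^ (1 + 1 / (B : ℝ)) * (N : ℝ) ^ (-(2 * lam)) with hcr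
  have hcr0 : 0 < cr := by positivity
  set κr : ℝ := 48 * (V : ℝ) ^ 2 / (N : ℝ) ^ 2 with hκr
  have hκr0 : 0 ≤ κr := by positivity
  have hhyp : ∀ f h : ℝ → ℂ, Measurable f → Measurable h → (∃ m : ℝ, ∀ x, ‖f x‖ ≤ m) →
        (∃ m : ℝ, ∀ x, ‖h x‖ ≤ m) → ‖bilinForm timeMeasure K f h‖ₑ ≤
          ENNReal.ofReal κr * (eLpNorm f 1 timeMeasure * eLpNorm h 1 timeMeasure) +
          1 * min (eLpNorm f 1 timeMeasure * eLpNorm h 1 timeMeasure)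
            (ENNReal.ofReal cr * ((eLpNorm f 1 timeMeasure * eLpNorm h 1 timeMeasure) ^ (1 - lam) *
              (eLpNorm f 2 timeMeasure * eLpNorm h 2 timeMeasure) ^ lam)) := by
    intro f h hf hh hfb hhb
    have htriv := enorm_bilinForm_le (μ := timeMeasure) hK1 hf hh
    rw [ENNReal.ofReal_one, one_mul] at htriv
    have hmem : ∀ g : ℝ → ℂ, Measurable g → (∃ m : ℝ, ∀ x, ‖g x‖ ≤ m) → MemLp g 2 timeMeasure := by
      rintro g hg ⟨m, hm⟩
      exact MemLp.of_bound hg.aestronglyMeasurable m (Filter.Eventually.of_forall hm)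
    have hmain := hform θ N V hθ hθ1 hN hV f h hf hh hfb hhb
    rw [one_mul]
    rcases le_total (eLpNorm f 1 timeMeasure * eLpNorm h 1 timeMeasure)
      (ENNReal.ofReal cr * ((eLpNorm f 1 timeMeasure * eLpNorm h 1 timeMeasure) ^ (1 - lam) *
        (eLpNorm f 2 timeMeasure * eLpNorm h 2 timeMeasure) ^ lam)) with hle | hle
    · rw [min_eq_left hle]
      exact htriv.trans le_add_self
    · rw [min_eq_right hle, eLpNorm_one_eq_ofReal (integrable_of_bounded hf hfb),
        eLpNorm_one_eq_ofReal (integrable_of_bounded hh hhb),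
        eLpNorm_two_eq_ofReal (hmem f hf hfb), eLpNorm_two_eq_ofReal (hmem h hh hhb)]
      have hx : 0 ≤ ∫ x, ‖f x‖ ∂timeMeasure := integral_nonneg fun _ => norm_nonneg _
      have hy : 0 ≤ ∫ x, ‖h x‖ ∂timeMeasure := integral_nonneg fun _ => norm_nonneg _
      rw [← ENNReal.ofReal_mul hx, ← ENNReal.ofReal_mul (Real.sqrt_nonneg _),
        ENNReal.ofReal_rpow_of_nonneg (mul_nonneg hx hy) (by linarith),
        ENNReal.ofReal_rpow_of_nonneg (by positivity) hlam0.le,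
        ← ENNReal.ofReal_mul (Real.rpow_nonneg (mul_nonneg hx hy) _),
        ← ENNReal.ofReal_mul hcr0.le, ← ENNReal.ofReal_mul hκr0,
        ← ENNReal.ofReal_add (mul_nonneg hκr0 (mul_nonneg hx hy))
          (mul_nonneg hcr0.le (mul_nonneg (Real.rpow_nonneg (mul_nonneg hx hy) _)
            (by positivity))), ← ofReal_norm]
      exact ENNReal.ofReal_le_ofReal hmain
  have hres := hint timeMeasure K 1 (ENNReal.ofReal κr) 1 (ENNReal.ofReal cr) hKm hK1
    (by simpa using hcr0) ENNReal.ofReal_ne_top hhyp f h hf hh hfp hhp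
  refine hres.trans (mul_le_mul_left ?_ _)
  rw [hexp, mul_one, ENNReal.ofReal_rpow_of_pos hcr0,
    ← ENNReal.ofReal_mul hc₂, ← ENNReal.ofReal_add hκr0 (by positivity)]
  refine ENNReal.ofReal_le_ofReal ?_
  have hcpow : cr ^ (2 * η / lam) ≤
      C₁ ^ (2 * η / lam) * ((V : ℝ) ^ (2 * η + δ) * (N : ℝ) ^ (-(4 * η))) := by
    rw [hcr, Real.mul_rpow (by positivity) (by positivity),
      Real.mul_rpow (by positivity) (by positivity), ← Real.rpow_mul hV0.le,
      ← Real.rpow_mul hN0.le, mul_assoc]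
    have e : -(2 * lam) * (2 * η / lam) = -(4 * η) := by field_simp; ring
    rw [e]
    gcongr
  have hW : 0 ≤ (V : ℝ) ^ 2 / (N : ℝ) ^ 2 := by positivity
  have hZ : 0 ≤ (V : ℝ) ^ (2 * η + δ) * (N : ℝ) ^ (-(4 * η)) := by positivity
  have hCC : 0 ≤ c₂ * C₁ ^ (2 * η / lam) := by positivity
  calc κr + c₂ * cr ^ (2 * η / lam)
      ≤ 48 * ((V : ℝ) ^ 2 / (N : ℝ) ^ 2) + c₂ * (C₁ ^ (2 * η / lam) *
          ((V : ℝ) ^ (2 * η + δ) * (N : ℝ) ^ (-(4 * η)))) := by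
        gcongr
        rw [hκr, mul_div_assoc]
    _ ≤ _ := by nlinarith [mul_nonneg hCC hW, mul_nonneg hCC hZ]

/-! ### Duality and convolution in time -/

lemma lintegral_le_eLpNorm {q : ℝ≥0∞} (hq : 1 ≤ q) {f : ℝ → ℝ≥0∞} (hf : Measurable f) :
    ∫⁻ x, f x ∂timeMeasure ≤ eLpNorm f q timeMeasure := by
  have h := eLpNorm_le_eLpNorm_of_exponent_le (μ := timeMeasure) hq hf.aestronglyMeasurable
  rw [eLpNorm_one_eq_lintegral_enorm] at h
  simpa using h

/-- A bound for a bilinear form with nonnegative kernel passes from complex functions to functions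
with values in `[0, ∞]`. -/
lemma lintegral_le_of_enorm_bilinForm_le {q : ℝ≥0∞} (hq : 1 ≤ q) {E : Set ℝ} (hE : MeasurableSet E)
    {A : ℝ≥0∞}
    (hA : ∀ f h : ℝ → ℂ, Measurable f → Measurable h → eLpNorm f q timeMeasure ≠ ⊤ →
      eLpNorm h q timeMeasure ≠ ⊤ →
      ‖bilinForm timeMeasure (fun z => E.indicator (fun _ => (1 : ℂ)) (z.2 - z.1)) f h‖ₑ ≤
        A * (eLpNorm f q timeMeasure * eLpNorm h q timeMeasure))
    {f h : ℝ → ℝ≥0∞} (hf : Measurable f) (hh : Measurable h)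
    (hfq : eLpNorm f q timeMeasure ≠ ⊤) (hhq : eLpNorm h q timeMeasure ≠ ⊤) :
    ∫⁻ z, E.indicator (fun _ => (1 : ℝ≥0∞)) (z.2 - z.1) * (f z.1 * h z.2)
      ∂(timeMeasure.prod timeMeasure) ≤
        A * (eLpNorm f q timeMeasure * eLpNorm h q timeMeasure) := by
  have hfin : ∀ g : ℝ → ℝ≥0∞, Measurable g → eLpNorm g q timeMeasure ≠ ⊤ →
      ∀ᵐ x ∂timeMeasure, g x < ⊤ := fun g hg hgq =>
    ae_lt_top hg ((lintegral_le_eLpNorm hq hg).trans_lt hgq.lt_top).ne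
  have hen : ∀ g : ℝ → ℝ≥0∞, Measurable g → eLpNorm g q timeMeasure ≠ ⊤ →
      ∀ᵐ x ∂timeMeasure, ‖((g x).toReal : ℂ)‖ₑ = g x := by
    intro g hg hgq
    filter_upwards [hfin g hg hgq] with x hx
    rw [← ofReal_norm, Complex.norm_real, Real.norm_of_nonneg ENNReal.toReal_nonneg,
      ENNReal.ofReal_toReal hx.ne]
  have hnorm : ∀ g : ℝ → ℝ≥0∞, Measurable g → eLpNorm g q timeMeasure ≠ ⊤ →
      eLpNorm (fun x => ((g x).toReal : ℂ)) q timeMeasure = eLpNorm g q timeMeasure := by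
    intro g hg hgq
    refine eLpNorm_congr_enorm_ae ?_
    filter_upwards [hen g hg hgq] with x hx
    rw [hx, enorm_eq_self]
  have hmeas : ∀ g : ℝ → ℝ≥0∞, Measurable g → Measurable fun x => ((g x).toReal : ℂ) :=
    fun g hg => Complex.measurable_ofReal.comp hg.ennreal_toReal
  have hint : ∀ g : ℝ → ℝ≥0∞, Measurable g → eLpNorm g q timeMeasure ≠ ⊤ →
      Integrable (fun x => (g x).toReal) timeMeasure := fun g hg hgq =>
    integrable_toReal_of_lintegral_ne_top hg.aemeasurable
      ((lintegral_le_eLpNorm hq hg).trans_lt hgq.lt_top).ne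
  have key := hA _ _ (hmeas f hf) (hmeas h hh) (by rwa [hnorm f hf hfq])
    (by rwa [hnorm h hh hhq])
  rw [hnorm f hf hfq, hnorm h hh hhq] at key
  refine le_trans (le_of_eq ?_) key
  set G : ℝ × ℝ → ℝ := fun z => E.indicator (fun _ => (1 : ℝ)) (z.2 - z.1) *
    ((f z.1).toReal * (h z.2).toReal) with hG
  have hG0 : ∀ z, 0 ≤ G z := fun z =>
    mul_nonneg (Set.indicator_nonneg (fun _ _ => zero_le_one) _)
      (mul_nonneg ENNReal.toReal_nonneg ENNReal.toReal_nonneg)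
  have hGi : Integrable G (timeMeasure.prod timeMeasure) := by
    refine ((hint f hf hfq).mul_prod (hint h hh hhq)).bdd_mul (c := 1) ?_ ?_
    · have h1 : Measurable (E.indicator (fun _ => (1 : ℝ))) := measurable_const.indicator hE
      exact (h1.comp (measurable_snd.sub measurable_fst)).aestronglyMeasurable
    · refine Filter.Eventually.of_forall fun z => ?_
      by_cases hz : z.2 - z.1 ∈ E <;> simp [hz]
  have e1 : bilinForm timeMeasure (fun z => E.indicator (fun _ => (1 : ℂ)) (z.2 - z.1))
      (fun x => ((f x).toReal : ℂ)) (fun x => ((h x).toReal : ℂ)) =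
      ((∫ z, G z ∂(timeMeasure.prod timeMeasure) : ℝ) : ℂ) := by
    rw [bilinForm, ← integral_complex_ofReal]
    refine integral_congr_ae (Filter.Eventually.of_forall fun z => ?_)
    by_cases hz : z.2 - z.1 ∈ E <;> simp [hz, hG]
  rw [e1, ← ofReal_norm, Complex.norm_real, Real.norm_of_nonneg (integral_nonneg hG0),
    ofReal_integral_eq_lintegral_ofReal hGi (Filter.Eventually.of_forall hG0)]
  refine lintegral_congr_ae ?_
  filter_upwards [Measure.quasiMeasurePreserving_fst.ae (hfin f hf hfq),
    Measure.quasiMeasurePreserving_snd.ae (hfin h hh hhq)] with z hz1 hz2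
  simp only [hG]
  rw [ENNReal.ofReal_mul (Set.indicator_nonneg (fun _ _ => zero_le_one) _),
    ENNReal.ofReal_mul ENNReal.toReal_nonneg, ENNReal.ofReal_toReal hz1.ne,
    ENNReal.ofReal_toReal hz2.ne]
  congr 1
  by_cases hz : z.2 - z.1 ∈ E <;> simp [hz]

lemma one_le_and_ne_top_of_holderConjugate {r r' : ℝ≥0∞} (hr : 1 < r)
    (hrr : r.HolderConjugate r') : 1 ≤ r' ∧ r' ≠ ⊤ := by
  have hconj : r⁻¹ + r'⁻¹ = 1 := hrr.inv_add_inv_eq_one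
  refine ⟨by rw [← ENNReal.inv_le_inv, inv_one, ← hconj]; exact le_add_self, ?_⟩
  rintro rfl
  rw [ENNReal.inv_top, add_zero, ENNReal.inv_eq_one] at hconj
  exact hr.ne' hconj

/-- The `L^r` norm of a bounded function `u` is at most its norm as a functional on the bounded
elements of `L^{r'}`. The functional is tested with `u^(r-1)`, and with indicator functions when
`r = ∞`. -/
lemma eLpNorm_le_of_forall_lintegral_mul_le {α : Type*} [MeasurableSpace α] {μ : Measure α}
    [IsProbabilityMeasure μ] {r r' : ℝ≥0∞} (hr : 1 < r) (hrr : r.HolderConjugate r')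
    {u : α → ℝ≥0∞} (hu : Measurable u) {M : ℝ≥0∞} (hM : M ≠ ⊤) (huM : ∀ x, u x ≤ M) {B : ℝ≥0∞}
    (hB : ∀ g : α → ℝ≥0∞, Measurable g → (∃ b, b ≠ ⊤ ∧ ∀ x, g x ≤ b) →
      ∫⁻ x, u x * g x ∂μ ≤ B * eLpNorm g r' μ) :
    eLpNorm u r μ ≤ B := by
  have hconj : r⁻¹ + r'⁻¹ = 1 := hrr.inv_add_inv_eq_one
  by_cases hrt : r = ⊤
  · subst hrt
    have hr' : r' = 1 := by
      rw [ENNReal.inv_top, zero_add] at hconj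
      exact ENNReal.inv_eq_one.1 hconj
    subst hr'
    rw [eLpNorm_exponent_top]
    refine eLpNormEssSup_le_of_ae_enorm_bound ?_
    simp only [enorm_eq_self]
    refine ae_le_of_forall_setLIntegral_le_of_sigmaFinite hu fun s hs _ => ?_
    have h1 := hB (s.indicator fun _ => 1) (measurable_const.indicator hs)
      ⟨1, ENNReal.one_ne_top, fun x => Set.indicator_le_self' (fun _ _ => zero_le) x⟩
    rw [eLpNorm_indicator_const hs one_ne_zero ENNReal.one_ne_top] at h1
    rw [setLIntegral_const, ← lintegral_indicator hs]
    refine le_trans (le_of_eq (lintegral_congr fun x => ?_)) (h1.trans_eq (by simp))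
    by_cases hx : x ∈ s <;> simp [hx]
  have hr0 : r ≠ 0 := (zero_lt_one.trans hr).ne'
  obtain ⟨hr'1, hr't⟩ := one_le_and_ne_top_of_holderConjugate hr hrr
  have hr'0 : r' ≠ 0 := (zero_lt_one.trans_le hr'1).ne'
  have hr1 : 1 < r.toReal := by
    rw [← ENNReal.toReal_one]; exact (ENNReal.toReal_lt_toReal (by simp) hrt).2 hr
  have hsum : r.toReal⁻¹ + r'.toReal⁻¹ = 1 := by
    rw [← ENNReal.toReal_inv, ← ENNReal.toReal_inv,
      ← ENNReal.toReal_add (by simp [hr0]) (by simp [hr'0]), hconj, ENNReal.toReal_one]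
  set ρ := r.toReal with hρ
  set s := r'.toReal with hs
  have hs0 : 0 < s := ENNReal.toReal_pos hr'0 hr't
  set I := ∫⁻ x, u x ^ ρ ∂μ with hI
  have hIt : I ≠ ⊤ := by
    have : I ≤ ∫⁻ _x, M ^ ρ ∂μ :=
      lintegral_mono fun x => ENNReal.rpow_le_rpow (huM x) (by linarith)
    refine (this.trans_lt ?_).ne
    rw [lintegral_const, measure_univ, mul_one]
    exact ENNReal.rpow_lt_top_of_nonneg (by linarith) hM
  have hLp : eLpNorm u r μ = I ^ (1 / ρ) := by
    rw [eLpNorm_eq_lintegral_rpow_enorm_toReal hr0 hrt]; simp only [enorm_eq_self]; rfl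
  rcases eq_or_ne I 0 with hI0 | hI0
  · rw [hLp, hI0, ENNReal.zero_rpow_of_pos (by positivity)]; exact zero_le
  have key := hB (fun x => u x ^ (ρ - 1)) (hu.pow_const _) ⟨M ^ (ρ - 1),
    ENNReal.rpow_ne_top_of_nonneg (by linarith) hM,
    fun x => ENNReal.rpow_le_rpow (huM x) (by linarith)⟩
  have hrs : (ρ - 1) * s = ρ := by
    have hρ0 : ρ ≠ 0 := by linarith
    field_simp at hsum
    linarith
  have hgn : eLpNorm (fun x => u x ^ (ρ - 1)) r' μ = I ^ (1 / s) := by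
    rw [eLpNorm_eq_lintegral_rpow_enorm_toReal hr'0 hr't]
    simp only [enorm_eq_self, ← ENNReal.rpow_mul]
    rw [← hs, hrs]
  have hleft : ∫⁻ x, u x * u x ^ (ρ - 1) ∂μ = I := by
    refine lintegral_congr fun x => ?_
    have : u x * u x ^ (ρ - 1) = u x ^ (1 : ℝ) * u x ^ (ρ - 1) := by rw [ENNReal.rpow_one]
    rw [this, ← ENNReal.rpow_add_of_nonneg _ _ zero_le_one (by linarith)]
    congr 1; ring
  rw [hleft, hgn] at key
  have hs' : I ^ (1 / s) ≠ 0 := by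
    simp [ENNReal.rpow_eq_zero_iff, hI0, hIt]
  have hs't : I ^ (1 / s) ≠ ⊤ := ENNReal.rpow_ne_top_of_nonneg (by positivity) hIt
  have hsplit : I = I ^ (1 / ρ) * I ^ (1 / s) := by
    rw [← ENNReal.rpow_add _ _ hI0 hIt]
    have : 1 / ρ + 1 / s = 1 := by rw [one_div, one_div]; exact hsum
    rw [this, ENNReal.rpow_one]
  rw [hLp]
  nth_rewrite 1 [hsplit] at key
  exact (ENNReal.mul_le_mul_iff_left hs' hs't).1 key

/-- A convolution operator with nonnegative bounded kernel is bounded from `L^{p'}` to `L^p` if its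
bilinear form is bounded on `L^{p'}`. -/
lemma eLpNorm_lintegral_le_of_bilin {p p' : ℝ≥0∞} (hp1 : 1 < p) (hpp : p.HolderConjugate p')
    {G : ℝ → ℝ≥0∞} (hG : Measurable G) {M : ℝ≥0∞} (hM : M ≠ ⊤) (hGM : ∀ t, G t ≤ M) {A : ℝ≥0∞}
    {f : ℝ → ℝ≥0∞} (hf : Measurable f) (hfp : eLpNorm f p' timeMeasure ≠ ⊤)
    (hA : ∀ h : ℝ → ℝ≥0∞, Measurable h → eLpNorm h p' timeMeasure ≠ ⊤ →
      ∫⁻ z, G (z.2 - z.1) * (f z.1 * h z.2) ∂(timeMeasure.prod timeMeasure) ≤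
        A * (eLpNorm f p' timeMeasure * eLpNorm h p' timeMeasure)) :
    eLpNorm (fun t => ∫⁻ s, G (t - s) * f s ∂timeMeasure) p timeMeasure ≤
      A * eLpNorm f p' timeMeasure := by
  have hp'1 := (one_le_and_ne_top_of_holderConjugate hp1 hpp).1
  have hum : Measurable fun t => ∫⁻ s, G (t - s) * f s ∂timeMeasure := by
    refine Measurable.lintegral_prod_right' (f := fun z : ℝ × ℝ => G (z.1 - z.2) * f z.2) ?_
    exact (hG.comp (measurable_fst.sub measurable_snd)).mul (hf.comp measurable_snd)
  have hF1 : ∫⁻ x, f x ∂timeMeasure ≠ ⊤ := ((lintegral_le_eLpNorm hp'1 hf).trans_lt hfp.lt_top).ne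
  refine eLpNorm_le_of_forall_lintegral_mul_le hp1 hpp hum (ENNReal.mul_ne_top hM hF1)
    (fun t => ?_) fun h hh ⟨b, hb, hhb⟩ => ?_
  · rw [← lintegral_const_mul _ hf]
    exact lintegral_mono fun x => mul_le_mul_left (hGM _) _
  have hhp : eLpNorm h p' timeMeasure ≠ ⊤ := by
    have h1 : eLpNorm h p' timeMeasure ≤ eLpNorm (fun _ => b) p' timeMeasure :=
      eLpNorm_mono_enorm fun x => by simpa using hhb x
    rw [eLpNorm_const b (zero_lt_one.trans_le hp'1).ne' (IsProbabilityMeasure.ne_zero _),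
      measure_univ, ENNReal.one_rpow, mul_one, enorm_eq_self] at h1
    exact (h1.trans_lt hb.lt_top).ne
  rw [mul_assoc]
  refine le_trans (le_of_eq ?_) (hA h hh hhp)
  rw [lintegral_prod_symm']
  · simp only [← mul_assoc]
    refine lintegral_congr fun t => ?_
    have hm : Measurable fun x => G (t - x) * f x :=
      (hG.comp (measurable_const.sub measurable_id)).mul hf
    rw [lintegral_mul_const _ hm]
  · exact (hG.comp (measurable_snd.sub measurable_fst)).mul
      ((hf.comp measurable_fst).mul (hh.comp measurable_snd))

/-- The majorant, as a function of time alone, of the norms of the spatial convolution operators: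
weighted indicator functions of the arcs at the dyadic levels `V = 2^i`. -/
noncomputable def arcMajorant {d : ℕ} (θ : Fin d → ℝ) (N I : ℕ) (γ : ℝ) (t : ℝ) : ℝ≥0∞ :=
  ∑ j, ∑ i ∈ Finset.range I, ENNReal.ofReal ((N : ℝ) ^ γ * (2 : ℝ) ^ (-(i * (γ / 2)))) *
    (arcSet (θ j) N (2 ^ i)).indicator (fun _ => (1 : ℝ≥0∞)) t

lemma measurable_arcMajorant {d : ℕ} (θ : Fin d → ℝ) (N I : ℕ) (γ : ℝ) :
    Measurable (arcMajorant θ N I γ) := by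
  unfold arcMajorant
  refine Finset.measurable_fun_sum _ fun j _ => Finset.measurable_fun_sum _ fun i _ => ?_
  exact (measurable_const.indicator (measurableSet_arcSet _ _ _)).const_mul _

lemma sum_two_rpow_neg_le {δ : ℝ} (hδ : 0 < δ) (I : ℕ) :
    ∑ i ∈ Finset.range I, (2 : ℝ) ^ (-(i * δ)) ≤ (1 - (2 : ℝ) ^ (-δ))⁻¹ := by
  have hlt : (2 : ℝ) ^ (-δ) < 1 := Real.rpow_lt_one_of_one_lt_of_neg one_lt_two (by linarith)
  have h0 : 0 ≤ (2 : ℝ) ^ (-δ) := by positivity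
  have e : ∀ i : ℕ, (2 : ℝ) ^ (-(i * δ)) = ((2 : ℝ) ^ (-δ)) ^ i := fun i => by
    rw [← Real.rpow_natCast, ← Real.rpow_mul two_pos.le]; congr 1; ring
  simp only [e]
  rw [← tsum_geometric_of_lt_one h0 hlt]
  exact (summable_geometric_of_lt_one h0 hlt).sum_le_tsum _ (fun _ _ => by positivity)

lemma arcMajorant_le {d : ℕ} (θ : Fin d → ℝ) (N I : ℕ) {γ : ℝ} (hγ : 0 < γ) (t : ℝ) :
    arcMajorant θ N I γ t ≤
      ENNReal.ofReal (d * (1 - (2 : ℝ) ^ (-(γ / 2)))⁻¹ * (N : ℝ) ^ γ) := by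
  have h1 : ∀ j : Fin d, ∑ i ∈ Finset.range I,
      ENNReal.ofReal ((N : ℝ) ^ γ * (2 : ℝ) ^ (-(i * (γ / 2)))) *
        (arcSet (θ j) N (2 ^ i)).indicator (fun _ => (1 : ℝ≥0∞)) t ≤
      ENNReal.ofReal ((1 - (2 : ℝ) ^ (-(γ / 2)))⁻¹ * (N : ℝ) ^ γ) := by
    intro j
    calc _ ≤ ∑ i ∈ Finset.range I, ENNReal.ofReal ((N : ℝ) ^ γ * (2 : ℝ) ^ (-(i * (γ / 2)))) := by
          refine Finset.sum_le_sum fun i _ => ?_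
          by_cases ht : t ∈ arcSet (θ j) N (2 ^ i) <;> simp [ht]
      _ = ENNReal.ofReal ((∑ i ∈ Finset.range I, (2 : ℝ) ^ (-(i * (γ / 2)))) * (N : ℝ) ^ γ) := by
          rw [← ENNReal.ofReal_sum_of_nonneg (fun i _ => by positivity), Finset.sum_mul]
          congr 1
          exact Finset.sum_congr rfl fun i _ => mul_comm _ _
      _ ≤ _ := by
          refine ENNReal.ofReal_le_ofReal ?_
          gcongr
          exact sum_two_rpow_neg_le (by positivity) I
  unfold arcMajorant
  refine (Finset.sum_le_sum fun j _ => h1 j).trans_eq ?_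
  rw [Finset.sum_const, Finset.card_univ, Fintype.card_fin, nsmul_eq_mul, mul_assoc,
    ENNReal.ofReal_mul (Nat.cast_nonneg d), ENNReal.ofReal_natCast]

/-- Convolution in time with the majorant, for `p < ∞`. The levels are summed: the geometric decay
in `V` is the strict inequality `γ > 4/p`, and the mean values of the arcs are harmless because `σ`
is small. -/
lemma exists_eLpNorm_arcMajorant_le_of_ne_top (d : ℕ) {p p' : ℝ≥0∞} (hp2 : 2 < p) (hpt : p ≠ ⊤)
    (hpp : p.HolderConjugate p') {θmin : ℝ} (hθmin : 0 < θmin) {γ : ℝ}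
    (hγ : 4 * p⁻¹.toReal < γ) :
    ∃ C : ℝ, 0 < C ∧ ∀ (θ : Fin d → ℝ) (N I : ℕ) (σ : ℝ), (∀ j, θmin ≤ θ j ∧ θ j ≤ 1) → 1 ≤ N →
      4 * σ ≤ 2 - 4 * p⁻¹.toReal → (2 : ℝ) ^ I ≤ 8 * (N : ℝ) ^ (2 * σ) →
      ∀ f : ℝ → ℝ≥0∞, Measurable f → eLpNorm f p' timeMeasure ≠ ⊤ →
        eLpNorm (fun t => ∫⁻ s, arcMajorant θ N I γ (t - s) * f s ∂timeMeasure) p timeMeasure ≤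
          ENNReal.ofReal (C * (N : ℝ) ^ (γ - 4 * p⁻¹.toReal)) * eLpNorm f p' timeMeasure := by
  set η := p⁻¹.toReal with hη
  have hη0 : 0 ≤ η := ENNReal.toReal_nonneg
  have hγ0 : 0 < γ := by linarith
  -- half of the available decay pays for the loss `V^δ`
  set δ : ℝ := (γ / 2 - 2 * η) / 2 with hδ
  have hδ0 : 0 < δ := by rw [hδ]; linarith
  have hp'1 : 1 ≤ p' :=
    (one_le_and_ne_top_of_holderConjugate (ENNReal.one_lt_two.trans hp2) hpp).1
  obtain ⟨C₁, hC₁, harc⟩ := exists_enorm_bilinForm_arcSet_le hp2 hpt hpp hθmin hδ0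
  set S : ℝ := (1 - (2 : ℝ) ^ (-δ))⁻¹ with hS
  have hS0 : 0 < S := by
    have : (2 : ℝ) ^ (-δ) < 1 := Real.rpow_lt_one_of_one_lt_of_neg one_lt_two (by linarith)
    rw [hS]; exact inv_pos.2 (by linarith)
  refine ⟨(d + 1) * (C₁ * (64 + S)), by positivity, ?_⟩
  intro θ N I σ hθ hN hσ hI f hf hfp
  have hN0 : (0 : ℝ) < N := by exact_mod_cast hN
  have hN1 : (1 : ℝ) ≤ N := by exact_mod_cast hN
  refine eLpNorm_lintegral_le_of_bilin (ENNReal.one_lt_two.trans hp2) hpp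
    (measurable_arcMajorant θ N I γ) ENNReal.ofReal_ne_top (fun t => arcMajorant_le θ N I hγ0 t)
    hf hfp ?_
  intro h hh hhp
  set Z := eLpNorm f p' timeMeasure * eLpNorm h p' timeMeasure with hZ
  set wt : ℕ → ℝ := fun i => (N : ℝ) ^ γ * (2 : ℝ) ^ (-(i * (γ / 2))) with hwt
  have hwt0 : ∀ i, 0 ≤ wt i := fun i => by positivity
  set bd : ℕ → ℝ := fun i => C₁ * (((2 ^ i : ℕ) : ℝ) ^ 2 / (N : ℝ) ^ 2 +
    ((2 ^ i : ℕ) : ℝ) ^ (2 * η + δ) * (N : ℝ) ^ (-(4 * η))) with hbd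
  have hbd0 : ∀ i, 0 ≤ bd i := fun i => by positivity
  have hpiece : ∀ (j : Fin d) (i : ℕ),
      ∫⁻ z, (arcSet (θ j) N (2 ^ i)).indicator (fun _ => (1 : ℝ≥0∞)) (z.2 - z.1) *
        (f z.1 * h z.2) ∂(timeMeasure.prod timeMeasure) ≤ ENNReal.ofReal (bd i) * Z := by
    intro j i
    exact lintegral_le_of_enorm_bilinForm_le hp'1 (measurableSet_arcSet _ _ _)
      (harc (θ j) N (2 ^ i) (hθ j).1 (hθ j).2 hN Nat.one_le_two_pow) hf hh hfp hhp
  have hmeas : ∀ (j : Fin d) (i : ℕ), Measurable fun z : ℝ × ℝ =>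
      (arcSet (θ j) N (2 ^ i)).indicator (fun _ => (1 : ℝ≥0∞)) (z.2 - z.1) *
        (f z.1 * h z.2) := by
    intro j i
    have h1 : Measurable ((arcSet (θ j) N (2 ^ i)).indicator (fun _ => (1 : ℝ≥0∞))) :=
      measurable_const.indicator (measurableSet_arcSet _ _ _)
    exact (h1.comp (measurable_snd.sub measurable_fst)).mul
      ((hf.comp measurable_fst).mul (hh.comp measurable_snd))
  have hexpand : ∫⁻ z, arcMajorant θ N I γ (z.2 - z.1) * (f z.1 * h z.2)
      ∂(timeMeasure.prod timeMeasure) = ∑ j, ∑ i ∈ Finset.range I, ENNReal.ofReal (wt i) *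
        ∫⁻ z, (arcSet (θ j) N (2 ^ i)).indicator (fun _ => (1 : ℝ≥0∞)) (z.2 - z.1) *
        (f z.1 * h z.2) ∂(timeMeasure.prod timeMeasure) := by
    have e : ∀ z : ℝ × ℝ, arcMajorant θ N I γ (z.2 - z.1) * (f z.1 * h z.2) =
        ∑ j, ∑ i ∈ Finset.range I, ENNReal.ofReal (wt i) *
          ((arcSet (θ j) N (2 ^ i)).indicator (fun _ => (1 : ℝ≥0∞)) (z.2 - z.1) *
          (f z.1 * h z.2)) := fun z => by
      rw [arcMajorant, Finset.sum_mul]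
      refine Finset.sum_congr rfl fun j _ => ?_
      rw [Finset.sum_mul]
      exact Finset.sum_congr rfl fun i _ => mul_assoc _ _ _
    simp only [e]
    rw [lintegral_finsetSum _ fun j _ =>
      Finset.measurable_fun_sum _ fun i _ => (hmeas j i).const_mul _]
    refine Finset.sum_congr rfl fun j _ => ?_
    rw [lintegral_finsetSum _ fun i _ => (hmeas j i).const_mul _]
    exact Finset.sum_congr rfl fun i _ => lintegral_const_mul _ (hmeas j i)
  have hsum : ∑ i ∈ Finset.range I, wt i * bd i ≤
      C₁ * (64 + S) * (N : ℝ) ^ (γ - 4 * η) := by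
    have hNpow : (N : ℝ) ^ γ * (N : ℝ) ^ (-(4 * η)) = (N : ℝ) ^ (γ - 4 * η) := by
      rw [← Real.rpow_add hN0]; congr 1
    have hterm : ∀ i, wt i * bd i ≤ C₁ * ((N : ℝ) ^ γ * (N : ℝ) ^ (-(2 : ℝ))) * 4 ^ i +
        C₁ * (N : ℝ) ^ (γ - 4 * η) * (2 : ℝ) ^ (-(i * δ)) := by
      intro i
      have e1 : (((2 ^ i : ℕ) : ℝ)) ^ 2 / (N : ℝ) ^ 2 = 4 ^ i * (N : ℝ) ^ (-(2 : ℝ)) := by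
        rw [Real.rpow_neg hN0.le, Real.rpow_two, div_eq_mul_inv]
        congr 1
        push_cast
        rw [← pow_mul, mul_comm, pow_mul]; norm_num
      have e2 : ((2 ^ i : ℕ) : ℝ) ^ (2 * η + δ) = (2 : ℝ) ^ (i * (2 * η + δ)) := by
        push_cast
        rw [← Real.rpow_natCast, ← Real.rpow_mul two_pos.le]
      have e3 : (2 : ℝ) ^ (-(i * (γ / 2))) * (2 : ℝ) ^ (i * (2 * η + δ)) =
          (2 : ℝ) ^ (-(i * δ)) := by
        rw [← Real.rpow_add two_pos]; congr 1; rw [hδ]; ring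
      have e4 : (2 : ℝ) ^ (-(i * (γ / 2))) ≤ 1 := by
        refine Real.rpow_le_one_of_one_le_of_nonpos one_le_two ?_
        have : 0 ≤ (i : ℝ) * (γ / 2) := by positivity
        linarith
      calc wt i * bd i = C₁ * ((N : ℝ) ^ γ * (N : ℝ) ^ (-(2 : ℝ))) * 4 ^ i *
            (2 : ℝ) ^ (-(i * (γ / 2))) + C₁ * ((N : ℝ) ^ γ * (N : ℝ) ^ (-(4 * η))) *
            ((2 : ℝ) ^ (-(i * (γ / 2))) * (2 : ℝ) ^ (i * (2 * η + δ))) := by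
            simp only [hwt, hbd]; rw [e1, e2]; ring
        _ ≤ _ := by
            rw [e3, hNpow]
            exact add_le_add_left (mul_le_of_le_one_right (by positivity) e4) _
    have hgeo : ∑ i ∈ Finset.range I, (4 : ℝ) ^ i ≤ 64 * (N : ℝ) ^ (4 * σ) := by
      have h4 : (4 : ℝ) ^ I ≤ 64 * (N : ℝ) ^ (4 * σ) := by
        calc (4 : ℝ) ^ I = ((2 : ℝ) ^ I) ^ 2 := by rw [← pow_mul, mul_comm, pow_mul]; norm_num
          _ ≤ (8 * (N : ℝ) ^ (2 * σ)) ^ 2 := by gcongr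
          _ = 64 * (N : ℝ) ^ (4 * σ) := by
            rw [mul_pow, ← Real.rpow_natCast ((N : ℝ) ^ (2 * σ)), ← Real.rpow_mul hN0.le]
            norm_num
            ring_nf
      refine le_trans ?_ h4
      rw [geom_sum_eq (by norm_num)]
      have : (0 : ℝ) < 4 ^ I := by positivity
      rw [div_le_iff₀ (by norm_num)]
      linarith
    calc ∑ i ∈ Finset.range I, wt i * bd i
        ≤ ∑ i ∈ Finset.range I, (C₁ * ((N : ℝ) ^ γ * (N : ℝ) ^ (-(2 : ℝ))) * 4 ^ i +
          C₁ * (N : ℝ) ^ (γ - 4 * η) * (2 : ℝ) ^ (-(i * δ))) :=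
          Finset.sum_le_sum fun i _ => hterm i
      _ = C₁ * ((N : ℝ) ^ γ * (N : ℝ) ^ (-(2 : ℝ))) * ∑ i ∈ Finset.range I, (4 : ℝ) ^ i +
          C₁ * (N : ℝ) ^ (γ - 4 * η) * ∑ i ∈ Finset.range I, (2 : ℝ) ^ (-(i * δ)) := by
          rw [Finset.sum_add_distrib, Finset.mul_sum, Finset.mul_sum]
      _ ≤ C₁ * ((N : ℝ) ^ γ * (N : ℝ) ^ (-(2 : ℝ))) * (64 * (N : ℝ) ^ (4 * σ)) +
          C₁ * (N : ℝ) ^ (γ - 4 * η) * S := by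
          gcongr
          exact sum_two_rpow_neg_le hδ0 I
      _ = C₁ * 64 * (N : ℝ) ^ (γ - 2 + 4 * σ) + C₁ * (N : ℝ) ^ (γ - 4 * η) * S := by
          have : (N : ℝ) ^ (γ - 2 + 4 * σ) =
              (N : ℝ) ^ γ * (N : ℝ) ^ (-(2 : ℝ)) * (N : ℝ) ^ (4 * σ) := by
            rw [← Real.rpow_add hN0, ← Real.rpow_add hN0]; congr 1
          rw [this]; ring
      _ ≤ C₁ * 64 * (N : ℝ) ^ (γ - 4 * η) + C₁ * (N : ℝ) ^ (γ - 4 * η) * S := by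
          gcongr
          linarith
      _ = _ := by ring
  rw [hexpand]
  calc _ ≤ ∑ _j : Fin d, ∑ i ∈ Finset.range I, ENNReal.ofReal (wt i) *
          (ENNReal.ofReal (bd i) * Z) :=
        Finset.sum_le_sum fun j _ => Finset.sum_le_sum fun i _ => mul_le_mul_right (hpiece j i) _
    _ = d * (ENNReal.ofReal (∑ i ∈ Finset.range I, wt i * bd i) * Z) := by
        rw [Finset.sum_const, Finset.card_univ, Fintype.card_fin, nsmul_eq_mul,
          ENNReal.ofReal_sum_of_nonneg (fun i _ => mul_nonneg (hwt0 i) (hbd0 i)), Finset.sum_mul]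
        congr 1
        refine Finset.sum_congr rfl fun i _ => ?_
        rw [ENNReal.ofReal_mul (hwt0 i), mul_assoc]
    _ ≤ ENNReal.ofReal (d + 1) * (ENNReal.ofReal (C₁ * (64 + S) * (N : ℝ) ^ (γ - 4 * η)) * Z) := by
        gcongr
        rw [← ENNReal.ofReal_natCast]
        exact ENNReal.ofReal_le_ofReal (by linarith)
    _ = _ := by
        rw [← mul_assoc, ← ENNReal.ofReal_mul (by positivity)]
        congr 2
        ring

/-- Convolution in time with the majorant, including the endpoint `p = ∞`, where it is enough that
the majorant is bounded. -/
lemma exists_eLpNorm_arcMajorant_le (d : ℕ) {p p' : ℝ≥0∞} (hp2 : 2 < p)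
    (hpp : p.HolderConjugate p') {θmin : ℝ} (hθmin : 0 < θmin) {γ : ℝ}
    (hγ : 4 * p⁻¹.toReal < γ) :
    ∃ C : ℝ, 0 < C ∧ ∀ (θ : Fin d → ℝ) (N I : ℕ) (σ : ℝ), (∀ j, θmin ≤ θ j ∧ θ j ≤ 1) → 1 ≤ N →
      4 * σ ≤ 2 - 4 * p⁻¹.toReal → (2 : ℝ) ^ I ≤ 8 * (N : ℝ) ^ (2 * σ) →
      ∀ f : ℝ → ℝ≥0∞, Measurable f → eLpNorm f p' timeMeasure ≠ ⊤ →
        eLpNorm (fun t => ∫⁻ s, arcMajorant θ N I γ (t - s) * f s ∂timeMeasure) p timeMeasure ≤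
          ENNReal.ofReal (C * (N : ℝ) ^ (γ - 4 * p⁻¹.toReal)) * eLpNorm f p' timeMeasure := by
  by_cases hpt : p = ⊤
  · subst hpt
    have hp'1 : 1 ≤ p' :=
      (one_le_and_ne_top_of_holderConjugate (ENNReal.one_lt_two.trans hp2) hpp).1
    have hγ0 : 0 < γ := by simpa using hγ
    have hlt : (2 : ℝ) ^ (-(γ / 2)) < 1 :=
      Real.rpow_lt_one_of_one_lt_of_neg one_lt_two (by linarith)
    have hinv : 0 < (1 - (2 : ℝ) ^ (-(γ / 2)))⁻¹ := inv_pos.2 (by linarith)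
    refine ⟨(d + 1) * (1 - (2 : ℝ) ^ (-(γ / 2)))⁻¹, by positivity, ?_⟩
    intro θ N I σ _ _ _ _ f hf _
    rw [eLpNorm_exponent_top]
    refine essSup_le_of_ae_le _ (Filter.Eventually.of_forall fun t => ?_)
    simp only [enorm_eq_self]
    calc ∫⁻ s, arcMajorant θ N I γ (t - s) * f s ∂timeMeasure
        ≤ ∫⁻ s, ENNReal.ofReal (d * (1 - (2 : ℝ) ^ (-(γ / 2)))⁻¹ * (N : ℝ) ^ γ) * f s
            ∂timeMeasure :=
          lintegral_mono fun s => mul_le_mul_left (arcMajorant_le θ N I hγ0 _) _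
      _ = ENNReal.ofReal (d * (1 - (2 : ℝ) ^ (-(γ / 2)))⁻¹ * (N : ℝ) ^ γ) *
            ∫⁻ s, f s ∂timeMeasure := lintegral_const_mul _ hf
      _ ≤ _ := by
          have hexp : γ - 4 * (⊤ : ℝ≥0∞)⁻¹.toReal = γ := by simp
          rw [hexp]
          refine mul_le_mul' (ENNReal.ofReal_le_ofReal ?_) (lintegral_le_eLpNorm hp'1 hf)
          gcongr
          linarith
  · exact exists_eLpNorm_arcMajorant_le_of_ne_top d hp2 hpt hpp hθmin hγ

/-! ### Convolution in space -/

section Torus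

variable {d : ℕ}

lemma volume_unitAddTorus_eq :
    (volume : Measure (UnitAddTorus (Fin d))) =
      Measure.pi fun _ => (AddCircle.haarAddCircle : Measure UnitAddCircle) := by
  have h : (volume : Measure UnitAddCircle) = AddCircle.haarAddCircle := by
    rw [AddCircle.volume_eq_smul_haarAddCircle]; simp
  have h2 : (volume : Measure (UnitAddTorus (Fin d))) =
    Measure.pi fun _ => (volume : Measure UnitAddCircle) := rfl
  rw [h2, h]

instance : IsProbabilityMeasure (volume : Measure (UnitAddTorus (Fin d))) := by
  rw [volume_unitAddTorus_eq]
  exact inferInstanceAs (IsProbabilityMeasure (Measure.pi fun _ : Fin d =>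
    (AddCircle.haarAddCircle : Measure UnitAddCircle)))

/-- Bessel's inequality on the torus for `volume`. Mathlib states Parseval's identity for the
product of the Haar measures of the circles. -/
lemma sum_norm_sq_mFourierCoeff_le (s : Finset (Fin d → ℤ)) {f : UnitAddTorus (Fin d) → ℂ}
    (hf : MemLp f 2 volume) :
    ∑ k ∈ s, ‖∫ x, UnitAddTorus.mFourier (-k) x * f x‖ ^ 2 ≤ ∫ x, ‖f x‖ ^ 2 := by
  rw [volume_unitAddTorus_eq] at hf ⊢
  have h := UnitAddTorus.hasSum_sq_mFourierCoeff (d := Fin d) (hf.toLp f)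
  have h1 : ∀ k : Fin d → ℤ, UnitAddTorus.mFourierCoeff (hf.toLp f) k =
      ∫ x, UnitAddTorus.mFourier (-k) x * f x
        ∂(Measure.pi fun _ : Fin d => (AddCircle.haarAddCircle : Measure UnitAddCircle)) := by
    intro k
    refine integral_congr_ae ?_
    filter_upwards [hf.coeFn_toLp] with x hx
    rw [hx, smul_eq_mul]
  have h2 : ∫ x, ‖hf.toLp f x‖ ^ 2
        ∂(Measure.pi fun _ : Fin d => (AddCircle.haarAddCircle : Measure UnitAddCircle)) =
      ∫ x, ‖f x‖ ^ 2
        ∂(Measure.pi fun _ : Fin d => (AddCircle.haarAddCircle : Measure UnitAddCircle)) := by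
    refine integral_congr_ae ?_
    filter_upwards [hf.coeFn_toLp] with x hx
    rw [hx]
  rw [← h2]
  simp only [← h1]
  exact sum_le_hasSum s (fun _ _ => by positivity) h

lemma mFourier_sub (k : Fin d → ℤ) (x y : UnitAddTorus (Fin d)) :
    UnitAddTorus.mFourier k (x - y) =
      UnitAddTorus.mFourier k x * UnitAddTorus.mFourier (-k) y := by
  simp only [UnitAddTorus.mFourier, ContinuousMap.coe_mk, ← Finset.prod_mul_distrib]
  refine Finset.prod_congr rfl fun j _ => ?_
  simp only [fourier_apply, Pi.sub_apply, Pi.neg_apply]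
  rw [smul_sub, sub_eq_add_neg, ← neg_smul, AddCircle.toCircle_add, Circle.coe_mul]

lemma norm_mFourier_apply (k : Fin d → ℤ) (x : UnitAddTorus (Fin d)) :
    ‖UnitAddTorus.mFourier k x‖ = 1 := by
  simp only [UnitAddTorus.mFourier, ContinuousMap.coe_mk, fourier_apply, norm_prod]
  exact Finset.prod_eq_one fun _ _ => Circle.norm_coe _

/-- Convolution with a trigonometric polynomial is bounded on `L²` by its largest coefficient. -/
lemma enorm_bilinForm_trigPoly_le_two (s : Finset (Fin d → ℤ)) {c : (Fin d → ℤ) → ℂ} {M : ℝ}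
    (hM : ∀ k, ‖c k‖ ≤ M) {f h : UnitAddTorus (Fin d) → ℂ} (hf : MemLp f 2 volume)
    (hh : MemLp h 2 volume) :
    ‖bilinForm volume (fun z => ∑ k ∈ s, c k * UnitAddTorus.mFourier k (z.2 - z.1)) f h‖ₑ ≤
      ENNReal.ofReal M * (eLpNorm f 2 volume * eLpNorm h 2 volume) := by
  have hM0 : 0 ≤ M := (norm_nonneg _).trans (hM 0)
  have hfi : Integrable f volume := hf.integrable one_le_two
  have hhi : Integrable h volume := hh.integrable one_le_two
  set a : (Fin d → ℤ) → ℂ := fun k => ∫ x, UnitAddTorus.mFourier (-k) x * f x with ha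
  set b : (Fin d → ℤ) → ℂ := fun k => ∫ x, UnitAddTorus.mFourier k x * h x with hb
  have hint : ∀ (k : Fin d → ℤ) (g : UnitAddTorus (Fin d) → ℂ), Integrable g volume →
      Integrable (fun x => UnitAddTorus.mFourier k x * g x) volume := fun k g hg =>
    hg.bdd_mul (c := 1) (UnitAddTorus.mFourier k).continuous.aestronglyMeasurable
      (Filter.Eventually.of_forall fun x => (norm_mFourier_apply k x).le)
  have hform : bilinForm volume (fun z => ∑ k ∈ s, c k * UnitAddTorus.mFourier k (z.2 - z.1)) f h =
      ∑ k ∈ s, c k * (a k * b k) := by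
    rw [bilinForm]
    have e : ∀ z : UnitAddTorus (Fin d) × UnitAddTorus (Fin d),
        (∑ k ∈ s, c k * UnitAddTorus.mFourier k (z.2 - z.1)) * (f z.1 * h z.2) =
        ∑ k ∈ s, c k * ((UnitAddTorus.mFourier (-k) z.1 * f z.1) *
          (UnitAddTorus.mFourier k z.2 * h z.2)) := fun z => by
      rw [Finset.sum_mul]
      refine Finset.sum_congr rfl fun k _ => ?_
      rw [mFourier_sub]; ring
    simp only [e]
    rw [integral_finsetSum _ fun k _ => ((hint (-k) f hfi).mul_prod (hint k h hhi)).const_mul _]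
    refine Finset.sum_congr rfl fun k _ => ?_
    rw [integral_const_mul, integral_prod_mul (fun x => UnitAddTorus.mFourier (-k) x * f x)
      (fun x => UnitAddTorus.mFourier k x * h x)]
  have hA : ∑ k ∈ s, ‖a k‖ ^ 2 ≤ ∫ x, ‖f x‖ ^ 2 := sum_norm_sq_mFourierCoeff_le s hf
  have hB : ∑ k ∈ s, ‖b k‖ ^ 2 ≤ ∫ x, ‖h x‖ ^ 2 := by
    have := sum_norm_sq_mFourierCoeff_le (s.map (Equiv.neg _).toEmbedding) hh
    simpa using this
  have hnorm : ‖∑ k ∈ s, c k * (a k * b k)‖ ≤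
      M * (Real.sqrt (∫ x, ‖f x‖ ^ 2) * Real.sqrt (∫ x, ‖h x‖ ^ 2)) := by
    calc ‖∑ k ∈ s, c k * (a k * b k)‖ ≤ ∑ k ∈ s, M * (‖a k‖ * ‖b k‖) := by
          refine (norm_sum_le _ _).trans (Finset.sum_le_sum fun k _ => ?_)
          rw [norm_mul, norm_mul]
          gcongr
          exact hM k
      _ = M * ∑ k ∈ s, ‖a k‖ * ‖b k‖ := by rw [Finset.mul_sum]
      _ ≤ M * (Real.sqrt (∑ k ∈ s, ‖a k‖ ^ 2) * Real.sqrt (∑ k ∈ s, ‖b k‖ ^ 2)) := by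
          gcongr; exact Real.sum_mul_le_sqrt_mul_sqrt _ _ _
      _ ≤ _ := by gcongr
  rw [hform, eLpNorm_two_eq_ofReal hf, eLpNorm_two_eq_ofReal hh,
    ← ENNReal.ofReal_mul (Real.sqrt_nonneg _), ← ENNReal.ofReal_mul hM0, ← ofReal_norm]
  exact ENNReal.ofReal_le_ofReal hnorm

/-- Convolution with a trigonometric polynomial from `L^{r'}` to `L^r`, by interpolation between
its sup norm and its largest coefficient. -/
lemma exists_enorm_bilinForm_trigPoly_le {r r' : ℝ≥0∞} (hr : 2 < r) (hrr : r.HolderConjugate r') :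
    ∃ C : ℝ, 0 < C ∧ ∀ {d : ℕ} (s : Finset (Fin d → ℤ)) (c : (Fin d → ℤ) → ℂ) (M A : ℝ), 0 < M →
      0 < A → (∀ k, ‖c k‖ ≤ M) → (∀ x, ‖∑ k ∈ s, c k * UnitAddTorus.mFourier k x‖ ≤ A) →
      ∀ f h : UnitAddTorus (Fin d) → ℂ, Measurable f → Measurable h → eLpNorm f r' volume ≠ ⊤ →
        eLpNorm h r' volume ≠ ⊤ →
        ‖bilinForm volume (fun z => ∑ k ∈ s, c k * UnitAddTorus.mFourier k (z.2 - z.1)) f h‖ₑ ≤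
          ENNReal.ofReal (C * M ^ (2 * r⁻¹.toReal) * A ^ (1 - 2 * r⁻¹.toReal)) *
            (eLpNorm f r' volume * eLpNorm h r' volume) := by
  have hconj : r⁻¹ + r'⁻¹ = 1 := hrr.inv_add_inv_eq_one
  by_cases hrt : r = ⊤
  · subst hrt
    have hr' : r' = 1 := by
      rw [ENNReal.inv_top, zero_add] at hconj
      exact ENNReal.inv_eq_one.1 hconj
    subst hr'
    refine ⟨1, one_pos, ?_⟩
    intro d s c M A hM hA hcM hcA f h hf hh _ _
    have := enorm_bilinForm_le (μ := volume) (fun z : _ × _ => hcA (z.2 - z.1)) hf hh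
    simpa using this
  have hr0 : r ≠ 0 := (two_pos.trans hr).ne'
  have hr'0 : r' ≠ 0 := by
    rintro rfl; simp at hconj
  have hρ0 : 0 < r⁻¹.toReal := ENNReal.toReal_pos (by simpa using hrt) (by simpa using hr0)
  have hρ1 : r⁻¹.toReal < 1 / 2 := by
    have h1 : r⁻¹ < 2⁻¹ := ENNReal.inv_lt_inv.2 hr
    have := (ENNReal.toReal_lt_toReal (by simpa using hr0) (by simp)).2 h1
    simpa using this
  have hsum : r⁻¹.toReal + r'⁻¹.toReal = 1 := by
    rw [← ENNReal.toReal_add (by simp [hr0]) (by simp [hr'0]), hconj, ENNReal.toReal_one]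
  have hr't : r' ≠ ⊤ := by
    rintro rfl
    simp only [ENNReal.inv_top, ENNReal.toReal_zero, add_zero] at hsum
    linarith
  have hs1 : 1 < r' := by
    rw [← ENNReal.inv_lt_inv, inv_one, ← ENNReal.toReal_lt_toReal (by simp [hr'0]) (by simp),
      ENNReal.toReal_one]
    linarith
  have hs2 : r' < 2 := by
    rw [← ENNReal.inv_lt_inv, ← ENNReal.toReal_lt_toReal (by simp) (by simp [hr'0])]
    simp only [ENNReal.toReal_inv, ENNReal.toReal_ofNat] at hρ1 hsum ⊢
    linarith
  have hs0 : 0 < r'.toReal := ENNReal.toReal_pos hr'0 hr't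
  set ρ := r⁻¹.toReal with hρ
  have hse : 1 - r'.toReal⁻¹ = ρ := by
    rw [← ENNReal.toReal_inv]; linarith
  have hexp : 2 * (r'.toReal - 1) / (1 * r'.toReal) = 2 * ρ := by
    rw [← hse]; field_simp
  have hlam : 2 * (r'.toReal - 1) < 1 * r'.toReal := by
    have : 2 * (r'.toReal - 1) / (1 * r'.toReal) < 1 := by rw [hexp]; linarith
    rwa [div_lt_one (by positivity)] at this
  obtain ⟨C, hC, key⟩ := exists_bilinForm_le hs1 hs2 zero_le_one le_rfl hlam
  refine ⟨C.toReal + 1, by positivity, ?_⟩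
  intro d s c M A hM hA hcM hcA f h hf hh hfs hhs
  have hKm : Measurable fun z : UnitAddTorus (Fin d) × UnitAddTorus (Fin d) =>
      ∑ k ∈ s, c k * UnitAddTorus.mFourier k (z.2 - z.1) := by
    refine Continuous.measurable ?_
    refine continuous_finsetSum _ fun k _ => continuous_const.mul ?_
    exact (UnitAddTorus.mFourier k).continuous.comp (continuous_snd.sub continuous_fst)
  have := key volume _ A 0 (ENNReal.ofReal A) (ENNReal.ofReal (M / A)) hKm
    (fun z => hcA _) (by simp; positivity) ENNReal.ofReal_ne_top ?_ f h hf hh hfs hhs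
  · refine this.trans ?_
    gcongr
    rw [zero_add, hexp, ENNReal.ofReal_rpow_of_pos (by positivity)]
    have e : C = ENNReal.ofReal C.toReal := (ENNReal.ofReal_toReal hC).symm
    rw [e, ← ENNReal.ofReal_mul ENNReal.toReal_nonneg, ← ENNReal.ofReal_mul (by positivity)]
    refine ENNReal.ofReal_le_ofReal ?_
    rw [Real.div_rpow hM.le hA.le, Real.rpow_sub hA, Real.rpow_one,
      ENNReal.toReal_ofReal (by positivity)]
    have : C.toReal * A * (M ^ (2 * ρ) / A ^ (2 * ρ)) =
      C.toReal * M ^ (2 * ρ) * (A / A ^ (2 * ρ)) := by ring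
    rw [this]
    gcongr
    linarith
  · intro f h hf hh ⟨mf, hmf⟩ ⟨mh, hmh⟩
    rw [zero_mul, zero_add, sub_self, ENNReal.rpow_zero, one_mul, ENNReal.rpow_one, mul_min]
    · refine le_min (enorm_bilinForm_le (fun z : _ × _ => hcA (z.2 - z.1)) hf hh) ?_
      rw [← mul_assoc, ← ENNReal.ofReal_mul hA.le, mul_div_cancel₀ _ hA.ne']
      exact enorm_bilinForm_trigPoly_le_two s hcM
        (MemLp.of_bound hf.aestronglyMeasurable mf (Filter.Eventually.of_forall hmf))
        (MemLp.of_bound hh.aestronglyMeasurable mh (Filter.Eventually.of_forall hmh))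

end Torus

/-- The spatial convolution operators with `truncatedKernel` at a fixed time, from `L^{r'}` to
`L^r`. At a major time the dispersive bound `(N v^{-1/2})^d`, where `v` measures the quality of the
rational approximation, is interpolated with Parseval's identity, and `v` is rounded up to a power
of two. -/
lemma IsCutoff.exists_enorm_bilinForm_truncatedKernel_le {φ : ℝ → ℝ} (hφ : IsCutoff φ) (d : ℕ)
    {r r' : ℝ≥0∞} (hr : 2 < r) (hrr : r.HolderConjugate r') :
    ∃ C : ℝ, 0 < C ∧ ∀ (J : Set ℝ) (θ : Fin d → ℝ) (σ : ℝ) (N : ℕ), 1 ≤ N → 0 ≤ σ → σ ≤ 1 / 4 →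
      ∃ I : ℕ, (2 : ℝ) ^ I ≤ 8 * (N : ℝ) ^ (2 * σ) ∧
        ∀ (t : ℝ) (f h : UnitAddTorus (Fin d) → ℂ), Measurable f → Measurable h →
          eLpNorm f r' volume ≠ ⊤ → eLpNorm h r' volume ≠ ⊤ →
          ‖bilinForm volume (fun z => truncatedKernel J φ θ σ N t (z.2 - z.1)) f h‖ₑ ≤
            ENNReal.ofReal C * arcMajorant θ N I (d * (1 - 2 * r⁻¹.toReal)) t *
              (eLpNorm f r' volume * eLpNorm h r' volume) := by
  obtain ⟨C₀, hC₀, hinterp⟩ := exists_enorm_bilinForm_trigPoly_le hr hrr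
  obtain ⟨c, hc, hcoeff⟩ := hφ.exists_norm_kernelCoeff_le
  obtain ⟨B, hB, hker⟩ := hφ.exists_kernel_bound
  set ρ := r⁻¹.toReal with hρ
  set γ : ℝ := d * (1 - 2 * ρ) with hγ
  refine ⟨C₀ * (c ^ d) ^ (2 * ρ) * (B * Real.sqrt 2) ^ γ, by positivity, ?_⟩
  intro J θ σ N hN hσ0 hσ
  have hN0 : (0 : ℝ) < N := by exact_mod_cast hN
  have hNσ : 1 ≤ (N : ℝ) ^ (2 * σ) :=
    Real.one_le_rpow (by exact_mod_cast hN) (by linarith)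
  -- the largest level needed: `v ≤ 2 N^{2σ}`, and rounding up doubles it
  obtain ⟨I, hI1, hI2⟩ := exists_nat_pow_near (x := 8 * (N : ℝ) ^ (2 * σ)) (y := 2)
    (by linarith) one_lt_two
  refine ⟨I, hI1, ?_⟩
  intro t f h hf hh hfr hhr
  by_cases ht : t ∈ majorTimes J θ σ N
  swap
  · have : (fun z : UnitAddTorus (Fin d) × UnitAddTorus (Fin d) =>
        truncatedKernel J φ θ σ N t (z.2 - z.1)) = fun _ => 0 := by
      ext z; exact Set.indicator_of_notMem ht _
    rw [this]
    simp [bilinForm]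
  have hK : (fun z : UnitAddTorus (Fin d) × UnitAddTorus (Fin d) =>
      truncatedKernel J φ θ σ N t (z.2 - z.1)) = fun z =>
        ∑ k ∈ frequencyBox d N, kernelCoeff φ θ N t k * UnitAddTorus.mFourier k (z.2 - z.1) := by
    ext z
    rw [truncatedKernel, Set.indicator_of_mem ht, hφ.kernel_eq_sum θ hN]
  obtain ⟨j, a, q, hq, hv, hkb⟩ := hker J θ σ N t hN hσ ht
  set v : ℝ := q + (N : ℝ) ^ 2 * |q * (θ j * t) - a| with hvdef
  have hq1 : (1 : ℝ) ≤ q := by exact_mod_cast hq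
  have hrem : 0 ≤ (N : ℝ) ^ 2 * |q * (θ j * t) - a| := by positivity
  have hv1 : 1 ≤ v := by rw [hvdef]; linarith
  obtain ⟨i, hi1, hi2⟩ := exists_nat_pow_near hv1 one_lt_two
  have hiI : i + 1 ∈ Finset.range I := by
    rw [Finset.mem_range]
    have h1 : (2 : ℝ) ^ (i + 2) < 2 ^ (I + 1) := by
      refine lt_of_le_of_lt ?_ hI2
      rw [pow_add]; linarith
    have := (pow_lt_pow_iff_right₀ (one_lt_two (α := ℝ))).1 h1
    omega
  have hmem : t ∈ arcSet (θ j) N (2 ^ (i + 1)) := by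
    refine ⟨a, q, hq, ?_, ?_⟩
    · have : (q : ℝ) ≤ ((2 ^ (i + 1) : ℕ) : ℝ) := by push_cast; linarith
      exact_mod_cast this
    · push_cast; linarith
  set w : ℝ := (2 : ℝ) ^ (-(((i + 1 : ℕ) : ℝ) * (1 / 2))) with hw
  have hw0 : 0 < w := by positivity
  have hvw : v ^ (-(1 / 2) : ℝ) ≤ Real.sqrt 2 * w := by
    have h1 : ((2 : ℝ) ^ i) ^ (-(1 / 2) : ℝ) = Real.sqrt 2 * w := by
      rw [hw, Real.sqrt_eq_rpow, ← Real.rpow_natCast, ← Real.rpow_mul two_pos.le,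
        ← Real.rpow_add two_pos]
      congr 1
      push_cast; ring
    rw [← h1]
    exact Real.rpow_le_rpow_of_nonpos (by positivity) hi1 (by norm_num)
  have hsup : ∀ x, ‖∑ k ∈ frequencyBox d N, kernelCoeff φ θ N t k * UnitAddTorus.mFourier k x‖ ≤
      ((B * Real.sqrt 2) * (N * w)) ^ d := by
    intro x
    rw [← hφ.kernel_eq_sum θ hN]
    refine (hkb x).trans ?_
    calc (B * N * v ^ (-(1 / 2) : ℝ)) ^ d ≤ (B * N * (Real.sqrt 2 * w)) ^ d := by gcongr
      _ = _ := by congr 1; ring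
  have hApow : (((B * Real.sqrt 2) * (N * w)) ^ d) ^ (1 - 2 * ρ) =
      (B * Real.sqrt 2) ^ γ *
        ((N : ℝ) ^ γ * (2 : ℝ) ^ (-(((i + 1 : ℕ) : ℝ) * (γ / 2)))) := by
    rw [← Real.rpow_natCast, ← Real.rpow_mul (by positivity), ← hγ,
      Real.mul_rpow (by positivity) (by positivity), Real.mul_rpow hN0.le hw0.le, hw,
      ← Real.rpow_mul two_pos.le]
    congr 3
    ring
  have hmaj : ENNReal.ofReal ((N : ℝ) ^ γ * (2 : ℝ) ^ (-(((i + 1 : ℕ) : ℝ) * (γ / 2)))) ≤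
      arcMajorant θ N I γ t := by
    unfold arcMajorant
    refine le_trans ?_ (Finset.single_le_sum (fun _ _ => zero_le) (Finset.mem_univ j))
    refine le_trans ?_ (Finset.single_le_sum (fun _ _ => zero_le) hiI)
    rw [Set.indicator_of_mem hmem, mul_one]
  rw [hK]
  refine (hinterp _ _ (c ^ d) _ (by positivity) (by positivity) (hcoeff θ N t) hsup f h hf hh
    hfr hhr).trans ?_
  gcongr
  rw [hApow, ← mul_assoc, ENNReal.ofReal_mul (by positivity)]
  gcongr

/-! ### Convolution in spacetime -/

/-- Duality for complex functions: the phase of `u` is removed by the test function. -/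
lemma eLpNorm_le_of_forall_enorm_integral_mul_le {α : Type*} [MeasurableSpace α] {μ : Measure α}
    [IsProbabilityMeasure μ] {r r' : ℝ≥0∞} (hr : 1 < r) (hrr : r.HolderConjugate r') {u : α → ℂ}
    (hu : Measurable u) {m : ℝ} (hm : ∀ x, ‖u x‖ ≤ m) {B : ℝ≥0∞}
    (hB : ∀ h : α → ℂ, Measurable h → (∃ b : ℝ, ∀ x, ‖h x‖ ≤ b) →
      ‖∫ x, u x * h x ∂μ‖ₑ ≤ B * eLpNorm h r' μ) :
    eLpNorm u r μ ≤ B := by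
  rw [← eLpNorm_enorm u]
  refine eLpNorm_le_of_forall_lintegral_mul_le hr hrr hu.enorm (M := ENNReal.ofReal m)
    ENNReal.ofReal_ne_top (fun x => ?_) fun g hg ⟨b, hb, hgb⟩ => ?_
  · rw [← ofReal_norm]; exact ENNReal.ofReal_le_ofReal (hm x)
  have hgt : ∀ x, g x ≠ ⊤ := fun x => ((hgb x).trans_lt hb.lt_top).ne
  set h : α → ℂ := fun x => (starRingEnd ℂ) (u x) / (‖u x‖ : ℂ) * ((g x).toReal : ℂ) with hh
  have hhm : Measurable h := by
    refine Measurable.mul (Measurable.div ?_ ?_) (Complex.measurable_ofReal.comp hg.ennreal_toReal)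
    · exact Complex.continuous_conj.measurable.comp hu
    · exact Complex.measurable_ofReal.comp hu.norm
  have hhg : ∀ x, ‖h x‖ ≤ (g x).toReal := fun x => by
    rw [hh]; simp only
    rw [norm_mul, Complex.norm_real, Real.norm_of_nonneg ENNReal.toReal_nonneg, norm_div,
      RCLike.norm_conj, Complex.norm_real, norm_norm]
    exact mul_le_of_le_one_left ENNReal.toReal_nonneg (div_self_le_one _)
  have huh : ∀ x, u x * h x = ((‖u x‖ * (g x).toReal : ℝ) : ℂ) := fun x => by
    rw [hh]; simp only
    rcases eq_or_ne (u x) 0 with h0 | h0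
    · simp [h0]
    · have hn : (‖u x‖ : ℂ) ≠ 0 := by simpa using h0
      rw [← mul_assoc, mul_div_assoc', Complex.mul_conj, Complex.normSq_eq_norm_sq]
      push_cast
      field_simp
  have hgb' : ∀ x, (g x).toReal ≤ b.toReal := fun x => ENNReal.toReal_mono hb (hgb x)
  have hnn : ∀ x, 0 ≤ ‖u x‖ * (g x).toReal := fun x =>
    mul_nonneg (norm_nonneg _) ENNReal.toReal_nonneg
  have hint : Integrable (fun x => ‖u x‖ * (g x).toReal) μ := by
    refine Integrable.of_bound (hu.norm.mul hg.ennreal_toReal).aestronglyMeasurable (m * b.toReal)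
      (Filter.Eventually.of_forall fun x => ?_)
    rw [Real.norm_of_nonneg (hnn x)]
    exact mul_le_mul (hm x) (hgb' x) ENNReal.toReal_nonneg ((norm_nonneg _).trans (hm x))
  have key := hB h hhm ⟨b.toReal, fun x => (hhg x).trans (hgb' x)⟩
  simp only [huh] at key
  rw [integral_complex_ofReal, ← ofReal_norm, Complex.norm_real,
    Real.norm_of_nonneg (integral_nonneg hnn),
    ofReal_integral_eq_lintegral_ofReal hint (Filter.Eventually.of_forall hnn)] at key
  calc ∫⁻ x, ‖u x‖ₑ * g x ∂μ = ∫⁻ x, ENNReal.ofReal (‖u x‖ * (g x).toReal) ∂μ := by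
        refine lintegral_congr fun x => ?_
        rw [ENNReal.ofReal_mul (norm_nonneg _), ofReal_norm, ENNReal.ofReal_toReal (hgt x)]
    _ ≤ B * eLpNorm h r' μ := key
    _ ≤ _ := by
        gcongr
        refine eLpNorm_mono_enorm fun x => ?_
        rw [← ofReal_norm, enorm_eq_self, ← ENNReal.ofReal_toReal (hgt x)]
        exact ENNReal.ofReal_le_ofReal (hhg x)

section Spacetime

variable {d : ℕ}

lemma spacetimeMeasure_eq_prod :
    spacetimeMeasure d = timeMeasure.prod (volume : Measure (UnitAddTorus (Fin d))) := rfl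

lemma measurable_eLpNorm_section {q : ℝ≥0∞} (hq0 : q ≠ 0) (hqt : q ≠ ⊤)
    {F : ℝ → UnitAddTorus (Fin d) → ℂ} (hF : Measurable (Function.uncurry F)) :
    Measurable fun s => eLpNorm (F s) q volume := by
  simp only [eLpNorm_eq_lintegral_rpow_enorm_toReal hq0 hqt]
  refine Measurable.pow_const ?_ _
  exact Measurable.lintegral_prod_right' (f := fun z : ℝ × UnitAddTorus (Fin d) =>
    ‖Function.uncurry F z‖ₑ ^ q.toReal) (hF.enorm.pow_const _)

lemma lintegral_eLpNorm_le_mixedNorm {p q : ℝ≥0∞} (hp : 1 ≤ p) (hq0 : q ≠ 0) (hqt : q ≠ ⊤)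
    {F : ℝ → UnitAddTorus (Fin d) → ℂ} (hF : Measurable (Function.uncurry F)) :
    ∫⁻ s, eLpNorm (F s) q volume ∂timeMeasure ≤ mixedNorm p q F :=
  lintegral_le_eLpNorm hp (measurable_eLpNorm_section hq0 hqt hF)

/-- All measures are probability measures, so a finite mixed norm entails integrability. -/
lemma integrable_uncurry_of_mixedNorm_lt_top {p q : ℝ≥0∞} (hp : 1 ≤ p) (hq : 1 ≤ q) (hqt : q ≠ ⊤)
    {F : ℝ → UnitAddTorus (Fin d) → ℂ} (hF : Measurable (Function.uncurry F))
    (hfin : mixedNorm p q F < ⊤) : Integrable (Function.uncurry F) (spacetimeMeasure d) := by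
  refine ⟨hF.aestronglyMeasurable, ?_⟩
  rw [hasFiniteIntegral_iff_enorm, spacetimeMeasure_eq_prod, lintegral_prod _ hF.enorm.aemeasurable]
  refine lt_of_le_of_lt ?_ ((lintegral_eLpNorm_le_mixedNorm hp
    (zero_lt_one.trans_le hq).ne' hqt hF).trans_lt hfin)
  refine lintegral_mono fun s => ?_
  have hFs : Measurable (F s) := hF.comp measurable_prodMk_left
  have := eLpNorm_le_eLpNorm_of_exponent_le (μ := volume) hq hFs.aestronglyMeasurable
  rwa [eLpNorm_one_eq_lintegral_enorm] at this

lemma mixedNorm_congr_ae {p q : ℝ≥0∞} {F G : ℝ → UnitAddTorus (Fin d) → ℂ}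
    (h : Function.uncurry F =ᵐ[spacetimeMeasure d] Function.uncurry G) :
    mixedNorm p q F = mixedNorm p q G := by
  refine eLpNorm_congr_ae ?_
  rw [spacetimeMeasure_eq_prod] at h
  filter_upwards [Measure.ae_ae_of_ae_prod h] with s hs
  exact eLpNorm_congr_ae hs

lemma spacetimeConv_congr_ae (K : ℝ → UnitAddTorus (Fin d) → ℂ)
    {F G : ℝ → UnitAddTorus (Fin d) → ℂ}
    (h : Function.uncurry F =ᵐ[spacetimeMeasure d] Function.uncurry G) :
    spacetimeConv K F = spacetimeConv K G := by
  ext t x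
  refine integral_congr_ae ?_
  filter_upwards [h] with z hz
  simp only [Function.uncurry] at hz
  rw [hz]

lemma measurable_convIntegrand {K : ℝ → UnitAddTorus (Fin d) → ℂ}
    (hK : Measurable (Function.uncurry K)) {F : ℝ → UnitAddTorus (Fin d) → ℂ}
    (hF : Measurable (Function.uncurry F)) :
    Measurable fun w : (ℝ × UnitAddTorus (Fin d)) × (ℝ × UnitAddTorus (Fin d)) =>
      K (w.1.1 - w.2.1) (w.1.2 - w.2.2) * F w.2.1 w.2.2 := by
  have h1 : Measurable fun w : (ℝ × UnitAddTorus (Fin d)) × (ℝ × UnitAddTorus (Fin d)) =>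
      (w.1.1 - w.2.1, w.1.2 - w.2.2) := by fun_prop
  exact (hK.comp h1).mul (hF.comp measurable_snd)

lemma measurable_spacetimeConv {K : ℝ → UnitAddTorus (Fin d) → ℂ}
    (hK : Measurable (Function.uncurry K)) {F : ℝ → UnitAddTorus (Fin d) → ℂ}
    (hF : Measurable (Function.uncurry F)) :
    Measurable (Function.uncurry (spacetimeConv K F)) := by
  have : SFinite (spacetimeMeasure d) := by
    rw [spacetimeMeasure_eq_prod]; infer_instance
  exact (StronglyMeasurable.integral_prod_right'
    (measurable_convIntegrand hK hF).stronglyMeasurable).measurable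

lemma integrable_convIntegrand {K : ℝ → UnitAddTorus (Fin d) → ℂ}
    (hK : Measurable (Function.uncurry K)) {M : ℝ} (hM : ∀ t x, ‖K t x‖ ≤ M)
    {F : ℝ → UnitAddTorus (Fin d) → ℂ} (hF : Integrable (Function.uncurry F) (spacetimeMeasure d))
    (t : ℝ) (x : UnitAddTorus (Fin d)) :
    Integrable (fun z : ℝ × UnitAddTorus (Fin d) => K (t - z.1) (x - z.2) * F z.1 z.2)
      (spacetimeMeasure d) := by
  refine Integrable.bdd_mul (c := M) hF ?_ (Filter.Eventually.of_forall fun z => hM _ _)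
  have h1 : Measurable fun z : ℝ × UnitAddTorus (Fin d) => (t - z.1, x - z.2) := by fun_prop
  exact (hK.comp h1).aestronglyMeasurable

/-- Fubini: pairing a spacetime convolution at a fixed time with a function of space. -/
lemma integral_spacetimeConv_mul {K : ℝ → UnitAddTorus (Fin d) → ℂ}
    (hK : Measurable (Function.uncurry K)) {M : ℝ} (hM : ∀ t x, ‖K t x‖ ≤ M)
    {F : ℝ → UnitAddTorus (Fin d) → ℂ} (hF : Integrable (Function.uncurry F) (spacetimeMeasure d))
    (t : ℝ) {h : UnitAddTorus (Fin d) → ℂ} (hh : Measurable h) {b : ℝ} (hb : ∀ x, ‖h x‖ ≤ b) :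
    ∫ x, spacetimeConv K F t x * h x =
      ∫ s, bilinForm volume (fun z => K (t - s) (z.2 - z.1)) (F s) h ∂timeMeasure := by
  have hhi : Integrable h volume :=
    Integrable.of_bound hh.aestronglyMeasurable b (Filter.Eventually.of_forall hb)
  have hprod := hF
  rw [spacetimeMeasure_eq_prod] at hprod
  set G : UnitAddTorus (Fin d) → (ℝ × UnitAddTorus (Fin d)) → ℂ := fun x z =>
    K (t - z.1) (x - z.2) * (F z.1 z.2 * h x) with hG
  have hKm : Measurable fun w : UnitAddTorus (Fin d) × (ℝ × UnitAddTorus (Fin d)) =>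
      K (t - w.2.1) (w.1 - w.2.2) := by
    have h1 : Measurable fun w : UnitAddTorus (Fin d) × (ℝ × UnitAddTorus (Fin d)) =>
      (t - w.2.1, w.1 - w.2.2) := by fun_prop
    exact hK.comp h1
  have hGi : Integrable (Function.uncurry G)
      ((volume : Measure (UnitAddTorus (Fin d))).prod (timeMeasure.prod volume)) := by
    have h1 : Integrable (fun w : UnitAddTorus (Fin d) × (ℝ × UnitAddTorus (Fin d)) =>
        F w.2.1 w.2.2 * h w.1)
        ((volume : Measure (UnitAddTorus (Fin d))).prod (timeMeasure.prod volume)) := by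
      have := hhi.mul_prod hprod
      refine this.congr (Filter.Eventually.of_forall fun w => ?_)
      exact mul_comm _ _
    exact h1.bdd_mul (c := M) hKm.aestronglyMeasurable
      (Filter.Eventually.of_forall fun w => hM _ _)
  have e1 : ∫ x, spacetimeConv K F t x * h x = ∫ x, ∫ z, G x z ∂(timeMeasure.prod volume) := by
    refine integral_congr_ae (Filter.Eventually.of_forall fun x => ?_)
    simp only [hG, spacetimeConv, ← mul_assoc]
    rw [integral_mul_const]
    rfl
  have e2 := integral_prod (fun z => ∫ x, G x z) hGi.integral_prod_right
  rw [e1, integral_integral_swap hGi, e2]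
  refine integral_congr_ae ?_
  filter_upwards [hprod.prod_right_ae] with s hs
  have hs' : Integrable (F s) volume := hs
  rw [bilinForm, integral_prod]
  refine (hs'.mul_prod hhi).bdd_mul (c := M) ?_ (Filter.Eventually.of_forall fun z => hM _ _)
  have h1 : Measurable fun z : UnitAddTorus (Fin d) × UnitAddTorus (Fin d) =>
      (t - s, z.2 - z.1) := by fun_prop
  exact (hK.comp h1).aestronglyMeasurable

/-- If the spatial convolution operators with `K t` are bounded by `k t` from `L^{r'}` to `L^r`,
then the `L^r` norms of a spacetime convolution with `K` are at most a convolution in time with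
`k`. -/
lemma eLpNorm_spacetimeConv_le {r r' : ℝ≥0∞} (hr : 1 < r) (hrr : r.HolderConjugate r')
    (hr't : r' ≠ ⊤) {K : ℝ → UnitAddTorus (Fin d) → ℂ}
    (hK : Measurable (Function.uncurry K)) {M : ℝ} (hM : ∀ t x, ‖K t x‖ ≤ M) {k : ℝ → ℝ≥0∞}
    (hk : Measurable k)
    (hKk : ∀ (t : ℝ) (f h : UnitAddTorus (Fin d) → ℂ), Measurable f → Measurable h →
      eLpNorm f r' volume ≠ ⊤ → eLpNorm h r' volume ≠ ⊤ →
      ‖bilinForm volume (fun z => K t (z.2 - z.1)) f h‖ₑ ≤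
        k t * (eLpNorm f r' volume * eLpNorm h r' volume))
    {F : ℝ → UnitAddTorus (Fin d) → ℂ} (hFm : Measurable (Function.uncurry F))
    (hF : Integrable (Function.uncurry F) (spacetimeMeasure d))
    (hfin : ∫⁻ s, eLpNorm (F s) r' volume ∂timeMeasure ≠ ⊤) (t : ℝ) :
    eLpNorm (spacetimeConv K F t) r volume ≤
      ∫⁻ s, k (t - s) * eLpNorm (F s) r' volume ∂timeMeasure := by
  have hconj : r⁻¹ + r'⁻¹ = 1 := hrr.inv_add_inv_eq_one
  have hr'0 : r' ≠ 0 := by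
    rintro rfl; simp at hconj
  have hsec := measurable_eLpNorm_section hr'0 hr't hFm
  have hmeas : Measurable fun s => k (t - s) * eLpNorm (F s) r' volume :=
    (hk.comp (measurable_const.sub measurable_id)).mul hsec
  have hbound : ∀ x, ‖spacetimeConv K F t x‖ ≤
      M * ∫ z, ‖Function.uncurry F z‖ ∂(spacetimeMeasure d) := by
    intro x
    rw [← integral_const_mul]
    refine norm_integral_le_of_norm_le (hF.norm.const_mul M)
      (Filter.Eventually.of_forall fun z => ?_)
    rw [norm_mul]
    exact mul_le_mul_of_nonneg_right (hM _ _) (norm_nonneg _)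
  have hum : Measurable (spacetimeConv K F t) :=
    (measurable_spacetimeConv hK hFm).comp measurable_prodMk_left
  refine eLpNorm_le_of_forall_enorm_integral_mul_le hr hrr hum hbound ?_
  intro h hh ⟨b, hb⟩
  have hhr : eLpNorm h r' volume ≠ ⊤ :=
    (MemLp.of_bound hh.aestronglyMeasurable b (Filter.Eventually.of_forall hb)).2.ne
  rw [integral_spacetimeConv_mul hK hM hF t hh hb, ← lintegral_mul_const _ hmeas]
  refine (enorm_integral_le_lintegral_enorm _).trans (lintegral_mono_ae ?_)
  filter_upwards [ae_lt_top hsec hfin] with s hs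
  rw [mul_assoc]
  exact hKk (t - s) (F s) h (hFm.comp measurable_prodMk_left) hh hs.ne hhr

end Spacetime

/-! ### The estimate -/

/-- The mixed norm estimate for measurable representatives. -/
lemma IsCutoff.exists_mixedNorm_spacetimeConv_le {φ : ℝ → ℝ} (hφ : IsCutoff φ) (d : ℕ)
    {p p' r r' : ℝ≥0∞} (hp : 2 < p) (hr : 2 < r) (hpp : p.HolderConjugate p')
    (hrr : r.HolderConjugate r') (hpr : 4 * p⁻¹.toReal < d * (1 - 2 * r⁻¹.toReal)) {θmin : ℝ}
    (hθmin : 0 < θmin) :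
    ∃ C : ℝ, 0 < C ∧ ∀ (J : Set ℝ) (θ : Fin d → ℝ) (σ : ℝ) (N : ℕ), MeasurableSet J →
      (∀ j, θmin ≤ θ j ∧ θ j ≤ 1) → 1 ≤ N → 0 ≤ σ → σ ≤ 1 / 4 → 4 * σ ≤ 2 - 4 * p⁻¹.toReal →
      ∀ F : ℝ → UnitAddTorus (Fin d) → ℂ, Measurable (Function.uncurry F) → mixedNorm p' r' F < ⊤ →
        mixedNorm p r (spacetimeConv (truncatedKernel J φ θ σ N) F) ≤
          ENNReal.ofReal (C * (N : ℝ) ^ (d * (1 - 2 * r⁻¹.toReal) - 4 * p⁻¹.toReal)) *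
            mixedNorm p' r' F := by
  obtain ⟨C₁, hC₁, hspace⟩ := hφ.exists_enorm_bilinForm_truncatedKernel_le d hr hrr
  obtain ⟨C₂, hC₂, htime⟩ := exists_eLpNorm_arcMajorant_le d hp hpp hθmin hpr
  refine ⟨C₁ * C₂, by positivity, ?_⟩
  intro J θ σ N hJ hθ hN hσ0 hσ hσp F hF hfin
  obtain ⟨I, hI, hform⟩ := hspace J θ σ N hN hσ0 hσ
  obtain ⟨M, hM0, hM⟩ := hφ.exists_norm_kernel_le θ hN
  have hp'1 := (one_le_and_ne_top_of_holderConjugate (ENNReal.one_lt_two.trans hp) hpp).1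
  obtain ⟨hr'1, hr't⟩ := one_le_and_ne_top_of_holderConjugate (ENNReal.one_lt_two.trans hr) hrr
  have hr'0 : r' ≠ 0 := (zero_lt_one.trans_le hr'1).ne'
  have hK : Measurable (Function.uncurry (truncatedKernel J φ θ σ N)) :=
    hφ.measurable_truncatedKernel hJ θ σ hN
  have hKM : ∀ t x, ‖truncatedKernel J φ θ σ N t x‖ ≤ M := fun t x => by
    refine (norm_indicator_le_norm_self _ _).trans (hM t x)
  set γ : ℝ := d * (1 - 2 * r⁻¹.toReal) with hγ
  have hint := integrable_uncurry_of_mixedNorm_lt_top hp'1 hr'1 hr't hF hfin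
  have hL1 := ((lintegral_eLpNorm_le_mixedNorm hp'1 hr'0 hr't hF).trans_lt hfin).ne
  have hsec := measurable_eLpNorm_section hr'0 hr't hF
  have hpoint : ∀ t, eLpNorm (spacetimeConv (truncatedKernel J φ θ σ N) F t) r volume ≤
      ENNReal.ofReal C₁ *
        ∫⁻ s, arcMajorant θ N I γ (t - s) * eLpNorm (F s) r' volume ∂timeMeasure := by
    intro t
    have hm := measurable_arcMajorant θ N I γ
    have h1 := eLpNorm_spacetimeConv_le (ENNReal.one_lt_two.trans hr) hrr hr't hK hKM
      (hm.const_mul (ENNReal.ofReal C₁)) hform hF hint hL1 t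
    have hm2 : Measurable fun s => arcMajorant θ N I γ (t - s) * eLpNorm (F s) r' volume :=
      (hm.comp (measurable_const.sub measurable_id)).mul hsec
    simp only [mul_assoc] at h1
    rwa [lintegral_const_mul _ hm2] at h1
  have hconv : Measurable fun t => ∫⁻ s, arcMajorant θ N I γ (t - s) *
      eLpNorm (F s) r' volume ∂timeMeasure := by
    refine Measurable.lintegral_prod_right' (f := fun z : ℝ × ℝ =>
      arcMajorant θ N I γ (z.1 - z.2) * eLpNorm (F z.2) r' volume) ?_
    exact ((measurable_arcMajorant θ N I γ).comp (measurable_fst.sub measurable_snd)).mul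
      (hsec.comp measurable_snd)
  have h2 : mixedNorm p r (spacetimeConv (truncatedKernel J φ θ σ N) F) ≤
      ENNReal.ofReal C₁ * eLpNorm (fun t => ∫⁻ s, arcMajorant θ N I γ (t - s) *
        eLpNorm (F s) r' volume ∂timeMeasure) p timeMeasure :=
    eLpNorm_le_mul_eLpNorm_of_ae_le_mul'' p
      hconv.aestronglyMeasurable (Filter.Eventually.of_forall hpoint)
  refine h2.trans ?_
  rw [mul_assoc C₁, ENNReal.ofReal_mul hC₁.le, mul_assoc]
  gcongr
  exact htime θ N I σ hθ hN hσp hI _ hsec hfin.ne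

end TorusStrichartz

theorem proposition2p3 (d : ℕ) (p r : ℝ≥0∞) (hp : 2 < p) (hr : 2 < r)
    (hpr : 0 < (d : ℝ) / 2 - 2 * p⁻¹.toReal - d * r⁻¹.toReal) :
    ∃ σ₀ : ℝ, 0 < σ₀ ∧
      ∀ φ : ℝ → ℝ, TorusStrichartz.IsCutoff φ →
      ∀ θmin : ℝ, 0 < θmin →
      ∃ C : ℝ, 0 < C ∧
        ∀ θ : Fin d → ℝ, (∀ j, θmin ≤ θ j ∧ θ j ≤ 1) →
        ∀ σ : ℝ, 0 < σ → σ ≤ σ₀ →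
        ∀ J ∈ ({Set.Icc 0 1, Set.Icc (-1) 1} : Set (Set ℝ)),
        ∀ (n : ℕ) (N : ℝ), N = 2 ^ n →
        ∀ p' r' : ℝ≥0∞, p.HolderConjugate p' → r.HolderConjugate r' →
        ∀ F : ℝ → UnitAddTorus (Fin d) → ℂ,
          AEStronglyMeasurable (Function.uncurry F) (TorusStrichartz.spacetimeMeasure d) →
          TorusStrichartz.mixedNorm p' r' F < ⊤ →
          (∀ (t : ℝ) (x : UnitAddTorus (Fin d)),
            Integrable (fun z : ℝ × UnitAddTorus (Fin d) =>
              TorusStrichartz.truncatedKernel J φ θ σ N (t - z.1) (x - z.2) * F z.1 z.2)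
              (TorusStrichartz.spacetimeMeasure d)) ∧
          AEStronglyMeasurable (Function.uncurry (TorusStrichartz.spacetimeConv
            (TorusStrichartz.truncatedKernel J φ θ σ N) F))
            (TorusStrichartz.spacetimeMeasure d) ∧
          TorusStrichartz.mixedNorm p r (TorusStrichartz.spacetimeConv
              (TorusStrichartz.truncatedKernel J φ θ σ N) F) ≤
            ENNReal.ofReal
                (C * N ^ (2 * ((d : ℝ) / 2 - 2 * p⁻¹.toReal - d * r⁻¹.toReal))) *
              TorusStrichartz.mixedNorm p' r' F := by
  have hη : p⁻¹.toReal < 1 / 2 := by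
    have h1 : p⁻¹ < 2⁻¹ := ENNReal.inv_lt_inv.2 hp
    have hp0 : p ≠ 0 := (two_pos.trans hp).ne'
    have := (ENNReal.toReal_lt_toReal (by simpa using hp0) (by simp)).2 h1
    simpa using this
  have hγ : 4 * p⁻¹.toReal < d * (1 - 2 * r⁻¹.toReal) := by linarith
  -- `σ ≤ 1/4` makes the Weyl bound available on the major arcs, and `σ ≤ 1/2 - 1/p` makes the mean
  -- values of the arcs negligible
  refine ⟨min (1 / 4) (1 / 2 - p⁻¹.toReal), lt_min (by norm_num) (by linarith), ?_⟩
  intro φ hφ θmin hθmin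
  have hp1 : 1 ≤ p := (ENNReal.one_lt_two.trans hp).le
  have hr1 : 1 ≤ r := (ENNReal.one_lt_two.trans hr).le
  have hpc : p.HolderConjugate p.conjExponent := .conjExponent hp1
  have hrc : r.HolderConjugate r.conjExponent := .conjExponent hr1
  obtain ⟨C, hC, key⟩ := hφ.exists_mixedNorm_spacetimeConv_le d hp hr hpc hrc hγ hθmin
  refine ⟨C, hC, ?_⟩
  intro θ hθ σ hσ0 hσ J hJ n N hN p' r' hpp hrr F hF hfin
  obtain rfl : p' = p.conjExponent := hpp.conjExponent_eq.symm
  obtain rfl : r' = r.conjExponent := hrr.conjExponent_eq.symm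
  have hJm : MeasurableSet J := by
    rcases hJ with rfl | rfl <;> exact measurableSet_Icc
  obtain rfl : N = ((2 ^ n : ℕ) : ℝ) := by rw [hN]; push_cast; rfl
  have hN1 : 1 ≤ 2 ^ n := Nat.one_le_two_pow
  -- replace `F` by a measurable representative
  set G : ℝ → UnitAddTorus (Fin d) → ℂ := fun t x => hF.mk _ (t, x) with hG
  have hGm : Measurable (Function.uncurry G) := hF.stronglyMeasurable_mk.measurable
  have hFG : Function.uncurry F =ᵐ[TorusStrichartz.spacetimeMeasure d] Function.uncurry G :=
    hF.ae_eq_mk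
  rw [TorusStrichartz.mixedNorm_congr_ae hFG] at hfin ⊢
  rw [TorusStrichartz.spacetimeConv_congr_ae _ hFG]
  have hK := hφ.measurable_truncatedKernel hJm θ σ hN1
  obtain ⟨M, -, hM⟩ := hφ.exists_norm_kernel_le θ hN1
  have hKM : ∀ t x, ‖TorusStrichartz.truncatedKernel J φ θ σ (2 ^ n : ℕ) t x‖ ≤ M := fun t x =>
    (norm_indicator_le_norm_self _ _).trans (hM t x)
  obtain ⟨hr'1, hr't⟩ := TorusStrichartz.one_le_and_ne_top_of_holderConjugate
    (ENNReal.one_lt_two.trans hr) hrr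
  have hp'1 := (TorusStrichartz.one_le_and_ne_top_of_holderConjugate
    (ENNReal.one_lt_two.trans hp) hpp).1
  have hFi : Integrable (Function.uncurry F) (TorusStrichartz.spacetimeMeasure d) :=
    (TorusStrichartz.integrable_uncurry_of_mixedNorm_lt_top hp'1 hr'1 hr't hGm hfin).congr hFG.symm
  refine ⟨fun t x => ?_, ?_, ?_⟩
  · exact TorusStrichartz.integrable_convIntegrand hK hKM hFi t x
  · exact (TorusStrichartz.measurable_spacetimeConv hK hGm).aestronglyMeasurable
  · have hexp : 2 * ((d : ℝ) / 2 - 2 * p⁻¹.toReal - d * r⁻¹.toReal) =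
        d * (1 - 2 * r⁻¹.toReal) - 4 * p⁻¹.toReal := by ring
    rw [hexp]
    refine key J θ σ (2 ^ n) hJm hθ hN1 hσ0.le (hσ.trans (min_le_left _ _)) ?_ G hGm hfin
    have := hσ.trans (min_le_right _ _)
    linarith
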